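/- Let $\omega\in C^\infty(\mathbb R)$ with $\omega\ge\omega_\ast>0$ for a constant $\omega_\ast$, let $y_\ast,p_\ast,u_\ast\in\mathbb R$, $\theta_\ast:=u_\ast^2/(2\omega(y_\ast))$, $T>0$, $\varepsilon_0>0$. For $0<\varepsilon<\varepsilon_0$ let $(\phi_\varepsilon,\theta_\varepsilon,y_\varepsilon,p_\varepsilon)$ be the solution on $[0,T]$ of the canonical equations $\dot\phi=\partial_\theta E_\varepsilon$, $\dot\theta=-\partial_\phi E_\varepsilon$, $\dot y=\partial_pE_\varepsilon$, $\dot p=-\partial_yE_\varepsilon$ of $$E_\varepsilon=\tfrac12p^2+\theta\,\omega(y)+\varepsilon\frac{\theta p\,\omega'(y)}{2\omega(y)}\sin(2\varepsilon^{-1}\phi)+\frac{\varepsilon^2}{8}\Big(\frac{\theta\omega'(y)}{\omega(y)}\sin(2\varepsilon^{-1}\phi)\Big)^2$$ with initial values $\phi(0)=0$, $\theta(0)=\theta_\ast$, $y(0)=y_\ast$, $p(0)=p_\ast$, and let $(\phi_0,\theta_0,y_0,p_0)$ solve on $[0,T]$, with the same initial values, $\dot\phi_0=\omega(y_0)$,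 $\dot\theta_0=0$, $\dot y_0=p_0$, $\dot p_0=-\theta_\ast\omega'(y_0)$. Write $D_t^kD_y^lL_0:=\frac{d^k}{dt^k}\big[(\log\omega)^{(l)}(y_0(t))\big]$. For $t\in[0,T]$, $s\in\mathcal S$ (the circle, i.e. $[0,1)$ with endpoints identified) put $$[\theta_1](t,s)=-\frac{\theta_\ast D_tL_0}{2\omega(y_0)}\sin(2\pi s),\quad[\phi_2](t,s)=-\frac{D_tL_0}{4\omega(y_0)}\cos(2\pi s),\quad[y_2](t,s)=-\frac{\theta_\ast D_yL_0}{4\omega(y_0)}\cos(2\pi s),\quad[p_2](t,s)=\frac{d}{dt}\Big(\frac{\theta_\ast D_yL_0}{4\omega(y_0)}\Big)\cos(2\pi s),$$ $$[\theta_2](t,s)=-\theta_\ast D_yL_0\,[y_2](t,s)-\frac{p_0}{\omega(y_0)}[p_2](t,s)+\frac{\theta_\ast^2(D_yL_0)^2}{16\,\omega(y_0)}\cos(4\pi s)-\frac{\theta_\ast D_tL_0}{\omega(y_0)}\bar\phi_2\cos(2\pi s),$$ and let $[\,\cdot\,]^\varepsilon(t)$ denote the same expressions with $2\pi s$ replaced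 by $2\varepsilon^{-1}\phi_0(t)$ and $4\pi s$ by $4\varepsilon^{-1}\phi_0(t)$. Put $$\theta_1^\varepsilon=\frac{\theta_\varepsilon-\theta_\ast}{\varepsilon},\quad\phi_2^\varepsilon=\frac{\phi_\varepsilon-\phi_0}{\varepsilon^2},\quad y_2^\varepsilon=\frac{y_\varepsilon-y_0}{\varepsilon^2},\quad p_2^\varepsilon=\frac{p_\varepsilon-p_0}{\varepsilon^2},\quad\theta_2^\varepsilon=\frac{\theta_1^\varepsilon-[\theta_1]^\varepsilon}{\varepsilon}.$$ Two-scale convergence. For $v:\mathbb R\to\mathbb R$ continuous let $h_\varepsilon(t,s)=\varepsilon\lfloor t/\varepsilon\rfloor+\varepsilon s$ and $L_\varepsilon v=(J\circ I_\varepsilon)(v\circ h_\varepsilon)$, where $I_\varepsilon$ interpolates linearly in $t$ between the nodes $\varepsilon\mathbb Z$ and $(Jw)(t,s)=w(t,s)-s(\lim_{r\to1^-}w(t,r)-w(t,0))$ for $s\in[0,1)$. Functions $v_\varepsilon$ on $[0,R]$ two-scale converge strongly to $U\in C([0,R]\times\mathcal S)$ if they have, for small $\varepsilon$, continuous extensions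 $V_\varepsilon$ to $\mathbb R$ with $L_\varepsilon V_\varepsilon\to U$ uniformly on $[0,R]\times\mathcal S$ as $\varepsilon\to0^+$. Functions $u_\varepsilon$ on $[0,T]$ two-scale converge strongly to $U\in C([0,T]\times\mathcal S)$ with respect to $\phi_0^{-1}\circ\pi$ if $r\mapsto u_\varepsilon(\phi_0^{-1}(\pi r))$ two-scale converges strongly to $U(\phi_0^{-1}(\pi r),s)$ in $C([0,\phi_0(T)/\pi]\times\mathcal S)$. Then the initial value problem $$\dot{\bar\phi}_2=\omega'(y_0)\bar y_2+\frac{\theta_\ast(D_yL_0)^2}{8}-\frac{(D_tL_0)^2}{8\omega(y_0)},\qquad\dot{\bar\theta}_2=\frac{d}{dt}\frac{\theta_\ast(D_tL_0)^2}{8\omega^2(y_0)},\qquad\dot{\bar y}_2=\bar p_2-\frac{\theta_\ast D_yL_0D_tL_0}{4\omega(y_0)},$$ $$\dot{\bar p}_2=-\omega'(y_0)\bar\theta_2-\theta_\ast\omega''(y_0)\bar y_2-\frac{\theta_\ast^2D_yL_0D_y^2L_0}{8}+\frac{\theta_\ast D_tL_0D_tD_yL_0}{4\omega(y_0)},$$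 with the ($\varepsilon$-independent) initial values $\bar\phi_2(0)=-[\phi_2]^\varepsilon(0)$, $\bar\theta_2(0)=-[\theta_2]^\varepsilon(0)$, $\bar y_2(0)=-[y_2]^\varepsilon(0)$, $\bar p_2(0)=-[p_2]^\varepsilon(0)$, has a unique solution on $[0,T]$, and as $\varepsilon\to0^+$ the uniform convergences $$\theta_1^\varepsilon-[\theta_1]^\varepsilon\to0,\quad\phi_2^\varepsilon-[\phi_2]^\varepsilon\to\bar\phi_2,\quad y_2^\varepsilon-[y_2]^\varepsilon\to\bar y_2,\quad p_2^\varepsilon-[p_2]^\varepsilon\to\bar p_2,\quad\theta_2^\varepsilon-[\theta_2]^\varepsilon\to\bar\theta_2\quad\text{in }C([0,T])$$ are respectively equivalent to the strong two-scale convergences with respect to $\phi_0^{-1}\circ\pi$ in $C([0,T]\times\mathcal S)$ $$\theta_1^\varepsilon\to[\theta_1],\quad\phi_2^\varepsilon\to\bar\phi_2+[\phi_2],\quad y_2^\varepsilon\to\bar y_2+[y_2],\quad p_2^\varepsilon\to\bar p_2+[p_2],\quad\theta_2^\varepsilon\to\bar\theta_2+[\theta_2],$$ and all of them hold. The equivalence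 is not only between these true statements: for each of the five quantities and every $a\in C([0,T])$, uniform convergence of (quantity $-$ oscillating term) to $a$ is equivalent to two-scale convergence of the quantity to $a\,+$ profile. -/

import Mathlib

open Filter Topology Set
open scoped ContDiff

noncomputable section

namespace FastSlow

/-! ### Strong two-scale convergence in `C⁰`

`𝒮` is the set `[0,1)` with the topology of the circle; a function on `𝒮` is represented by its
`1`-periodic extension to `ℝ`. -/

/-- The two-scale composition function `h_ε(t,s) = ε N(t/ε) + ε s`. -/
def compFun (ε t s : ℝ) : ℝ := ε * (⌊t / ε⌋ : ℝ) + ε * s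

/-- Linear interpolation in the first argument between the nodes of the grid `εℤ`. -/
def interpI (ε : ℝ) (w : ℝ → ℝ → ℝ) (t s : ℝ) : ℝ :=
  w (ε * (⌊t / ε⌋ : ℝ)) s
    + Int.fract (t / ε) * (w (ε * (⌊t / ε⌋ : ℝ) + ε) s - w (ε * (⌊t / ε⌋ : ℝ)) s)

/-- Linear correction in the second argument (`s ∈ [0,1)`), which makes the result periodic. -/
def interpJ (w : ℝ → ℝ → ℝ) (t s : ℝ) : ℝ :=
  w t s - s * (limUnder (𝓝[<] (1 : ℝ)) (fun r => w t r) - w t 0)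

/-- `L_ε v = (J ∘ I_ε)(v ∘ h_ε)`. -/
def interpL (ε : ℝ) (v : ℝ → ℝ) : ℝ → ℝ → ℝ :=
  interpJ (interpI ε (fun t s => v (compFun ε t s)))

/-- `U ∈ C([0,R] × 𝒮)`. -/
def IsContTorus (R : ℝ) (U : ℝ → ℝ → ℝ) : Prop :=
  ContinuousOn (fun x : ℝ × ℝ => U x.1 x.2) (Icc 0 R ×ˢ univ) ∧
    ∀ t ∈ Icc 0 R, Function.Periodic (U t) 1

/-- Strong two-scale convergence `v_ε → U` in `C([0,R] × 𝒮)` as `ε → 0⁺`, for functions `v_ε` on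
`[0,R]`. As `L_ε` acts on continuous functions on `ℝ`, the functions `v_ε` (of which only the
values on `[0,R]` matter) are first extended continuously to `ℝ`. -/
def StrongTwoScale (R : ℝ) (v : ℝ → ℝ → ℝ) (U : ℝ → ℝ → ℝ) : Prop :=
  IsContTorus R U ∧
    ∃ V : ℝ → ℝ → ℝ,
      (∀ᶠ ε in 𝓝[>] (0 : ℝ), Continuous (V ε) ∧ EqOn (V ε) (v ε) (Icc 0 R)) ∧
      TendstoUniformlyOn (fun ε (x : ℝ × ℝ) => interpL ε (V ε) x.1 x.2)
        (fun x => U x.1 x.2) (𝓝[>] 0) (Icc 0 R ×ˢ Ico 0 1)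

/-- The change of time `φ₀⁻¹ ∘ π : [0, φ₀(T)/π] → [0,T]`, `r ↦ φ₀⁻¹(π r)`. -/
def timeChange (T : ℝ) (φ₀ : ℝ → ℝ) (r : ℝ) : ℝ :=
  Function.invFunOn φ₀ (Icc 0 T) (Real.pi * r)

/-- Strong two-scale convergence `u_ε → U` in `C([0,T] × 𝒮)` with respect to `φ₀⁻¹ ∘ π`. -/
def TwoScaleWrt (T : ℝ) (φ₀ : ℝ → ℝ) (u : ℝ → ℝ → ℝ) (U : ℝ → ℝ → ℝ) : Prop :=
  IsContTorus T U ∧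
    StrongTwoScale (φ₀ T / Real.pi) (fun ε r => u ε (timeChange T φ₀ r))
      (fun r s => U (timeChange T φ₀ r) s)

/-- Uniform convergence on `[0,T]` as `ε → 0⁺`. -/
def UnifConv (T : ℝ) (u : ℝ → ℝ → ℝ) (a : ℝ → ℝ) : Prop :=
  TendstoUniformlyOn u a (𝓝[>] 0) (Icc 0 T)

/-! ### The model problem in action-angle variables -/

/-- The data of the model problem: the frequency `ω` and the initial values of `y`, `ẏ`, `ż`. -/
structure Model where
  freq : ℝ → ℝ
  yStar : ℝ
  pStar : ℝ
  uStar : ℝ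

/-- Four functions of time, `(φ, θ, y, p)`. -/
structure Path where
  φ : ℝ → ℝ
  θ : ℝ → ℝ
  y : ℝ → ℝ
  p : ℝ → ℝ

variable (M : Model)

/-- `θ_* = u_*² / (2 ω(y_*))`. -/
def Model.θStar : ℝ := M.uStar ^ 2 / (2 * M.freq M.yStar)

/-- `X = (φ_ε, θ_ε, y_ε, p_ε)` solves on `[0,T]` the equations of motion in action-angle variables,
with their initial values. -/
structure IsSolution (T ε : ℝ) (X : Path) : Prop where
  init : X.φ 0 = 0 ∧ X.θ 0 = M.θStar ∧ X.y 0 = M.yStar ∧ X.p 0 = M.pStar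
  eq_φ : ∀ t ∈ Icc 0 T, HasDerivWithinAt X.φ
    (M.freq (X.y t)
      + ε * (X.p t * deriv M.freq (X.y t) / (2 * M.freq (X.y t))) * Real.sin (2 * ε⁻¹ * X.φ t)
      + ε ^ 2 * (X.θ t * deriv M.freq (X.y t) ^ 2 / (4 * M.freq (X.y t) ^ 2))
          * Real.sin (2 * ε⁻¹ * X.φ t) ^ 2) (Icc 0 T) t
  eq_θ : ∀ t ∈ Icc 0 T, HasDerivWithinAt X.θ
    (-(X.θ t * X.p t * deriv M.freq (X.y t) / M.freq (X.y t)) * Real.cos (2 * ε⁻¹ * X.φ t)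
      - ε * (X.θ t ^ 2 * deriv M.freq (X.y t) ^ 2 / (4 * M.freq (X.y t) ^ 2))
          * Real.sin (4 * ε⁻¹ * X.φ t)) (Icc 0 T) t
  eq_y : ∀ t ∈ Icc 0 T, HasDerivWithinAt X.y
    (X.p t + ε * (X.θ t * deriv M.freq (X.y t) / (2 * M.freq (X.y t)))
      * Real.sin (2 * ε⁻¹ * X.φ t)) (Icc 0 T) t
  eq_p : ∀ t ∈ Icc 0 T, HasDerivWithinAt X.p
    (-(X.θ t * deriv M.freq (X.y t))
      + ε * (X.θ t * X.p t * deriv M.freq (X.y t) ^ 2 / (2 * M.freq (X.y t) ^ 2))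
          * Real.sin (2 * ε⁻¹ * X.φ t)
      - ε * (X.θ t * X.p t * iteratedDeriv 2 M.freq (X.y t) / (2 * M.freq (X.y t)))
          * Real.sin (2 * ε⁻¹ * X.φ t)
      + ε ^ 2 * (X.θ t ^ 2 * deriv M.freq (X.y t) ^ 3 / (4 * M.freq (X.y t) ^ 3))
          * Real.sin (2 * ε⁻¹ * X.φ t) ^ 2
      - ε ^ 2 * (X.θ t ^ 2 * deriv M.freq (X.y t) * iteratedDeriv 2 M.freq (X.y t)
            / (4 * M.freq (X.y t) ^ 2))
          * Real.sin (2 * ε⁻¹ * X.φ t) ^ 2) (Icc 0 T) t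

/-- `X₀ = (φ₀, θ₀, y₀, p₀)` solves on `[0,T]` the leading-order (limit) equations. -/
structure IsLeadingOrder (T : ℝ) (X₀ : Path) : Prop where
  init : X₀.φ 0 = 0 ∧ X₀.θ 0 = M.θStar ∧ X₀.y 0 = M.yStar ∧ X₀.p 0 = M.pStar
  eq_φ : ∀ t ∈ Icc 0 T, HasDerivWithinAt X₀.φ (M.freq (X₀.y t)) (Icc 0 T) t
  eq_θ : ∀ t ∈ Icc 0 T, HasDerivWithinAt X₀.θ 0 (Icc 0 T) t
  eq_y : ∀ t ∈ Icc 0 T, HasDerivWithinAt X₀.y (X₀.p t) (Icc 0 T) t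
  eq_p : ∀ t ∈ Icc 0 T, HasDerivWithinAt X₀.p (-(M.θStar * deriv M.freq (X₀.y t))) (Icc 0 T) t

/-- `D_t^k D_y^l L₀`, with `L₀ = log (ω(y₀))`, as a function of time on `[0,T]`. -/
def DL (T : ℝ) (X₀ : Path) (k l : ℕ) : ℝ → ℝ :=
  iteratedDerivWithin k
    (fun τ => iteratedDeriv l (fun η => Real.log (M.freq η)) (X₀.y τ)) (Icc 0 T)

/-! ### Scaled residuals -/

/-- `θ₁^ε = (θ_ε - θ_*)/ε`. -/
def θ₁ (X : ℝ → Path) (ε t : ℝ) : ℝ := ((X ε).θ t - M.θStar) / ε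

/-- `φ₂^ε = (φ_ε - φ₀)/ε²`. -/
def φ₂ (X₀ : Path) (X : ℝ → Path) (ε t : ℝ) : ℝ := ((X ε).φ t - X₀.φ t) / ε ^ 2

/-- `y₂^ε = (y_ε - y₀)/ε²`. -/
def y₂ (X₀ : Path) (X : ℝ → Path) (ε t : ℝ) : ℝ := ((X ε).y t - X₀.y t) / ε ^ 2

/-- `p₂^ε = (p_ε - p₀)/ε²`. -/
def p₂ (X₀ : Path) (X : ℝ → Path) (ε t : ℝ) : ℝ := ((X ε).p t - X₀.p t) / ε ^ 2

/-! ### Rapidly oscillating functions `[·]^ε` -/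

def oscθ₁ (T : ℝ) (X₀ : Path) (ε t : ℝ) : ℝ :=
  -(M.θStar * DL M T X₀ 1 0 t / (2 * M.freq (X₀.y t))) * Real.sin (2 * ε⁻¹ * X₀.φ t)

def oscφ₂ (T : ℝ) (X₀ : Path) (ε t : ℝ) : ℝ :=
  -(DL M T X₀ 1 0 t / (4 * M.freq (X₀.y t))) * Real.cos (2 * ε⁻¹ * X₀.φ t)

def oscy₂ (T : ℝ) (X₀ : Path) (ε t : ℝ) : ℝ :=
  -(M.θStar * DL M T X₀ 0 1 t / (4 * M.freq (X₀.y t))) * Real.cos (2 * ε⁻¹ * X₀.φ t)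

def oscp₂ (T : ℝ) (X₀ : Path) (ε t : ℝ) : ℝ :=
  derivWithin (fun τ => M.θStar * DL M T X₀ 0 1 τ / (4 * M.freq (X₀.y τ))) (Icc 0 T) t
    * Real.cos (2 * ε⁻¹ * X₀.φ t)

/-- `[θ₂]^ε`; the argument `b` stands for `φ̄₂`. -/
def oscθ₂ (T : ℝ) (X₀ : Path) (b : ℝ → ℝ) (ε t : ℝ) : ℝ :=
  -(M.θStar * DL M T X₀ 0 1 t) * oscy₂ M T X₀ ε t
    - X₀.p t / M.freq (X₀.y t) * oscp₂ M T X₀ ε t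
    + M.θStar ^ 2 * DL M T X₀ 0 1 t ^ 2 / (16 * M.freq (X₀.y t)) * Real.cos (4 * ε⁻¹ * X₀.φ t)
    - M.θStar * DL M T X₀ 1 0 t / M.freq (X₀.y t) * b t * Real.cos (2 * ε⁻¹ * X₀.φ t)

/-- `θ₂^ε = (θ₁^ε - [θ₁]^ε)/ε`. -/
def θ₂ (T : ℝ) (X₀ : Path) (X : ℝ → Path) (ε t : ℝ) : ℝ :=
  (θ₁ M X ε t - oscθ₁ M T X₀ ε t) / ε

/-! ### Two-scale profiles `[·](t,s)` -/

def profθ₁ (T : ℝ) (X₀ : Path) (t s : ℝ) : ℝ :=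
  -(M.θStar * DL M T X₀ 1 0 t / (2 * M.freq (X₀.y t))) * Real.sin (2 * Real.pi * s)

def profφ₂ (T : ℝ) (X₀ : Path) (t s : ℝ) : ℝ :=
  -(DL M T X₀ 1 0 t / (4 * M.freq (X₀.y t))) * Real.cos (2 * Real.pi * s)

def profy₂ (T : ℝ) (X₀ : Path) (t s : ℝ) : ℝ :=
  -(M.θStar * DL M T X₀ 0 1 t / (4 * M.freq (X₀.y t))) * Real.cos (2 * Real.pi * s)

def profp₂ (T : ℝ) (X₀ : Path) (t s : ℝ) : ℝ :=
  derivWithin (fun τ => M.θStar * DL M T X₀ 0 1 τ / (4 * M.freq (X₀.y τ))) (Icc 0 T) t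
    * Real.cos (2 * Real.pi * s)

/-- `[θ₂](t,s)`; the argument `b` stands for `φ̄₂`. -/
def profθ₂ (T : ℝ) (X₀ : Path) (b : ℝ → ℝ) (t s : ℝ) : ℝ :=
  -(M.θStar * DL M T X₀ 0 1 t) * profy₂ M T X₀ t s
    - X₀.p t / M.freq (X₀.y t) * profp₂ M T X₀ t s
    + M.θStar ^ 2 * DL M T X₀ 0 1 t ^ 2 / (16 * M.freq (X₀.y t)) * Real.cos (4 * Real.pi * s)
    - M.θStar * DL M T X₀ 1 0 t / M.freq (X₀.y t) * b t * Real.cos (2 * Real.pi * s)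

/-! ### The averaged second-order system -/

/-- `B = (φ̄₂, θ̄₂, ȳ₂, p̄₂)` solves on `[0,T]` the inhomogeneous linear system for the averaged
second-order terms, with its `ε`-independent initial values. -/
structure IsSecondOrder (T : ℝ) (X₀ B : Path) : Prop where
  init : ∀ ε > 0, B.φ 0 = -oscφ₂ M T X₀ ε 0 ∧ B.θ 0 = -oscθ₂ M T X₀ B.φ ε 0 ∧
    B.y 0 = -oscy₂ M T X₀ ε 0 ∧ B.p 0 = -oscp₂ M T X₀ ε 0
  eq_φ : ∀ t ∈ Icc 0 T, HasDerivWithinAt B.φ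
    (deriv M.freq (X₀.y t) * B.y t + M.θStar * DL M T X₀ 0 1 t ^ 2 / 8
      - DL M T X₀ 1 0 t ^ 2 / (8 * M.freq (X₀.y t))) (Icc 0 T) t
  eq_θ : ∀ t ∈ Icc 0 T, HasDerivWithinAt B.θ
    (derivWithin (fun τ => M.θStar * DL M T X₀ 1 0 τ ^ 2 / (8 * M.freq (X₀.y τ) ^ 2)) (Icc 0 T) t)
    (Icc 0 T) t
  eq_y : ∀ t ∈ Icc 0 T, HasDerivWithinAt B.y
    (B.p t - M.θStar * DL M T X₀ 0 1 t * DL M T X₀ 1 0 t / (4 * M.freq (X₀.y t))) (Icc 0 T) t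
  eq_p : ∀ t ∈ Icc 0 T, HasDerivWithinAt B.p
    (-(deriv M.freq (X₀.y t) * B.θ t) - M.θStar * iteratedDeriv 2 M.freq (X₀.y t) * B.y t
      - M.θStar ^ 2 * DL M T X₀ 0 1 t * DL M T X₀ 0 2 t / 8
      + M.θStar * DL M T X₀ 1 0 t * DL M T X₀ 1 1 t / (4 * M.freq (X₀.y t))) (Icc 0 T) t

end FastSlow

end

namespace FastSlow

/-! ### Strong two-scale convergence and uniform convergence -/

/-! Two-scale part. `interpL` loses no information: a continuous `V` is recovered exactly from three
values of `interpL ε V`. Together with the equicontinuity of `U` in the slow variable, this makes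
two-scale convergence to `U` the same as uniform convergence of `v_ε(r) - U(r, r/ε)` to zero. In the
time `r = φ₀/π` the fast variable is `s = φ₀/(πε)`, so `2πs = 2φ₀/ε` and the profiles become the
oscillating terms.

Asymptotic part. With the velocity `v = ẏ` (`vel`) the energy is exactly `v²/2 + θ ω(y)`. It is
conserved and `θ` stays nonnegative, so the slow variables are bounded uniformly in `ε`. The
residuals of `y`, `p`, `φ`, divided by `ε²`, have derivatives containing `ε⁻¹ sin(2φ/ε)`. Adding
suitable multiples of `cos(2φ/ε)` (`corrY`, `corrP`, `corrΦ`) cancels these terms. The force `θ ω'`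
is rewritten through the energy as `(E - v²/2)(log ω)'`, so the `O(ε)` oscillation of `θ` never has
to be divided by `ε²`. What remains is linear with bounded coefficients, and Grönwall bounds the
residuals.

Hence `φ_ε - φ₀ = O(ε²)`, and even the phase `2φ_ε/ε` converges uniformly to `2φ₀/ε`. Slow functions
times `cos(2φ_ε/ε)` or `cos(4φ_ε/ε)` then have small antiderivatives up to small errors
(`weakZero_mul_cos`), and squares of sine and cosine average to `1/2`. Such forcing moves the
solution of a linear system only slightly (`unifZero_of_weakZero_forcing`), so the corrected
residuals converge to the averaged system.

The expansion of `θ` is algebraic: subtracting the two energy identities and dividing by `ε` gives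
`θ₁`, and one order further gives `θ₂`. The nonoscillating part is `θ̄₂` because the averaged system
conserves the second-order energy, which its initial values make zero
(`Setting.energy_second_order`). -/

lemma interpL_apply {ε : ℝ} (hε : 0 < ε) {V : ℝ → ℝ} (hV : Continuous V) (t s : ℝ) :
    interpL ε V t s =
      (V (ε * ⌊t / ε⌋ + ε * s) + Int.fract (t / ε) *
        (V (ε * ⌊t / ε⌋ + ε + ε * s) - V (ε * ⌊t / ε⌋ + ε * s)))
      - s * ((V (ε * ⌊t / ε⌋ + ε) + Int.fract (t / ε) *
          (V (ε * ⌊t / ε⌋ + ε + ε) - V (ε * ⌊t / ε⌋ + ε)))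
        - (V (ε * ⌊t / ε⌋) + Int.fract (t / ε) *
          (V (ε * ⌊t / ε⌋ + ε) - V (ε * ⌊t / ε⌋)))) := by
  have h1 : ∀ s, compFun ε (ε * (⌊t / ε⌋ : ℝ)) s = ε * ⌊t / ε⌋ + ε * s := by
    intro s
    rw [compFun, mul_div_cancel_left₀ _ hε.ne', Int.floor_intCast]
  have h2 : ∀ s, compFun ε (ε * (⌊t / ε⌋ : ℝ) + ε) s = ε * ⌊t / ε⌋ + ε + ε * s := by
    intro s
    have : (ε * (⌊t / ε⌋ : ℝ) + ε) / ε = ((⌊t / ε⌋ + 1 : ℤ) : ℝ) := by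
      push_cast; field_simp
    rw [compFun, this, Int.floor_intCast]; push_cast; ring
  have hI : ∀ s, interpI ε (fun t s => V (compFun ε t s)) t s =
      V (ε * ⌊t / ε⌋ + ε * s) + Int.fract (t / ε) *
        (V (ε * ⌊t / ε⌋ + ε + ε * s) - V (ε * ⌊t / ε⌋ + ε * s)) := by
    intro s; simp only [interpI, h1, h2]
  -- By continuity of `V` the left limit at `s = 1` is the value at `s = 1`, where the argument
  -- reaches the next node.
  have hlim : limUnder (𝓝[<] (1 : ℝ))
      (fun r => interpI ε (fun t s => V (compFun ε t s)) t r) =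
      V (ε * ⌊t / ε⌋ + ε) + Int.fract (t / ε) *
          (V (ε * ⌊t / ε⌋ + ε + ε) - V (ε * ⌊t / ε⌋ + ε)) := by
    apply Tendsto.limUnder_eq
    simp only [hI]
    have hc : Continuous fun s : ℝ => V (ε * ⌊t / ε⌋ + ε * s) + Int.fract (t / ε) *
        (V (ε * ⌊t / ε⌋ + ε + ε * s) - V (ε * ⌊t / ε⌋ + ε * s)) := by fun_prop
    have := hc.tendsto 1
    simp only [mul_one] at this
    exact this.mono_left nhdsWithin_le_nhds
  rw [interpL, interpJ, hlim, hI, hI]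
  simp only [mul_zero, add_zero]

/-- At a node the interpolation in `t` is inactive and only the periodicity correction, `s` times
the jump of `V` across the cell, remains. At `s = 0` the correction vanishes and the interpolation
contributes `Int.fract (r / ε)` times the same jump. For `s = Int.fract (r / ε)` the two cancel. -/
lemma interpL_reconstruct {ε : ℝ} (hε : 0 < ε) {V : ℝ → ℝ} (hV : Continuous V) (r : ℝ) :
    V r = interpL ε V (ε * ⌊r / ε⌋) (Int.fract (r / ε)) + interpL ε V r 0
      - interpL ε V (ε * ⌊r / ε⌋) 0 := by
  have h0 : ε * (⌊r / ε⌋ : ℝ) / ε = ((⌊r / ε⌋ : ℤ) : ℝ) := mul_div_cancel_left₀ _ hε.ne'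
  have hr : ε * ⌊r / ε⌋ + ε * Int.fract (r / ε) = r := by
    rw [← mul_add, Int.floor_add_fract, mul_div_cancel₀ _ hε.ne']
  simp only [interpL_apply hε hV, h0, Int.floor_intCast, Int.fract_intCast, hr]
  simp only [mul_zero, add_zero]
  ring

/-- Heine–Cantor on `[0,R] × [0,1]`; periodicity carries the estimate to all real `s`. -/
lemma IsContTorus.equicontinuous {R : ℝ} {U : ℝ → ℝ → ℝ} (hU : IsContTorus R U) {δ : ℝ}
    (hδ : 0 < δ) : ∃ η > 0, ∀ r ∈ Icc 0 R, ∀ r' ∈ Icc 0 R, |r - r'| < η →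
      ∀ s, |U r s - U r' s| < δ := by
  have hK : IsCompact (Icc 0 R ×ˢ Icc (0 : ℝ) 1) := isCompact_Icc.prod isCompact_Icc
  have huc := hK.uniformContinuousOn_of_continuous
    (hU.1.mono (prod_mono subset_rfl (subset_univ _)))
  obtain ⟨η, hη, H⟩ := Metric.uniformContinuousOn_iff.1 huc δ hδ
  refine ⟨η, hη, fun r hr r' hr' hrr s => ?_⟩
  have hf : ∀ t ∈ Icc 0 R, U t s = U t (Int.fract s) := by
    intro t ht
    have := (hU.2 t ht).sub_int_mul_eq (x := s) ⌊s⌋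
    rw [mul_one] at this
    rw [Int.fract, this]
  have hs : Int.fract s ∈ Icc (0 : ℝ) 1 := ⟨Int.fract_nonneg s, (Int.fract_lt_one s).le⟩
  rw [hf r hr, hf r' hr']
  have := H (r, Int.fract s) ⟨hr, hs⟩ (r', Int.fract s) ⟨hr', hs⟩ (by
    simpa [Prod.dist_eq, Real.dist_eq, hη] using hrr)
  simpa [Real.dist_eq] using this

lemma abs_lerp_sub_le {a b u l δ : ℝ} (hl0 : 0 ≤ l) (hl1 : l ≤ 1) (ha : |a - u| ≤ δ)
    (hb : |b - u| ≤ δ) : |a + l * (b - a) - u| ≤ δ := by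
  rw [abs_le] at *
  constructor <;> nlinarith

lemma clamp_mem {R : ℝ} (hR : 0 ≤ R) (r : ℝ) : max 0 (min R r) ∈ Icc 0 R :=
  ⟨le_max_left _ _, max_le hR (min_le_left _ _)⟩

lemma clamp_of_mem {R r : ℝ} (hr : r ∈ Icc 0 R) : max 0 (min R r) = r := by
  rw [min_eq_right hr.2, max_eq_right hr.1]

lemma abs_clamp_sub_le {R r t : ℝ} (ht : t ∈ Icc 0 R) : |max 0 (min R r) - t| ≤ |r - t| := by
  calc |max 0 (min R r) - t| = |max 0 (min R r) - max 0 (min R t)| := by rw [clamp_of_mem ht]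
    _ ≤ |min R r - min R t| := by simpa using abs_max_sub_max_le_max 0 (min R r) 0 (min R t)
    _ ≤ |r - t| := by simpa using abs_min_sub_min_le_max R r R t

lemma strongTwoScale_of_tendsto {R : ℝ} (hR : 0 ≤ R) {v U : ℝ → ℝ → ℝ} (hU : IsContTorus R U)
    (hv : ∀ᶠ ε in 𝓝[>] (0 : ℝ), ContinuousOn (v ε) (Icc 0 R))
    (h : TendstoUniformlyOn (fun ε r => v ε r - U r (r / ε)) (fun _ => 0) (𝓝[>] 0) (Icc 0 R)) :
    StrongTwoScale R v U := by
  set c : ℝ → ℝ := fun r => max 0 (min R r) with hc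
  have hcc : Continuous c := by fun_prop
  have hcm : ∀ r, c r ∈ Icc 0 R := clamp_mem hR
  -- Outside `[0,R]` the error `v - U` is frozen at its boundary value while the fast variable runs
  -- on. A constant extension would stop the oscillation, although cells near `R` use values of `V`
  -- up to `2ε` beyond `t`.
  refine ⟨hU, fun ε r => v ε (c r) - U (c r) (c r / ε) + U (c r) (r / ε), ?_, ?_⟩
  · filter_upwards [hv] with ε hε
    refine ⟨?_, fun r hr => ?_⟩
    · have h1 : Continuous fun r => v ε (c r) := hε.comp_continuous hcc hcm
      have h2 : Continuous fun r => U (c r) (c r / ε) :=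
        hU.1.comp_continuous (f := fun r => (c r, c r / ε)) (by fun_prop)
          fun r => ⟨hcm r, mem_univ _⟩
      have h3 : Continuous fun r => U (c r) (r / ε) :=
        hU.1.comp_continuous (f := fun r => (c r, r / ε)) (by fun_prop)
          fun r => ⟨hcm r, mem_univ _⟩
      exact (h1.sub h2).add h3
    · have : c r = r := clamp_of_mem hr
      simp [this]
  · rw [Metric.tendstoUniformlyOn_iff] at h ⊢
    intro δ hδ
    have hδ' : 0 < δ / 8 := by positivity
    obtain ⟨η, hη, hequi⟩ := hU.equicontinuous hδ'
    have hsm : ∀ᶠ ε in 𝓝[>] (0 : ℝ), 2 * ε < η := by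
      have : Tendsto (fun ε : ℝ => 2 * ε) (𝓝[>] 0) (𝓝 0) := by
        have : Tendsto (fun ε : ℝ => 2 * ε) (𝓝 0) (𝓝 (2 * 0)) :=
          (continuous_const.mul continuous_id).tendsto 0
        rw [mul_zero] at this
        exact this.mono_left nhdsWithin_le_nhds
      exact this.eventually_lt_const hη
    filter_upwards [h _ hδ', hv, hsm, self_mem_nhdsWithin] with ε hε hvε hεη hε0
    rintro ⟨t, s⟩ ⟨ht, hs⟩
    have hε0 : 0 < ε := hε0
    have hV : Continuous fun r => v ε (c r) - U (c r) (c r / ε) + U (c r) (r / ε) := by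
      have h1 : Continuous fun r => v ε (c r) := hvε.comp_continuous hcc hcm
      have h2 : Continuous fun r => U (c r) (c r / ε) :=
        hU.1.comp_continuous (f := fun r => (c r, c r / ε)) (by fun_prop)
          fun r => ⟨hcm r, mem_univ _⟩
      have h3 : Continuous fun r => U (c r) (r / ε) :=
        hU.1.comp_continuous (f := fun r => (c r, r / ε)) (by fun_prop)
          fun r => ⟨hcm r, mem_univ _⟩
      exact (h1.sub h2).add h3
    set V : ℝ → ℝ := fun r => v ε (c r) - U (c r) (c r / ε) + U (c r) (r / ε) with hVdef
    have hVU : ∀ r, |r - t| ≤ 2 * ε → |V r - U t (r / ε)| ≤ δ / 4 := by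
      intro r hr
      have e1 := hε (c r) (hcm r)
      rw [Real.dist_eq, zero_sub, abs_neg] at e1
      have e2 := hequi (c r) (hcm r) t ht
        (((abs_clamp_sub_le ht).trans hr).trans_lt hεη) (r / ε)
      have : V r - U t (r / ε) = (v ε (c r) - U (c r) (c r / ε))
        + (U (c r) (r / ε) - U t (r / ε)) := by simp only [hVdef]; ring
      rw [this]
      exact (abs_add_le _ _).trans (by linarith)
    have hper : ∀ (k : ℤ) (σ : ℝ), U t (σ + k) = U t σ := by
      intro k σ
      simpa using (hU.2 t ht).int_mul k σ
    have hfl : ε * (⌊t / ε⌋ : ℝ) = t - ε * Int.fract (t / ε) := by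
      rw [Int.fract]; field_simp; ring
    have hf0 := Int.fract_nonneg (t / ε)
    have hf1 := (Int.fract_lt_one (t / ε)).le
    -- The formula for `interpL` evaluates `V` only at points `σ ∈ [0,2]` cells past the node below
    -- `t`.
    have hloc : ∀ (σ : ℝ), 0 ≤ σ → σ ≤ 2 → |ε * (⌊t / ε⌋ : ℝ) + ε * σ - t| ≤ 2 * ε := by
      intro σ h0 h2
      rw [hfl, abs_le]
      constructor <;> nlinarith
    have hs0 : 0 ≤ s := hs.1
    have hs1 : s ≤ 1 := hs.2.le
    have k1 : |V (ε * ⌊t / ε⌋ + ε * s) - U t s| ≤ δ / 4 := by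
      have := hVU _ (hloc s hs0 (by linarith))
      rwa [show (ε * (⌊t / ε⌋ : ℝ) + ε * s) / ε = s + (⌊t / ε⌋ : ℤ) by field_simp; ring, hper]
        at this
    have k2 : |V (ε * ⌊t / ε⌋ + ε + ε * s) - U t s| ≤ δ / 4 := by
      have := hVU _ (hloc (s + 1) (by linarith) (by linarith))
      rw [show (ε * (⌊t / ε⌋ : ℝ) + ε * (s + 1)) / ε = s + ((⌊t / ε⌋ + 1 : ℤ) : ℝ) by
        push_cast; field_simp; ring, hper] at this
      rwa [show ε * (⌊t / ε⌋ : ℝ) + ε + ε * s = ε * ⌊t / ε⌋ + ε * (s + 1) by ring]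
    have k3 : |V (ε * ⌊t / ε⌋) - U t 0| ≤ δ / 4 := by
      have := hVU _ (hloc 0 le_rfl (by linarith))
      rw [show (ε * (⌊t / ε⌋ : ℝ) + ε * 0) / ε = 0 + (⌊t / ε⌋ : ℤ) by field_simp; ring, hper]
        at this
      simpa using this
    have k4 : |V (ε * ⌊t / ε⌋ + ε) - U t 0| ≤ δ / 4 := by
      have := hVU _ (hloc 1 (by linarith) (by linarith))
      rw [show (ε * (⌊t / ε⌋ : ℝ) + ε * 1) / ε = 0 + ((⌊t / ε⌋ + 1 : ℤ) : ℝ) by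
        push_cast; field_simp; ring, hper] at this
      simpa using this
    have k5 : |V (ε * ⌊t / ε⌋ + ε + ε) - U t 0| ≤ δ / 4 := by
      have := hVU _ (hloc 2 (by linarith) (by linarith))
      rw [show (ε * (⌊t / ε⌋ : ℝ) + ε * 2) / ε = 0 + ((⌊t / ε⌋ + 2 : ℤ) : ℝ) by
        push_cast; field_simp; ring, hper] at this
      rwa [show ε * (⌊t / ε⌋ : ℝ) + ε + ε = ε * ⌊t / ε⌋ + ε * 2 by ring]
    have m1 := abs_lerp_sub_le hf0 hf1 k1 k2
    have m2 := abs_lerp_sub_le hf0 hf1 k4 k5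
    have m3 := abs_lerp_sub_le hf0 hf1 k3 k4
    rw [dist_comm, Real.dist_eq]
    change |interpL ε V t s - U t s| < δ
    rw [interpL_apply hε0 hV]
    set A := V (ε * ⌊t / ε⌋ + ε * s) + Int.fract (t / ε) *
        (V (ε * ⌊t / ε⌋ + ε + ε * s) - V (ε * ⌊t / ε⌋ + ε * s))
    set B := V (ε * ⌊t / ε⌋ + ε) + Int.fract (t / ε) *
          (V (ε * ⌊t / ε⌋ + ε + ε) - V (ε * ⌊t / ε⌋ + ε))
    set D := V (ε * ⌊t / ε⌋) + Int.fract (t / ε) *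
          (V (ε * ⌊t / ε⌋ + ε) - V (ε * ⌊t / ε⌋))
    -- Both ends of the cell are compared with the same value `U t 0`, so the periodicity correction
    -- is at most `δ/2`; the interpolated value itself costs `δ/4`.
    have hBD : |B - D| ≤ δ / 2 := by
      rw [show B - D = (B - U t 0) - (D - U t 0) by ring]
      exact (abs_sub _ _).trans (by linarith)
    have hsBD : |s * (B - D)| ≤ δ / 2 := by
      rw [abs_mul, abs_of_nonneg hs0]
      nlinarith [abs_nonneg (B - D)]
    rw [show A - s * (B - D) - U t s = (A - U t s) - s * (B - D) by ring]
    exact (abs_sub _ _).trans_lt (by linarith)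

lemma tendsto_of_strongTwoScale {R : ℝ} {v U : ℝ → ℝ → ℝ} (h : StrongTwoScale R v U) :
    TendstoUniformlyOn (fun ε r => v ε r - U r (r / ε)) (fun _ => 0) (𝓝[>] 0) (Icc 0 R) := by
  obtain ⟨hU, V, hV, hL⟩ := h
  rw [Metric.tendstoUniformlyOn_iff] at hL ⊢
  intro δ hδ
  have hδ' : 0 < δ / 8 := by positivity
  obtain ⟨η, hη, hequi⟩ := hU.equicontinuous hδ'
  have hsm : ∀ᶠ ε in 𝓝[>] (0 : ℝ), ε < η :=
    (tendsto_id.mono_left nhdsWithin_le_nhds).eventually_lt_const hη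
  filter_upwards [hL _ hδ', hV, hsm, self_mem_nhdsWithin] with ε hε hVε hεη hε0 r hr
  have hε0 : 0 < ε := hε0
  have hf0 := Int.fract_nonneg (r / ε)
  have hf1 := Int.fract_lt_one (r / ε)
  have hfl : ε * (⌊r / ε⌋ : ℝ) = r - ε * Int.fract (r / ε) := by
    rw [Int.fract]; field_simp; ring
  -- The node below `r` is used, so it stays in `[0,R]`, where the convergence is known.
  have hn : ε * (⌊r / ε⌋ : ℝ) ∈ Icc 0 R := by
    constructor
    · exact mul_nonneg hε0.le (by exact_mod_cast Int.floor_nonneg.2 (div_nonneg hr.1 hε0.le))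
    · have := hr.2
      nlinarith
  have hclose : |r - ε * (⌊r / ε⌋ : ℝ)| < η := by
    rw [hfl, abs_lt]
    constructor <;> nlinarith
  have e1 := hε (ε * ⌊r / ε⌋, Int.fract (r / ε)) ⟨hn, hf0, hf1⟩
  have e2 := hε (r, 0) ⟨hr, le_rfl, one_pos⟩
  have e3 := hε (ε * ⌊r / ε⌋, 0) ⟨hn, le_rfl, one_pos⟩
  have e4 := hequi r hr _ hn hclose (Int.fract (r / ε))
  have e5 := hequi r hr _ hn hclose 0
  have hUf : U r (r / ε) = U r (Int.fract (r / ε)) := by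
    have := (hU.2 r hr).sub_int_mul_eq (x := r / ε) ⌊r / ε⌋
    rw [mul_one] at this
    rw [Int.fract, this]
  rw [Real.dist_eq, zero_sub, abs_neg, ← hVε.2 hr, interpL_reconstruct hε0 hVε.1 r, hUf]
  simp only [Real.dist_eq] at e1 e2 e3
  rw [abs_lt] at *
  -- Five errors of size `δ/8`: three from `interpL_reconstruct` and two from moving the slow
  -- variable of `U` between `r` and the node.
  constructor <;> linarith [e1.1, e1.2, e2.1, e2.2, e3.1, e3.2, e4.1, e4.2, e5.1, e5.2]

/-- Uniform convergence after subtraction of the oscillating term is the same as strong two-scale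
convergence with respect to the change of time given by the phase. -/
theorem unifConv_iff_twoScaleWrt {T : ℝ} (hT : 0 ≤ T) {φ₀ : ℝ → ℝ}
    (hφc : ContinuousOn φ₀ (Icc 0 T)) (hφm : StrictMonoOn φ₀ (Icc 0 T)) (hφ0 : φ₀ 0 = 0)
    {u osc prof : ℝ → ℝ → ℝ} {a : ℝ → ℝ} (ha : ContinuousOn a (Icc 0 T))
    (hu : ∀ᶠ ε in 𝓝[>] (0 : ℝ), ContinuousOn (u ε) (Icc 0 T)) (hprof : IsContTorus T prof)
    (hosc : ∀ ε > 0, ∀ t ∈ Icc 0 T, osc ε t = prof t (φ₀ t / (Real.pi * ε))) :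
    UnifConv T (fun ε t => u ε t - osc ε t) a ↔
      TwoScaleWrt T φ₀ u (fun t s => a t + prof t s) := by
  have hπ := Real.pi_pos
  set R := φ₀ T / Real.pi with hRdef
  set τ := timeChange T φ₀ with hτdef
  have h0T : (0 : ℝ) ∈ Icc 0 T := ⟨le_rfl, hT⟩
  have hTT : T ∈ Icc 0 T := ⟨hT, le_rfl⟩
  have hφT : 0 ≤ φ₀ T := hφ0 ▸ hφm.monotoneOn h0T hTT hT
  have hR : 0 ≤ R := by positivity
  have hex : ∀ r ∈ Icc 0 R, ∃ t ∈ Icc 0 T, φ₀ t = Real.pi * r := by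
    intro r hr
    have := intermediate_value_Icc hT hφc
    rw [hφ0] at this
    have h2 : Real.pi * r ≤ φ₀ T := by
      have := hr.2
      rw [hRdef, le_div_iff₀ hπ] at this
      linarith
    exact this ⟨mul_nonneg hπ.le hr.1, h2⟩
  have hτm : ∀ r ∈ Icc 0 R, τ r ∈ Icc 0 T := fun r hr => Function.invFunOn_mem (hex r hr)
  have hτe : ∀ r ∈ Icc 0 R, φ₀ (τ r) = Real.pi * r := fun r hr => Function.invFunOn_eq (hex r hr)
  have hsurj : ∀ t ∈ Icc 0 T, φ₀ t / Real.pi ∈ Icc 0 R ∧ τ (φ₀ t / Real.pi) = t := by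
    intro t ht
    have h1 : φ₀ t / Real.pi ∈ Icc 0 R := by
      have := hφm.monotoneOn h0T ht ht.1
      rw [hφ0] at this
      exact ⟨by positivity, div_le_div_of_nonneg_right (hφm.monotoneOn ht hTT ht.2) hπ.le⟩
    refine ⟨h1, hφm.injOn (hτm _ h1) ht ?_⟩
    rw [hτe _ h1, mul_div_cancel₀ _ hπ.ne']
  have hτmono : MonotoneOn τ (Icc 0 R) := by
    intro r hr r' hr' hrr
    by_contra! hlt
    have := hφm (hτm _ hr') (hτm _ hr) hlt
    rw [hτe _ hr, hτe _ hr'] at this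
    nlinarith
  -- A monotone surjection onto an interval is continuous, so no inverse function theorem is needed.
  have hτc : ContinuousOn τ (Icc 0 R) := by
    have himg : τ '' Icc 0 R = Icc 0 T := by
      ext t
      constructor
      · rintro ⟨r, hr, rfl⟩
        exact hτm r hr
      · intro ht
        exact ⟨_, (hsurj t ht).1, (hsurj t ht).2⟩
    rw [continuousOn_iff_continuous_domRestrict]
    have hmono : Monotone fun r : Icc (0 : ℝ) R => (⟨τ r, hτm _ r.2⟩ : Icc (0 : ℝ) T) :=
      fun r r' h => hτmono r.2 r'.2 h
    have hs : Function.Surjective fun r : Icc (0 : ℝ) R => (⟨τ r, hτm _ r.2⟩ : Icc (0 : ℝ) T) := by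
      rintro ⟨t, ht⟩
      exact ⟨⟨_, (hsurj t ht).1⟩, Subtype.ext (hsurj t ht).2⟩
    exact continuous_subtype_val.comp (hmono.continuous_of_surjective hs)
  have hU : IsContTorus T (fun t s => a t + prof t s) := by
    refine ⟨?_, fun t ht s => ?_⟩
    · exact (ha.comp continuousOn_fst fun x hx => hx.1).add hprof.1
    · simp only [hprof.2 t ht s]
  have hUτ : IsContTorus R (fun r s => a (τ r) + prof (τ r) s) := by
    refine ⟨?_, fun r hr s => hU.2 _ (hτm r hr) s⟩
    exact hU.1.comp (f := fun x : ℝ × ℝ => (τ x.1, x.2))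
      ((hτc.comp continuousOn_fst fun x hx => hx.1).prodMk continuousOn_snd)
      fun x hx => ⟨hτm _ hx.1, mem_univ _⟩
  -- The substitution `t = τ r` is a bijection of the intervals, and `φ₀ (τ r) / (π ε) = r / ε`.
  have key : UnifConv T (fun ε t => u ε t - osc ε t) a ↔
      TendstoUniformlyOn (fun ε r => u ε (τ r) - (a (τ r) + prof (τ r) (r / ε))) (fun _ => 0)
        (𝓝[>] 0) (Icc 0 R) := by
    rw [UnifConv, Metric.tendstoUniformlyOn_iff, Metric.tendstoUniformlyOn_iff]
    refine forall₂_congr fun δ hδ => ?_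
    constructor
    · intro h
      filter_upwards [h, self_mem_nhdsWithin] with ε hε hε0 r hr
      have hε0 : 0 < ε := hε0
      have := hε (τ r) (hτm r hr)
      rw [hosc ε hε0 _ (hτm r hr), hτe r hr, mul_div_mul_left _ _ hπ.ne', dist_comm,
        Real.dist_eq] at this
      rw [Real.dist_eq, zero_sub, abs_neg]
      convert this using 2
      ring
    · intro h
      filter_upwards [h, self_mem_nhdsWithin] with ε hε hε0 t ht
      have hε0 : 0 < ε := hε0
      have := hε _ (hsurj t ht).1
      rw [(hsurj t ht).2, div_div, Real.dist_eq, zero_sub, abs_neg] at this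
      rw [hosc ε hε0 _ ht, dist_comm, Real.dist_eq]
      convert this using 2
      ring
  rw [key, TwoScaleWrt, and_iff_right hU]
  refine ⟨fun h => strongTwoScale_of_tendsto hR hUτ ?_ h, fun h => tendsto_of_strongTwoScale h⟩
  filter_upwards [hu] with ε hε
  exact hε.comp hτc hτm

end FastSlow

namespace FastSlow

/-! ### Uniform asymptotics on `[0,T]`

Functions of `(ε,t)` are considered along the filter `ε → 0⁺`, uniformly in `t ∈ [0,T]`. -/

/-- `ε → 0⁺`, uniformly in `t ∈ [0,T]`. -/
def unifFilter (T : ℝ) : Filter (ℝ × ℝ) := 𝓝[>] 0 ×ˢ 𝓟 (Icc 0 T)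

lemma eventually_unifFilter {T : ℝ} {P : ℝ × ℝ → Prop} :
    (∀ᶠ q in unifFilter T, P q) ↔ ∀ᶠ ε in 𝓝[>] (0 : ℝ), ∀ t ∈ Icc 0 T, P (ε, t) :=
  eventually_prod_principal_iff

lemma eventually_mem_unifFilter (T : ℝ) :
    ∀ᶠ q in unifFilter T, 0 < q.1 ∧ q.2 ∈ Icc 0 T := by
  rw [eventually_unifFilter]
  filter_upwards [self_mem_nhdsWithin] with ε hε t ht using ⟨hε, ht⟩

lemma unifConv_iff {T : ℝ} {u : ℝ → ℝ → ℝ} {a : ℝ → ℝ} :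
    UnifConv T u a ↔ Tendsto (fun q : ℝ × ℝ => u q.1 q.2 - a q.2) (unifFilter T) (𝓝 0) := by
  rw [UnifConv, Metric.tendstoUniformlyOn_iff, Metric.tendsto_nhds]
  refine forall₂_congr fun δ hδ => ?_
  rw [eventually_unifFilter]
  simp only [dist_comm, Real.dist_eq, sub_zero]

lemma tendsto_fst_unifFilter (T : ℝ) :
    Tendsto (fun q : ℝ × ℝ => q.1) (unifFilter T) (𝓝 0) :=
  (tendsto_id.mono_left nhdsWithin_le_nhds).comp tendsto_fst

/-- Boundedness for small `ε`, uniformly in `t ∈ [0,T]`. -/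
def UnifBdd (T : ℝ) (F : ℝ × ℝ → ℝ) : Prop :=
  F =O[unifFilter T] fun _ => (1 : ℝ)

/-- Uniform convergence to zero. -/
def UnifZero (T : ℝ) (F : ℝ × ℝ → ℝ) : Prop := Tendsto F (unifFilter T) (𝓝 0)

section algebra
variable {T : ℝ} {F G : ℝ × ℝ → ℝ}

lemma unifZero_iff_isLittleO : UnifZero T F ↔ F =o[unifFilter T] fun _ => (1 : ℝ) :=
  (Asymptotics.isLittleO_one_iff ℝ).symm

lemma unifBdd_iff : UnifBdd T F ↔
    ∃ K, 0 < K ∧ ∀ᶠ ε in 𝓝[>] (0 : ℝ), ∀ t ∈ Icc 0 T, |F (ε, t)| ≤ K := by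
  rw [UnifBdd, Asymptotics.isBigO_iff']
  simp only [eventually_unifFilter, Real.norm_eq_abs, abs_one, mul_one]

lemma UnifBdd.add (hF : UnifBdd T F) (hG : UnifBdd T G) : UnifBdd T (fun q => F q + G q) :=
  Asymptotics.IsBigO.add hF hG

lemma UnifBdd.sub (hF : UnifBdd T F) (hG : UnifBdd T G) : UnifBdd T (fun q => F q - G q) :=
  Asymptotics.IsBigO.sub hF hG

lemma UnifBdd.mul (hF : UnifBdd T F) (hG : UnifBdd T G) : UnifBdd T (fun q => F q * G q) := by
  simpa [UnifBdd] using Asymptotics.IsBigO.mul hF hG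

lemma UnifZero.bdd (hF : UnifZero T F) : UnifBdd T F := (unifZero_iff_isLittleO.1 hF).isBigO

lemma UnifZero.add (hF : UnifZero T F) (hG : UnifZero T G) : UnifZero T (fun q => F q + G q) := by
  simpa [UnifZero] using Tendsto.add hF hG

lemma UnifZero.sub (hF : UnifZero T F) (hG : UnifZero T G) : UnifZero T (fun q => F q - G q) := by
  simpa [UnifZero] using Tendsto.sub hF hG

lemma UnifZero.mul_bdd (hF : UnifZero T F) (hG : UnifBdd T G) :
    UnifZero T (fun q => F q * G q) := by
  rw [unifZero_iff_isLittleO] at *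
  simpa [UnifBdd] using hF.mul_isBigO hG

lemma UnifBdd.mul_zero (hF : UnifBdd T F) (hG : UnifZero T G) :
    UnifZero T (fun q => F q * G q) := by
  simpa only [mul_comm] using hG.mul_bdd hF

lemma unifZero_fst : UnifZero T (fun q => q.1) := tendsto_fst_unifFilter T

lemma UnifZero.congr (hF : UnifZero T F)
    (h : ∀ᶠ ε in 𝓝[>] (0 : ℝ), ∀ t ∈ Icc 0 T, F (ε, t) = G (ε, t)) : UnifZero T G :=
  Tendsto.congr' (eventually_unifFilter.2 h) hF

lemma UnifBdd.congr (hF : UnifBdd T F)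
    (h : ∀ᶠ ε in 𝓝[>] (0 : ℝ), ∀ t ∈ Icc 0 T, F (ε, t) = G (ε, t)) : UnifBdd T G :=
  Asymptotics.IsBigO.congr' hF (eventually_unifFilter.2 h) EventuallyEq.rfl

lemma unifBdd_const (c : ℝ) : UnifBdd T (fun _ => c) :=
  Asymptotics.isBigO_const_const c one_ne_zero _

lemma unifBdd_of_continuousOn {g : ℝ → ℝ} (hg : ContinuousOn g (Icc 0 T)) :
    UnifBdd T (fun q => g q.2) := by
  obtain ⟨K, hK⟩ := isCompact_Icc.exists_bound_of_continuousOn hg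
  rw [unifBdd_iff]
  exact ⟨max K 1, by positivity, Eventually.of_forall fun ε t ht => (hK t ht).trans (le_max_left _ _)⟩

lemma unifBdd_of_abs_le_one (h : ∀ q, |F q| ≤ 1) : UnifBdd T F := by
  rw [unifBdd_iff]
  exact ⟨1, one_pos, Eventually.of_forall fun ε t _ => h _⟩

lemma unifBdd_cos : UnifBdd T (fun q => Real.cos (F q)) :=
  unifBdd_of_abs_le_one fun _ => Real.abs_cos_le_one _

lemma unifBdd_sin : UnifBdd T (fun q => Real.sin (F q)) :=
  unifBdd_of_abs_le_one fun _ => Real.abs_sin_le_one _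

/-- `g` need not be uniformly continuous, and `x` need not stay in a compact set: the image of `x₀`
is compact, and `g` is uniformly continuous at its points, compared with arbitrary nearby ones. -/
lemma unifZero_comp_sub {E : Type*} [SeminormedAddCommGroup E] {g : E → ℝ} (hg : Continuous g)
    {x : ℝ × ℝ → E} {x₀ : ℝ → E} (hx₀ : ContinuousOn x₀ (Icc 0 T))
    (hx : Tendsto (fun q => x q - x₀ q.2) (unifFilter T) (𝓝 0)) :
    UnifZero T (fun q => g (x q) - g (x₀ q.2)) := by
  have hK : IsCompact (x₀ '' Icc 0 T) := isCompact_Icc.image_of_continuousOn hx₀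
  rw [UnifZero, Metric.tendsto_nhds]
  intro δ hδ
  have h1 := hK.uniformContinuousAt_of_continuousAt g (fun _ _ => hg.continuousAt)
    (Metric.dist_mem_uniformity hδ)
  obtain ⟨η, hη, H⟩ := Metric.mem_uniformity_dist.1 h1
  filter_upwards [Metric.tendsto_nhds.1 hx η hη, eventually_mem_unifFilter T] with q hq hqm
  have := @H (x₀ q.2) (x q) (by rw [dist_comm, dist_eq_norm]; simpa using hq)
    (mem_image_of_mem _ hqm.2)
  simpa [Real.dist_eq, abs_sub_comm] using this

end algebra

/-! ### First-order expansions -/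

/-- Mean value inequality for `z ↦ g z - g' a * z`. -/
lemma abs_sub_linear_le {g g' : ℝ → ℝ} (hg : ∀ z, HasDerivAt g (g' z) z) {a b δ : ℝ}
    (h : ∀ z ∈ uIcc a b, |g' z - g' a| ≤ δ) :
    |g b - g a - g' a * (b - a)| ≤ δ * |b - a| := by
  have hd : ∀ z ∈ uIcc a b,
      HasDerivWithinAt (fun z => g z - g' a * z) (g' z - g' a) (uIcc a b) z := by
    intro z _
    simpa using ((hg z).fun_sub ((hasDerivAt_id z).const_mul (g' a))).hasDerivWithinAt
  have := (convex_uIcc a b).norm_image_sub_le_of_norm_hasDerivWithin_le hd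
    (fun z hz => by simpa using h z hz) left_mem_uIcc right_mem_uIcc
  simp only [Real.norm_eq_abs] at this
  convert this using 2
  ring

/-- First-order expansion of `g (y₀ + ε² y₂)`, uniformly on `[0,T]`. -/
lemma unifZero_linear_remainder {T : ℝ} {g g' : ℝ → ℝ} (hg : ∀ z, HasDerivAt g (g' z) z)
    (hg' : Continuous g') {y : ℝ × ℝ → ℝ} {y₀ : ℝ → ℝ} (hy₀ : ContinuousOn y₀ (Icc 0 T))
    (hy : UnifBdd T (fun q => (y q - y₀ q.2) / q.1 ^ 2)) :
    UnifZero T (fun q => (g (y q) - g (y₀ q.2)) / q.1 ^ 2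
      - g' (y₀ q.2) * ((y q - y₀ q.2) / q.1 ^ 2)) := by
  have hyz : UnifZero T (fun q => y q - y₀ q.2) := by
    refine (((unifZero_fst.mul_bdd unifZero_fst.bdd).mul_bdd hy)).congr ?_
    filter_upwards [self_mem_nhdsWithin] with ε hε t _
    have hε : (0 : ℝ) < ε := hε
    field_simp
  have hK : IsCompact (y₀ '' Icc 0 T) := isCompact_Icc.image_of_continuousOn hy₀
  obtain ⟨M, hM, hb⟩ := unifBdd_iff.1 hy
  rw [UnifZero, Metric.tendsto_nhds]
  intro δ hδ
  -- The remainder is the oscillation of `g'` times the scaled residual, which is at most `M`.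
  have hδ' : 0 < δ / (2 * M) := by positivity
  have h1 := hK.uniformContinuousAt_of_continuousAt g' (fun _ _ => hg'.continuousAt)
    (Metric.dist_mem_uniformity hδ')
  obtain ⟨η, hη, H⟩ := Metric.mem_uniformity_dist.1 h1
  filter_upwards [Metric.tendsto_nhds.1 hyz η hη, eventually_mem_unifFilter T,
    (eventually_unifFilter (P := fun q => |(y q - y₀ q.2) / q.1 ^ 2| ≤ M)).2 hb] with q hq hqm hqb
  have hε := hqm.1
  have hlin := abs_sub_linear_le hg (a := y₀ q.2) (b := y q) (δ := δ / (2 * M)) (by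
    intro z hz
    have hz' : |z - y₀ q.2| ≤ |y q - y₀ q.2| := abs_sub_left_of_mem_uIcc hz
    have := @H (y₀ q.2) z (by
      rw [dist_comm, Real.dist_eq]
      refine hz'.trans_lt ?_
      simpa [Real.dist_eq] using hq) (mem_image_of_mem _ hqm.2)
    rw [mem_ofPred_eq, dist_comm, Real.dist_eq] at this
    exact this.le)
  have e : (g (y q) - g (y₀ q.2)) / q.1 ^ 2 - g' (y₀ q.2) * ((y q - y₀ q.2) / q.1 ^ 2)
      = (g (y q) - g (y₀ q.2) - g' (y₀ q.2) * (y q - y₀ q.2)) / q.1 ^ 2 := by ring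
  rw [Real.dist_eq, sub_zero, e, abs_div]
  have hqb' : |y q - y₀ q.2| / |q.1 ^ 2| ≤ M := by rw [← abs_div]; exact hqb
  calc _ ≤ δ / (2 * M) * |y q - y₀ q.2| / |q.1 ^ 2| := by gcongr
    _ = δ / (2 * M) * (|y q - y₀ q.2| / |q.1 ^ 2|) := by ring
    _ ≤ δ / (2 * M) * M := by gcongr
    _ = δ / 2 := by field_simp
    _ < δ := by linarith

/-! ### Grönwall estimates on `[0,T]` -/

lemma hasDerivWithinAt_Ici_of_Icc {E : Type*} [NormedAddCommGroup E] [NormedSpace ℝ E]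
    {f : ℝ → E} {f' : E} {T t : ℝ} (h : HasDerivWithinAt f f' (Icc 0 T) t) (ht : t ∈ Ico 0 T) :
    HasDerivWithinAt f f' (Ici t) t := by
  refine (h.mono (Icc_subset_Icc_left ht.1)).mono_of_mem_nhdsWithin ?_
  exact Icc_mem_nhdsGE ht.2

/-- Grönwall with rate `K + 1` in place of `K`: this covers `K = 0` and makes the factor `δ / (K +
1)` at most `δ`. The case `δ = 0` is allowed and gives constancy results. -/
lemma norm_le_of_norm_deriv_le {E : Type*} [NormedAddCommGroup E] [NormedSpace ℝ E]
    {f f' : ℝ → E} {K δ T : ℝ} (hK : 0 ≤ K) (hδ : 0 ≤ δ)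
    (hf : ∀ t ∈ Icc 0 T, HasDerivWithinAt f (f' t) (Icc 0 T) t) (h0 : ‖f 0‖ ≤ δ)
    (hb : ∀ t ∈ Icc 0 T, ‖f' t‖ ≤ K * ‖f t‖ + δ) :
    ∀ t ∈ Icc 0 T, ‖f t‖ ≤ 2 * Real.exp ((K + 1) * T) * δ := by
  intro t ht
  have h := norm_le_gronwallBound_of_norm_deriv_right_le (f := f) (f' := f') (δ := δ)
    (K := K + 1) (ε := δ) (a := 0) (b := T)
    (fun t ht => (hf t ht).continuousWithinAt)
    (fun t ht => hasDerivWithinAt_Ici_of_Icc (hf t (Ico_subset_Icc_self ht)) ht) h0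
    (fun t ht => (hb t (Ico_subset_Icc_self ht)).trans (by nlinarith [norm_nonneg (f t)])) t ht
  rw [gronwallBound_of_K_ne_0 (by positivity), sub_zero] at h
  have he : Real.exp ((K + 1) * t) ≤ Real.exp ((K + 1) * T) :=
    Real.exp_le_exp.2 (mul_le_mul_of_nonneg_left ht.2 (by positivity))
  have h1 : 1 ≤ Real.exp ((K + 1) * t) := Real.one_le_exp (mul_nonneg (by positivity) ht.1)
  have h2 : δ / (K + 1) * (Real.exp ((K + 1) * t) - 1) ≤ δ * (Real.exp ((K + 1) * t) - 1) := by
    apply mul_le_mul_of_nonneg_right _ (by linarith)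
    exact div_le_self hδ (by linarith)
  nlinarith

/-! ### Global existence for a planar linear system -/

lemma abs_clip_le {r x : ℝ} (hr : 0 ≤ r) : |max (-r) (min r x)| ≤ |x| := by
  simpa [hr] using (abs_max_sub_max_le_max (-r) (min r x) (-r) (min r 0)).trans
    (max_le (by simp) (by simpa [hr] using abs_min_sub_min_le_max r x r 0))

lemma abs_clip_le_radius {r x : ℝ} (hr : 0 ≤ r) : |max (-r) (min r x)| ≤ r :=
  abs_le.2 ⟨le_max_left _ _, max_le (by linarith) (min_le_left _ _)⟩

lemma abs_clip_sub_clip_le {r x y : ℝ} :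
    |max (-r) (min r x) - max (-r) (min r y)| ≤ |x - y| := by
  have h1 := abs_max_sub_max_le_max (-r) (min r x) (-r) (min r y)
  have h2 := abs_min_sub_min_le_max r x r y
  simp at h1 h2
  exact h1.trans h2

lemma clip_of_abs_le {r x : ℝ} (h : |x| ≤ r) : max (-r) (min r x) = x := by
  rw [min_eq_right (abs_le.1 h).2, max_eq_right (abs_le.1 h).1]

/-- Clipping the unknowns at radius `r` makes the field bounded and globally Lipschitz, so
Picard–Lindelöf applies on all of `[0,T]` at once. Clipping does not increase absolute values, so
the Grönwall bound does not depend on `r`; it shows that the clipping is never active. -/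
theorem exists_solution_linear {T : ℝ} (hT : 0 ≤ T) {a b b₁ b₂ : ℝ → ℝ}
    (ha : ContinuousOn a (Icc 0 T)) (hb : ContinuousOn b (Icc 0 T))
    (hb₁ : ContinuousOn b₁ (Icc 0 T)) (hb₂ : ContinuousOn b₂ (Icc 0 T)) (c₁ c₂ : ℝ) :
    ∃ x₁ x₂ : ℝ → ℝ, x₁ 0 = c₁ ∧ x₂ 0 = c₂ ∧ ∀ t ∈ Icc 0 T,
      HasDerivWithinAt x₁ (x₂ t + b₁ t) (Icc 0 T) t ∧
      HasDerivWithinAt x₂ (a t * x₁ t + b t * x₂ t + b₂ t) (Icc 0 T) t := by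
  obtain ⟨A, hA⟩ := isCompact_Icc.exists_bound_of_continuousOn ha
  obtain ⟨A', hA'⟩ := isCompact_Icc.exists_bound_of_continuousOn hb
  obtain ⟨B₁, hB₁⟩ := isCompact_Icc.exists_bound_of_continuousOn hb₁
  obtain ⟨B₂, hB₂⟩ := isCompact_Icc.exists_bound_of_continuousOn hb₂
  simp only [Real.norm_eq_abs] at hA hA' hB₁ hB₂
  have h0T : (0 : ℝ) ∈ Icc 0 T := ⟨le_rfl, hT⟩
  have hA0 : 0 ≤ A := (abs_nonneg _).trans (hA 0 h0T)
  have hA'0 : 0 ≤ A' := (abs_nonneg _).trans (hA' 0 h0T)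
  have hB₁0 : 0 ≤ B₁ := (abs_nonneg _).trans (hB₁ 0 h0T)
  have hB₂0 : 0 ≤ B₂ := (abs_nonneg _).trans (hB₂ 0 h0T)
  set B := B₁ + B₂ + |c₁| + |c₂| with hBdef
  have hB0 : 0 ≤ B := by positivity
  set K := 1 + A + A' with hKdef
  have hK0 : 0 ≤ K := by positivity
  -- Exactly the bound of `norm_le_of_norm_deriv_le` with rate `K` and data `B`.
  set r := 2 * Real.exp ((K + 1) * T) * B with hrdef
  have hr0 : 0 ≤ r := by positivity
  set cl : ℝ → ℝ := fun x => max (-r) (min r x) with hcl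
  set f : ℝ → ℝ × ℝ → ℝ × ℝ := fun t x =>
    (cl x.2 + b₁ t, a t * cl x.1 + b t * cl x.2 + b₂ t) with hf
  have hle : ∀ t ∈ Icc 0 T, ∀ x : ℝ × ℝ, ∀ ρ, |cl x.1| ≤ ρ → |cl x.2| ≤ ρ →
      ‖f t x‖ ≤ K * ρ + B := by
    intro t ht x ρ h1 h2
    have hρ : 0 ≤ ρ := (abs_nonneg _).trans h1
    have := hA t ht
    have := hA' t ht
    have := hB₁ t ht
    have := hB₂ t ht
    have e1 : |a t * cl x.1| ≤ A * ρ := by rw [abs_mul]; gcongr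
    have e2 : |b t * cl x.2| ≤ A' * ρ := by rw [abs_mul]; gcongr
    have n1 := abs_nonneg c₁
    have n2 := abs_nonneg c₂
    have n3 := mul_nonneg hA0 hρ
    have n4 := mul_nonneg hA'0 hρ
    rw [Prod.norm_def, Real.norm_eq_abs, Real.norm_eq_abs]
    refine max_le ?_ ?_
    · refine (abs_add_le _ _).trans ?_
      rw [hKdef, hBdef]; linarith
    · refine (abs_add_le _ _).trans ?_
      have := abs_add_le (a t * cl x.1) (b t * cl x.2)
      rw [hKdef, hBdef]; linarith
  have hpl : IsPicardLindelof f (tmin := 0) (tmax := T) ⟨0, h0T⟩ (c₁, c₂)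
      (Real.toNNReal ((K * r + B) * T)) 0 (Real.toNNReal (K * r + B)) (Real.toNNReal K) := by
    refine ⟨fun t ht => ?_, fun x _ => ?_, fun t ht x _ => ?_, ?_⟩
    · refine LipschitzWith.lipschitzOnWith (LipschitzWith.of_dist_le' fun x y => ?_)
      have h1 : |cl x.1 - cl y.1| ≤ dist x y :=
        abs_clip_sub_clip_le.trans (by rw [Prod.dist_eq]; exact le_max_left _ _)
      have h2 : |cl x.2 - cl y.2| ≤ dist x y :=
        abs_clip_sub_clip_le.trans (by rw [Prod.dist_eq]; exact le_max_right _ _)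
      have hd := dist_nonneg (x := x) (y := y)
      have e1 : |a t * (cl x.1 - cl y.1)| ≤ A * dist x y := by
        rw [abs_mul]; gcongr; exact hA t ht
      have e2 : |b t * (cl x.2 - cl y.2)| ≤ A' * dist x y := by
        rw [abs_mul]; gcongr; exact hA' t ht
      have n3 := mul_nonneg hA0 hd
      have n4 := mul_nonneg hA'0 hd
      rw [Prod.dist_eq (x := f t x), Real.dist_eq, Real.dist_eq]
      refine max_le ?_ ?_
      · rw [show (f t x).1 - (f t y).1 = cl x.2 - cl y.2 by simp [hf]]
        rw [hKdef]; nlinarith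
      · rw [show (f t x).2 - (f t y).2 = a t * (cl x.1 - cl y.1) + b t * (cl x.2 - cl y.2) by
          simp only [hf]; ring]
        refine (abs_add_le _ _).trans ?_
        rw [hKdef]; nlinarith
    · exact (continuousOn_const.add hb₁).prodMk
        (((ha.mul continuousOn_const).add (hb.mul continuousOn_const)).add hb₂)
    · rw [Real.coe_toNNReal _ (by positivity)]
      exact hle t ht x r (abs_clip_le_radius hr0) (abs_clip_le_radius hr0)
    · rw [Real.coe_toNNReal _ (by positivity), Real.coe_toNNReal _ (by positivity)]
      simp [hT]
  obtain ⟨x, hx0, hx⟩ := hpl.exists_eq_forall_mem_Icc_hasDerivWithinAt₀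
  have hx0 : x 0 = (c₁, c₂) := hx0
  have hbd : ∀ t ∈ Icc 0 T, ‖x t‖ ≤ r := by
    refine norm_le_of_norm_deriv_le hK0 hB0 hx ?_ fun t ht => hle t ht _ _ ?_ ?_
    · rw [hx0, Prod.norm_def, hBdef]
      have n1 := abs_nonneg c₁
      have n2 := abs_nonneg c₂
      exact max_le (by simp only [Real.norm_eq_abs]; linarith)
        (by simp only [Real.norm_eq_abs]; linarith)
    · exact (abs_clip_le hr0).trans (norm_fst_le (x t))
    · exact (abs_clip_le hr0).trans (norm_snd_le (x t))
  refine ⟨fun t => (x t).1, fun t => (x t).2, by simp [hx0], by simp [hx0], fun t ht => ?_⟩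
  have c1 : cl (x t).1 = (x t).1 := clip_of_abs_le ((norm_fst_le (x t)).trans (hbd t ht))
  have c2 : cl (x t).2 = (x t).2 := clip_of_abs_le ((norm_snd_le (x t)).trans (hbd t ht))
  have h := hx t ht
  have h1 := h.fst
  have h2 := h.snd
  simp only [hf, c1, c2] at h1 h2
  exact ⟨h1, h2⟩

/-! ### Weak convergence to zero -/

/-- `F(ε, ·)` has, up to a uniformly small error, a uniformly small antiderivative. -/
def WeakZero (T : ℝ) (F : ℝ × ℝ → ℝ) : Prop :=
  ∀ δ > 0, ∀ᶠ ε in 𝓝[>] (0 : ℝ), ∃ R R' : ℝ → ℝ, ∀ t ∈ Icc 0 T,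
    HasDerivWithinAt R (R' t) (Icc 0 T) t ∧ |R t| ≤ δ ∧ |F (ε, t) - R' t| ≤ δ

lemma UnifZero.weakZero {T : ℝ} {F : ℝ × ℝ → ℝ} (h : UnifZero T F) : WeakZero T F := by
  intro δ hδ
  filter_upwards [eventually_unifFilter.1 (Metric.tendsto_nhds.1 h δ hδ)] with ε hε
  refine ⟨fun _ => 0, fun _ => 0, fun t ht => ⟨hasDerivWithinAt_const _ _ _, by simpa using hδ.le, ?_⟩⟩
  simpa [Real.dist_eq] using (hε t ht).le

lemma WeakZero.add {T : ℝ} {F G : ℝ × ℝ → ℝ} (hF : WeakZero T F) (hG : WeakZero T G) :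
    WeakZero T (fun q => F q + G q) := by
  intro δ hδ
  filter_upwards [hF (δ / 2) (by positivity), hG (δ / 2) (by positivity)] with ε h1 h2
  obtain ⟨R, R', h1⟩ := h1
  obtain ⟨S, S', h2⟩ := h2
  refine ⟨fun t => R t + S t, fun t => R' t + S' t, fun t ht => ⟨(h1 t ht).1.add (h2 t ht).1, ?_, ?_⟩⟩
  · exact (abs_add_le _ _).trans (by linarith [(h1 t ht).2.1, (h2 t ht).2.1])
  · rw [show F (ε, t) + G (ε, t) - (R' t + S' t) = (F (ε, t) - R' t) + (G (ε, t) - S' t) by ring]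
    exact (abs_add_le _ _).trans (by linarith [(h1 t ht).2.2, (h2 t ht).2.2])

lemma WeakZero.congr {T : ℝ} {F G : ℝ × ℝ → ℝ} (hF : WeakZero T F)
    (h : ∀ᶠ ε in 𝓝[>] (0 : ℝ), ∀ t ∈ Icc 0 T, F (ε, t) = G (ε, t)) : WeakZero T G := by
  intro δ hδ
  filter_upwards [hF δ hδ, h] with ε ⟨R, R', h1⟩ h2
  exact ⟨R, R', fun t ht => h2 t ht ▸ h1 t ht⟩

/-- Riemann–Lebesgue lemma for a phase with positive velocity. -/
lemma weakZero_mul_cos {T : ℝ} {c : ℝ} (hc : 0 < c) {φ w g : ℝ → ℝ}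
    (hφ : ∀ t ∈ Icc 0 T, HasDerivWithinAt φ (w t) (Icc 0 T) t)
    (hw : ContinuousOn w (Icc 0 T)) (hwpos : ∀ t ∈ Icc 0 T, 0 < w t)
    (hg : ContinuousOn g (Icc 0 T)) :
    WeakZero T (fun q => g q.2 * Real.cos (c * q.1⁻¹ * φ q.2)) := by
  intro δ hδ
  obtain ⟨W, hW⟩ := isCompact_Icc.exists_bound_of_continuousOn hw
  set W' := max W 1 with hW'
  have hW'0 : 0 < W' := by positivity
  -- `g / w` is merely continuous and cannot be integrated by parts. A polynomial `P` near it gives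
  -- the antiderivative `ε/c · P sin(cφ/ε)`; the error `P - g/w` is then multiplied by `w`, hence
  -- the tolerance `δ / (2 * W')`.
  obtain ⟨P, hP⟩ := exists_polynomial_near_of_continuousOn 0 T (fun t => g t / w t)
    (hg.div hw fun t ht => (hwpos t ht).ne') (δ / (2 * W')) (by positivity)
  obtain ⟨K, hK⟩ := (isCompact_Icc (a := (0 : ℝ)) (b := T)).exists_bound_of_continuousOn
    P.continuous.continuousOn
  obtain ⟨K', hK'⟩ := (isCompact_Icc (a := (0 : ℝ)) (b := T)).exists_bound_of_continuousOn
    P.derivative.continuous.continuousOn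
  have hlim : ∀ k : ℝ, Tendsto (fun ε : ℝ => ε / c * k) (𝓝[>] 0) (𝓝 0) := by
    intro k
    have : Tendsto (fun ε : ℝ => ε / c * k) (𝓝 0) (𝓝 (0 / c * k)) :=
      (continuous_id.div_const c |>.mul continuous_const).tendsto 0
    rw [zero_div, zero_mul] at this
    exact this.mono_left nhdsWithin_le_nhds
  filter_upwards [self_mem_nhdsWithin, (hlim K).eventually_lt_const hδ,
    (hlim K').eventually_lt_const (half_pos hδ)] with ε hε h1 h2
  have hε : 0 < ε := hε
  refine ⟨fun t => ε / c * P.eval t * Real.sin (c * ε⁻¹ * φ t),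
    fun t => ε / c * P.derivative.eval t * Real.sin (c * ε⁻¹ * φ t)
      + P.eval t * w t * Real.cos (c * ε⁻¹ * φ t), fun t ht => ⟨?_, ?_, ?_⟩⟩
  · have d1 := ((P.hasDerivAt t).hasDerivWithinAt (s := Icc 0 T)).const_mul (ε / c)
    have d2 := ((hφ t ht).const_mul (c * ε⁻¹)).sin
    refine (d1.mul d2).congr_deriv ?_
    field_simp
  · have := hK t ht
    rw [Real.norm_eq_abs] at this
    rw [abs_mul, abs_mul, abs_of_pos (div_pos hε hc)]
    have hs := Real.abs_sin_le_one (c * ε⁻¹ * φ t)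
    have hK0 := (abs_nonneg _).trans this
    calc _ ≤ ε / c * K * 1 := by gcongr
      _ ≤ δ := by linarith
  · have hk' := hK' t ht
    have hw1 := hW t ht
    rw [Real.norm_eq_abs] at hk' hw1
    have hPt := (hP t ht).le
    have hs := Real.abs_sin_le_one (c * ε⁻¹ * φ t)
    have hco := Real.abs_cos_le_one (c * ε⁻¹ * φ t)
    have hwt := (hwpos t ht).ne'
    have e : g t * Real.cos (c * ε⁻¹ * φ t) -
        (ε / c * P.derivative.eval t * Real.sin (c * ε⁻¹ * φ t)
          + P.eval t * w t * Real.cos (c * ε⁻¹ * φ t)) =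
        -((P.eval t - g t / w t) * w t * Real.cos (c * ε⁻¹ * φ t))
          - ε / c * P.derivative.eval t * Real.sin (c * ε⁻¹ * φ t) := by
      field_simp; ring
    have e1 : |(P.eval t - g t / w t) * w t * Real.cos (c * ε⁻¹ * φ t)| ≤ δ / 2 := by
      rw [abs_mul, abs_mul]
      calc _ ≤ δ / (2 * W') * W' * 1 := by
            gcongr
            exact hw1.trans (le_max_left _ _)
        _ = δ / 2 := by field_simp
    have e2 : |ε / c * P.derivative.eval t * Real.sin (c * ε⁻¹ * φ t)| ≤ δ / 2 := by
      rw [abs_mul, abs_mul, abs_of_pos (div_pos hε hc)]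
      have hK0 := (abs_nonneg _).trans hk'
      calc _ ≤ ε / c * K' * 1 := by gcongr
        _ ≤ δ / 2 := by linarith
    simp only
    rw [e]
    refine (abs_sub _ _).trans ?_
    rw [abs_neg]
    linarith

/-- A linear system with zero initial values and weakly vanishing forcing has uniformly vanishing
solutions. -/
theorem unifZero_of_weakZero_forcing {T : ℝ} (hT : 0 ≤ T) {e₁ e₂ f₁ f₂ : ℝ × ℝ → ℝ} {d a b : ℝ → ℝ}
    (hd : ContinuousOn d (Icc 0 T))
    (ha : ContinuousOn a (Icc 0 T)) (hb : ContinuousOn b (Icc 0 T))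
    (h0 : ∀ᶠ ε in 𝓝[>] (0 : ℝ), e₁ (ε, 0) = 0 ∧ e₂ (ε, 0) = 0)
    (h : ∀ᶠ ε in 𝓝[>] (0 : ℝ), ∀ t ∈ Icc 0 T,
      HasDerivWithinAt (fun τ => e₁ (ε, τ)) (d t * e₂ (ε, t) + f₁ (ε, t)) (Icc 0 T) t ∧
      HasDerivWithinAt (fun τ => e₂ (ε, τ)) (a t * e₁ (ε, t) + b t * e₂ (ε, t) + f₂ (ε, t))
        (Icc 0 T) t)
    (hf₁ : WeakZero T f₁) (hf₂ : WeakZero T f₂) : UnifZero T e₁ ∧ UnifZero T e₂ := by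
  obtain ⟨D, hD⟩ := isCompact_Icc.exists_bound_of_continuousOn hd
  obtain ⟨A, hA⟩ := isCompact_Icc.exists_bound_of_continuousOn ha
  obtain ⟨B, hB⟩ := isCompact_Icc.exists_bound_of_continuousOn hb
  simp only [Real.norm_eq_abs] at hA hB hD
  have h0T : (0 : ℝ) ∈ Icc 0 T := ⟨le_rfl, hT⟩
  have hD0 : 0 ≤ D := (abs_nonneg _).trans (hD 0 h0T)
  have hA0 : 0 ≤ A := (abs_nonneg _).trans (hA 0 h0T)
  have hB0 : 0 ≤ B := (abs_nonneg _).trans (hB 0 h0T)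
  set K := D + A + B with hK
  have hK0 : 0 ≤ K := by positivity
  -- The exponential part is the Grönwall bound for the shifted unknowns; the `+ 1` pays for adding
  -- the antiderivatives back.
  set C := 2 * Real.exp ((K + 1) * T) * (K + 1) + 1 with hC
  have hC0 : 0 < C := by positivity
  have key : ∀ δ > 0, ∀ᶠ ε in 𝓝[>] (0 : ℝ), ∀ t ∈ Icc 0 T,
      |e₁ (ε, t)| ≤ C * δ ∧ |e₂ (ε, t)| ≤ C * δ := by
    intro δ hδ
    filter_upwards [h0, h, hf₁ δ hδ, hf₂ δ hδ] with ε hi hder ⟨R, R', hR⟩ ⟨S, S', hS⟩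
    -- Subtracting the antiderivatives `R`, `S` from the unknowns replaces the forcing by its error
    -- `≤ δ`. The linear terms applied to `R`, `S` cost at most `K * δ`, whence `(K + 1) * δ`.
    have hbound := norm_le_of_norm_deriv_le (T := T)
      (f := fun t => (e₁ (ε, t) - R t, e₂ (ε, t) - S t))
      (f' := fun t => (d t * e₂ (ε, t) + f₁ (ε, t) - R' t,
        a t * e₁ (ε, t) + b t * e₂ (ε, t) + f₂ (ε, t) - S' t))
      (K := K) (δ := (K + 1) * δ) hK0 (by positivity)
      (fun t ht => ((hder t ht).1.sub (hR t ht).1).prodMk ((hder t ht).2.sub (hS t ht).1))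
      (by
        rw [hi.1, hi.2, Prod.norm_def]
        have h1 := (hR 0 h0T).2.1
        have h2 := (hS 0 h0T).2.1
        refine max_le ?_ ?_ <;> simp only [Real.norm_eq_abs, zero_sub, abs_neg] <;> nlinarith)
      (by
        intro t ht
        set N := ‖(e₁ (ε, t) - R t, e₂ (ε, t) - S t)‖ with hN
        have n1 : |e₁ (ε, t) - R t| ≤ N := norm_fst_le (e₁ (ε, t) - R t, e₂ (ε, t) - S t)
        have n2 : |e₂ (ε, t) - S t| ≤ N := norm_snd_le (e₁ (ε, t) - R t, e₂ (ε, t) - S t)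
        have hN0 : 0 ≤ N := norm_nonneg _
        obtain ⟨-, r1, r2⟩ := hR t ht
        obtain ⟨-, s1, s2⟩ := hS t ht
        have m1 : |e₁ (ε, t)| ≤ N + δ := by
          have := abs_add_le (e₁ (ε, t) - R t) (R t)
          rw [sub_add_cancel] at this
          linarith
        have m2 : |e₂ (ε, t)| ≤ N + δ := by
          have := abs_add_le (e₂ (ε, t) - S t) (S t)
          rw [sub_add_cancel] at this
          linarith
        have p1 : |d t * e₂ (ε, t)| ≤ D * (N + δ) := by
          rw [abs_mul]; gcongr; exact hD t ht
        have p2 : |a t * e₁ (ε, t)| ≤ A * (N + δ) := by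
          rw [abs_mul]; gcongr; exact hA t ht
        have p3 : |b t * e₂ (ε, t)| ≤ B * (N + δ) := by
          rw [abs_mul]; gcongr; exact hB t ht
        have z1 : 0 ≤ D * (N + δ) := by positivity
        have z2 : 0 ≤ A * (N + δ) := by positivity
        have z3 : 0 ≤ B * (N + δ) := by positivity
        rw [Prod.norm_def]
        refine max_le ?_ ?_ <;> simp only [Real.norm_eq_abs]
        · rw [add_sub_assoc]
          refine (abs_add_le _ _).trans ?_
          rw [hK]; nlinarith
        · rw [add_sub_assoc]
          refine (abs_add_le _ _).trans ?_
          have := abs_add_le (a t * e₁ (ε, t)) (b t * e₂ (ε, t))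
          rw [hK]; nlinarith)
    intro t ht
    have hb := hbound t ht
    have n1 := (norm_fst_le (e₁ (ε, t) - R t, e₂ (ε, t) - S t)).trans hb
    have n2 := (norm_snd_le (e₁ (ε, t) - R t, e₂ (ε, t) - S t)).trans hb
    simp only [Real.norm_eq_abs] at n1 n2
    have r1 := (hR t ht).2.1
    have s1 := (hS t ht).2.1
    have m1 := abs_add_le (e₁ (ε, t) - R t) (R t)
    have m2 := abs_add_le (e₂ (ε, t) - S t) (S t)
    rw [sub_add_cancel] at m1 m2
    constructor <;> rw [hC] <;> nlinarith
  refine ⟨Metric.tendsto_nhds.2 fun δ hδ => ?_, Metric.tendsto_nhds.2 fun δ hδ => ?_⟩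
  all_goals
    rw [eventually_unifFilter]
    filter_upwards [key (δ / (2 * C)) (by positivity)] with ε hε t ht
    have e : C * (δ / (2 * C)) = δ / 2 := by field_simp
    have := hε t ht
    rw [e] at this
    rw [Real.dist_eq, sub_zero]
    linarith [this.1, this.2]

end FastSlow

namespace FastSlow

/-! ### Coefficient functions -/

/-- `(log ω)' = ω'/ω`. -/
noncomputable def Model.logD (M : Model) (η : ℝ) : ℝ := deriv M.freq η / M.freq η

/-- `(log ω)'' = ω''/ω - (ω'/ω)²`. -/
noncomputable def Model.logDD (M : Model) (η : ℝ) : ℝ :=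
  iteratedDeriv 2 M.freq η / M.freq η - M.logD η ^ 2

/-- `(log ω)' / (4 ω)`. -/
noncomputable def Model.ampl (M : Model) (η : ℝ) : ℝ := M.logD η / (4 * M.freq η)

/-- Minus the derivative of `(log ω)' / (4 ω)`. -/
noncomputable def Model.amplD (M : Model) (η : ℝ) : ℝ :=
  (M.logD η ^ 2 - M.logDD η) / (4 * M.freq η)

/-- The value of the energy. -/
noncomputable def Model.energy (M : Model) : ℝ := M.pStar ^ 2 / 2 + M.θStar * M.freq M.yStar

/-- Smoothness and positivity of the frequency. -/
structure Model.IsRegular (M : Model) : Prop where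
  smooth : ContDiff ℝ ∞ M.freq
  pos : ∀ η, 0 < M.freq η

section coefficients
variable {M : Model} (hM : M.IsRegular)
include hM

lemma Model.IsRegular.ne (η : ℝ) : M.freq η ≠ 0 := (hM.pos η).ne'

lemma Model.IsRegular.hasDerivAt_freq (η : ℝ) :
    HasDerivAt M.freq (M.freq η * M.logD η) η := by
  have := (hM.smooth.differentiable (by simp) η).hasDerivAt
  rwa [show deriv M.freq η = M.freq η * M.logD η by
    rw [Model.logD, mul_div_cancel₀ _ (hM.ne η)]] at this

lemma Model.IsRegular.deriv_freq (η : ℝ) : deriv M.freq η = M.freq η * M.logD η :=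
  (hM.hasDerivAt_freq η).deriv

lemma Model.IsRegular.iteratedDeriv_two_freq (η : ℝ) :
    iteratedDeriv 2 M.freq η = M.freq η * (M.logDD η + M.logD η ^ 2) := by
  rw [Model.logDD]
  have := hM.ne η
  field_simp
  ring

lemma Model.IsRegular.contDiff_deriv : ContDiff ℝ ∞ (deriv M.freq) :=
  (contDiff_infty_iff_deriv.1 hM.smooth).2

lemma Model.IsRegular.contDiff_logD : ContDiff ℝ ∞ M.logD :=
  hM.contDiff_deriv.div hM.smooth hM.ne

omit hM in
lemma Model.iteratedDeriv_two_eq : iteratedDeriv 2 M.freq = deriv (deriv M.freq) := by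
  rw [iteratedDeriv_succ, iteratedDeriv_one]

lemma Model.IsRegular.contDiff_logDD : ContDiff ℝ ∞ M.logDD := by
  have h : ContDiff ℝ ∞ (iteratedDeriv 2 M.freq) := by
    rw [M.iteratedDeriv_two_eq]
    exact (contDiff_infty_iff_deriv.1 hM.contDiff_deriv).2
  exact (h.div hM.smooth hM.ne).sub (hM.contDiff_logD.pow 2)

lemma Model.IsRegular.contDiff_ampl : ContDiff ℝ ∞ M.ampl :=
  hM.contDiff_logD.div (contDiff_const.mul hM.smooth) fun η =>
    mul_ne_zero four_ne_zero (hM.ne η)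

lemma Model.IsRegular.contDiff_amplD : ContDiff ℝ ∞ M.amplD :=
  ((hM.contDiff_logD.pow 2).sub hM.contDiff_logDD).div (contDiff_const.mul hM.smooth) fun η =>
    mul_ne_zero four_ne_zero (hM.ne η)

lemma Model.IsRegular.hasDerivAt_logD (η : ℝ) : HasDerivAt M.logD (M.logDD η) η := by
  have h1 := (hM.contDiff_deriv.differentiable (by simp) η).hasDerivAt
  have h := h1.div (hM.hasDerivAt_freq η) (hM.ne η)
  refine h.congr_deriv ?_
  rw [← M.iteratedDeriv_two_eq, hM.iteratedDeriv_two_freq, hM.deriv_freq]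
  have := hM.ne η
  field_simp
  ring

lemma Model.IsRegular.hasDerivAt_ampl (η : ℝ) : HasDerivAt M.ampl (-M.amplD η) η := by
  have h := (hM.hasDerivAt_logD η).div ((hM.hasDerivAt_freq η).const_mul 4)
    (mul_ne_zero four_ne_zero (hM.ne η))
  refine h.congr_deriv ?_
  rw [Model.amplD]
  have := hM.ne η
  field_simp
  ring

lemma Model.IsRegular.hasDerivAt_amplD (η : ℝ) : HasDerivAt M.amplD (deriv M.amplD η) η :=
  (hM.contDiff_amplD.differentiable (by simp) η).hasDerivAt

lemma Model.IsRegular.continuous_deriv_amplD : Continuous (deriv M.amplD) :=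
  hM.contDiff_amplD.continuous_deriv (by simp)

end coefficients

/-! ### Conserved quantities and signs for scalar equations. -/

lemma eq_of_hasDerivWithinAt_zero {f : ℝ → ℝ} {T : ℝ}
    (hf : ∀ t ∈ Icc 0 T, HasDerivWithinAt f 0 (Icc 0 T) t) : ∀ t ∈ Icc 0 T, f t = f 0 := by
  intro t ht
  have h := norm_le_of_norm_deriv_le (T := T) (f := fun t => f t - f 0) (f' := fun _ => 0)
    (K := 0) (δ := 0) le_rfl le_rfl (fun t ht => (hf t ht).sub_const _) (by simp) (by simp) t ht
  rw [mul_zero, norm_le_zero_iff, sub_eq_zero] at h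
  exact h

/-- A solution of a scalar linear homogeneous equation keeps its sign. -/
lemma nonneg_of_hasDerivWithinAt_mul {f a : ℝ → ℝ} {T : ℝ} (hT : 0 ≤ T)
    (ha : ContinuousOn a (Icc 0 T))
    (hf : ∀ t ∈ Icc 0 T, HasDerivWithinAt f (a t * f t) (Icc 0 T) t) (h0 : 0 ≤ f 0) :
    ∀ t ∈ Icc 0 T, 0 ≤ f t := by
  -- The coefficient is extended continuously to `ℝ` so that the exponent of the integrating factor
  -- is differentiable also at the endpoints.
  set b : ℝ → ℝ := IccExtend hT ((Icc 0 T).domRestrict a) with hb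
  have hbc : Continuous b := (continuousOn_iff_continuous_domRestrict.1 ha).Icc_extend'
  have hba : ∀ t ∈ Icc 0 T, b t = a t := fun t ht => by
    rw [hb, IccExtend_of_mem _ _ ht]; rfl
  set A : ℝ → ℝ := fun t => ∫ τ in (0 : ℝ)..t, b τ with hA
  have hAd : ∀ t, HasDerivAt A (b t) t := fun t =>
    (hbc.integral_hasStrictDerivAt 0 t).hasDerivAt
  have hconst := eq_of_hasDerivWithinAt_zero (T := T) (f := fun t => f t * Real.exp (-A t)) (by
    intro t ht
    refine ((hf t ht).mul (hAd t).neg.exp.hasDerivWithinAt).congr_deriv ?_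
    rw [hba t ht]
    simp only [Pi.neg_apply]
    ring)
  intro t ht
  have h := hconst t ht
  have hA0 : A 0 = 0 := by simp [hA]
  simp only [hA0, neg_zero, Real.exp_zero, mul_one] at h
  by_contra! hlt
  have := mul_neg_of_neg_of_pos hlt (Real.exp_pos (-A t))
  linarith

/-! ### The exact equations in slow variables -/

/-- The velocity `ẏ = p + ε θ ω'/(2ω) sin(2φ/ε)`. -/
noncomputable def vel (M : Model) (ε : ℝ) (X : Path) (t : ℝ) : ℝ :=
  X.p t + ε / 2 * X.θ t * M.logD (X.y t) * Real.sin (2 * ε⁻¹ * X.φ t)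

section exact
variable {M : Model} (hM : M.IsRegular) {T ε : ℝ} (hε : 0 < ε) {X : Path}
  (hX : IsSolution M T ε X)
include hM hX

/-- In this and the next three lemmas `vel` absorbs the terms quadratic in `sin(2φ/ε)`, as well as
the `sin(4φ/ε)` term of the `θ` equation. -/
lemma IsSolution.hasDerivWithinAt_y {t : ℝ} (ht : t ∈ Icc 0 T) :
    HasDerivWithinAt X.y (vel M ε X t) (Icc 0 T) t := by
  refine (hX.eq_y t ht).congr_deriv ?_
  rw [vel, hM.deriv_freq]
  have := hM.ne (X.y t)
  field_simp

lemma IsSolution.hasDerivWithinAt_φ {t : ℝ} (ht : t ∈ Icc 0 T) :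
    HasDerivWithinAt X.φ (M.freq (X.y t) + ε / 2 * M.logD (X.y t) * vel M ε X t *
      Real.sin (2 * ε⁻¹ * X.φ t)) (Icc 0 T) t := by
  refine (hX.eq_φ t ht).congr_deriv ?_
  rw [vel, hM.deriv_freq]
  have := hM.ne (X.y t)
  field_simp
  ring

lemma IsSolution.hasDerivWithinAt_p {t : ℝ} (ht : t ∈ Icc 0 T) :
    HasDerivWithinAt X.p (-(X.θ t * M.freq (X.y t) * M.logD (X.y t))
      - ε / 2 * X.θ t * M.logDD (X.y t) * vel M ε X t * Real.sin (2 * ε⁻¹ * X.φ t))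
      (Icc 0 T) t := by
  refine (hX.eq_p t ht).congr_deriv ?_
  rw [vel, hM.deriv_freq, hM.iteratedDeriv_two_freq]
  have := hM.ne (X.y t)
  field_simp
  ring

lemma IsSolution.hasDerivWithinAt_θ {t : ℝ} (ht : t ∈ Icc 0 T) :
    HasDerivWithinAt X.θ (-(X.θ t * vel M ε X t * M.logD (X.y t) *
      Real.cos (2 * ε⁻¹ * X.φ t))) (Icc 0 T) t := by
  refine (hX.eq_θ t ht).congr_deriv ?_
  rw [vel, hM.deriv_freq, show 4 * ε⁻¹ * X.φ t = 2 * (2 * ε⁻¹ * X.φ t) by ring, Real.sin_two_mul]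
  have := hM.ne (X.y t)
  field_simp
  ring

omit hM hX in
lemma hasDerivWithinAt_cos_phase {φ : ℝ → ℝ} {w t : ℝ} {s : Set ℝ} (c : ℝ)
    (h : HasDerivWithinAt φ w s t) :
    HasDerivWithinAt (fun τ => Real.cos (c * φ τ)) (-(c * w * Real.sin (c * φ t))) s t :=
  ((h.const_mul c).cos).congr_deriv (by ring)

omit hM hX in
lemma hasDerivWithinAt_sin_phase {φ : ℝ → ℝ} {w t : ℝ} {s : Set ℝ} (c : ℝ)
    (h : HasDerivWithinAt φ w s t) :
    HasDerivWithinAt (fun τ => Real.sin (c * φ τ)) (c * w * Real.cos (c * φ t)) s t :=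
  ((h.const_mul c).sin).congr_deriv (by ring)

include hε

/-- Differentiating the sine yields a factor `2ε⁻¹`, offset by the `ε/2` in `vel`; this produces the
cosine term. All contributions of order `ε` cancel. -/
lemma IsSolution.hasDerivWithinAt_vel {t : ℝ} (ht : t ∈ Icc 0 T) :
    HasDerivWithinAt (vel M ε X) (-(X.θ t * M.freq (X.y t) * M.logD (X.y t) *
      (1 - Real.cos (2 * ε⁻¹ * X.φ t)))) (Icc 0 T) t := by
  have hy := hX.hasDerivWithinAt_y hM ht
  have hl := (hM.hasDerivAt_logD (X.y t)).comp_hasDerivWithinAt t hy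
  have hs := hasDerivWithinAt_sin_phase (2 * ε⁻¹) (hX.hasDerivWithinAt_φ hM ht)
  have h := (hX.hasDerivWithinAt_p hM ht).add
    ((((hX.hasDerivWithinAt_θ hM ht).const_mul (ε / 2)).mul hl).mul hs)
  refine h.congr_deriv ?_
  simp only [Function.comp_apply, Pi.mul_apply]
  field_simp
  ring

/-- `E_ε` is a completed square in `vel`. The value is independent of `ε` because the sine vanishes
at the initial phase `0`. -/
lemma IsSolution.energy_eq {t : ℝ} (ht : t ∈ Icc 0 T) :
    vel M ε X t ^ 2 / 2 + X.θ t * M.freq (X.y t) = M.energy := by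
  have h := eq_of_hasDerivWithinAt_zero (T := T)
    (f := fun t => vel M ε X t ^ 2 / 2 + X.θ t * M.freq (X.y t)) (by
      intro t ht
      have hv := hX.hasDerivWithinAt_vel hM hε ht
      have hw := (hM.hasDerivAt_freq (X.y t)).comp_hasDerivWithinAt t (hX.hasDerivWithinAt_y hM ht)
      refine (((hv.fun_pow 2).div_const 2).add
        ((hX.hasDerivWithinAt_θ hM ht).mul hw)).congr_deriv ?_
      simp only [Function.comp_apply]
      ring) t ht
  rw [h, vel, hX.init.1, hX.init.2.1, hX.init.2.2.1, hX.init.2.2.2, Model.energy]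
  simp

/-- The equation for `θ` is linear and homogeneous once `vel`, `y`, `φ` are regarded as given, and
`θ_* ≥ 0`. The sign makes both terms of the energy nonnegative. -/
lemma IsSolution.θ_nonneg (hT : 0 ≤ T) {t : ℝ} (ht : t ∈ Icc 0 T) : 0 ≤ X.θ t := by
  have hyc : ContinuousOn X.y (Icc 0 T) := fun t ht => (hX.eq_y t ht).continuousWithinAt
  have hφc : ContinuousOn X.φ (Icc 0 T) := fun t ht => (hX.eq_φ t ht).continuousWithinAt
  have hvc : ContinuousOn (vel M ε X) (Icc 0 T) :=
    fun t ht => (hX.hasDerivWithinAt_vel hM hε ht).continuousWithinAt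
  have hlc : ContinuousOn (fun t => M.logD (X.y t)) (Icc 0 T) :=
    hM.contDiff_logD.continuous.comp_continuousOn hyc
  refine nonneg_of_hasDerivWithinAt_mul hT
    (a := fun t => -(vel M ε X t * M.logD (X.y t) * Real.cos (2 * ε⁻¹ * X.φ t)))
    (((hvc.mul hlc).mul (Real.continuous_cos.comp_continuousOn
      (continuousOn_const.mul hφc))).neg)
    (fun t ht => (hX.hasDerivWithinAt_θ hM ht).congr_deriv (by ring)) ?_ t ht
  rw [hX.init.2.1, Model.θStar]
  have := hM.pos M.yStar
  positivity

end exact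

/-- The slow variables of the exact solutions are bounded, uniformly in `ε ≤ 1`. -/
theorem exists_bound_solution {M : Model} (hM : M.IsRegular) {ωLow : ℝ} (hωLow : 0 < ωLow)
    (hωge : ∀ η, ωLow ≤ M.freq η) {T : ℝ} (hT : 0 ≤ T) :
    ∃ K, ∀ ε ∈ Ioc (0 : ℝ) 1, ∀ X : Path, IsSolution M T ε X → ∀ t ∈ Icc 0 T,
      |X.y t| ≤ K ∧ |vel M ε X t| ≤ K ∧ |X.θ t| ≤ K ∧ |X.p t| ≤ K := by
  have hθ0 : 0 ≤ M.θStar := by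
    rw [Model.θStar]
    have := hM.pos M.yStar
    positivity
  have hE : 0 ≤ M.energy := by
    have := hM.pos M.yStar
    rw [Model.energy]
    positivity
  -- `v² ≤ 2E` gives `|v| ≤ (v² + 1)/2 ≤ E + 1`. Hence `y` stays within `V * T` of `y_*`, which
  -- fixes the compact interval where `logD` is bounded.
  set V := M.energy + 1 with hV
  obtain ⟨L, hL⟩ := (isCompact_Icc (a := M.yStar - V * T) (b := M.yStar + V * T)
    ).exists_bound_of_continuousOn hM.contDiff_logD.continuous.continuousOn
  simp only [Real.norm_eq_abs] at hL
  have hVT : 0 ≤ V * T := by positivity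
  have hL0 : 0 ≤ L := (abs_nonneg _).trans (hL M.yStar ⟨by linarith, by linarith⟩)
  set Θ := M.energy / ωLow with hΘ
  have hΘ0 : 0 ≤ Θ := by positivity
  refine ⟨|M.yStar| + V * T + V + Θ + Θ * L, fun ε hε X hX t ht => ?_⟩
  have hv : ∀ t ∈ Icc 0 T, |vel M ε X t| ≤ V := by
    intro t ht
    have h1 := hX.energy_eq hM hε.1 ht
    have h2 := mul_nonneg (hX.θ_nonneg hM hε.1 hT ht) (hM.pos (X.y t)).le
    rw [abs_le]
    constructor <;> nlinarith [sq_nonneg (vel M ε X t - 1), sq_nonneg (vel M ε X t + 1)]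
  have hθn := hX.θ_nonneg hM hε.1 hT ht
  have hθ : |X.θ t| ≤ Θ := by
    rw [abs_of_nonneg hθn, hΘ, le_div_iff₀ hωLow]
    have h1 := hX.energy_eq hM hε.1 ht
    nlinarith [hωge (X.y t), sq_nonneg (vel M ε X t)]
  have hy : |X.y t - M.yStar| ≤ V * T := by
    have h0T : (0 : ℝ) ∈ Icc 0 T := ⟨le_rfl, hT⟩
    have := (convex_Icc 0 T).norm_image_sub_le_of_norm_hasDerivWithin_le
      (fun t ht => hX.hasDerivWithinAt_y hM ht) (fun t ht => hv t ht) h0T ht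
    rw [hX.init.2.2.1, Real.norm_eq_abs, Real.norm_eq_abs, sub_zero, abs_of_nonneg ht.1] at this
    exact this.trans (by have := ht.2; gcongr)
  have hl : |M.logD (X.y t)| ≤ L := by
    refine hL _ ?_
    rw [abs_le] at hy
    constructor <;> linarith [hy.1, hy.2]
  have hvt := hv t ht
  have hΘL : 0 ≤ Θ * L := by positivity
  have hya := abs_nonneg M.yStar
  refine ⟨?_, by linarith, by linarith, ?_⟩
  · have := abs_add_le (X.y t - M.yStar) M.yStar
    rw [sub_add_cancel] at this
    linarith
  · have hs := Real.abs_sin_le_one (2 * ε⁻¹ * X.φ t)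
    have e : X.p t = vel M ε X t - ε / 2 * X.θ t * M.logD (X.y t) *
      Real.sin (2 * ε⁻¹ * X.φ t) := by rw [vel]; ring
    have h3 : |ε / 2 * X.θ t * M.logD (X.y t) * Real.sin (2 * ε⁻¹ * X.φ t)| ≤ Θ * L := by
      rw [abs_mul, abs_mul, abs_mul]
      have : |ε / 2| ≤ 1 := by
        rw [abs_of_pos (half_pos hε.1)]
        linarith [hε.2]
      calc _ ≤ 1 * Θ * L * 1 := by gcongr
        _ = Θ * L := by ring
    rw [e]
    exact (abs_sub _ _).trans (by linarith)

/-! ### Near-identity transformations -/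

lemma IsLeadingOrder.energy_eq {M : Model} (hM : M.IsRegular) {T : ℝ} {X₀ : Path}
    (hX₀ : IsLeadingOrder M T X₀) {t : ℝ} (ht : t ∈ Icc 0 T) :
    X₀.p t ^ 2 / 2 + M.θStar * M.freq (X₀.y t) = M.energy := by
  have h := eq_of_hasDerivWithinAt_zero (T := T)
    (f := fun t => X₀.p t ^ 2 / 2 + M.θStar * M.freq (X₀.y t)) (by
      intro t ht
      have hp := hX₀.eq_p t ht
      have hw := (hM.hasDerivAt_freq (X₀.y t)).comp_hasDerivWithinAt t (hX₀.eq_y t ht)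
      refine (((hp.fun_pow 2).div_const 2).add (hw.const_mul M.θStar)).congr_deriv ?_
      rw [hM.deriv_freq]
      ring) t ht
  rw [h, hX₀.init.2.2.1, hX₀.init.2.2.2, Model.energy]

section corrected
variable {M : Model} (hM : M.IsRegular) {T ε : ℝ} (hε : 0 < ε) {X X₀ : Path}
  (hX : IsSolution M T ε X) (hX₀ : IsLeadingOrder M T X₀)

/-- Scaled residual of `y`, corrected by its oscillating part. -/
noncomputable def corrY (M : Model) (ε : ℝ) (X X₀ : Path) (t : ℝ) : ℝ :=
  (X.y t - X₀.y t) / ε ^ 2 + X.θ t * M.ampl (X.y t) * Real.cos (2 * ε⁻¹ * X.φ t)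

/-- Scaled residual of `p`, corrected by its oscillating part. -/
noncomputable def corrP (M : Model) (ε : ℝ) (X X₀ : Path) (t : ℝ) : ℝ :=
  (X.p t - X₀.p t) / ε ^ 2 + X.θ t * X.p t * M.amplD (X.y t) * Real.cos (2 * ε⁻¹ * X.φ t)

/-- Scaled residual of `φ`, corrected by its oscillating part. -/
noncomputable def corrΦ (M : Model) (ε : ℝ) (X X₀ : Path) (t : ℝ) : ℝ :=
  (X.φ t - X₀.φ t) / ε ^ 2 + vel M ε X t * M.ampl (X.y t) * Real.cos (2 * ε⁻¹ * X.φ t)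

include hM hε hX hX₀

/-- The residual contributes `ε⁻¹ θ (log ω)' sin / 2`, and since `ampl = (log ω)'/(4ω)` the
derivative of the added cosine removes it. The terms from `θ̇` (with `cos²`) and from the phase
correction (with `sin²`) share a coefficient and add up to a term without oscillating factor. -/
lemma hasDerivWithinAt_corrY {t : ℝ} (ht : t ∈ Icc 0 T) :
    HasDerivWithinAt (corrY M ε X X₀) (corrP M ε X X₀ t
      - X.θ t * M.ampl (X.y t) * M.logD (X.y t) * vel M ε X t
      - X.θ t * M.amplD (X.y t) * (vel M ε X t + X.p t) * Real.cos (2 * ε⁻¹ * X.φ t))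
      (Icc 0 T) t := by
  have hy := hX.hasDerivWithinAt_y hM ht
  have hn := (hM.hasDerivAt_ampl (X.y t)).comp_hasDerivWithinAt t hy
  have hc := hasDerivWithinAt_cos_phase (2 * ε⁻¹) (hX.hasDerivWithinAt_φ hM ht)
  have h := ((hy.sub (hX₀.eq_y t ht)).div_const (ε ^ 2)).add
    (((hX.hasDerivWithinAt_θ hM ht).mul hn).mul hc)
  refine h.congr_deriv ?_
  simp only [Function.comp_apply, Pi.mul_apply, corrP]
  have hsc := Real.sin_sq_add_cos_sq (2 * ε⁻¹ * X.φ t)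
  set C := Real.cos (2 * ε⁻¹ * X.φ t)
  set S := Real.sin (2 * ε⁻¹ * X.φ t) with hS
  have hv : X.p t = vel M ε X t - ε / 2 * X.θ t * M.logD (X.y t) * S := by rw [vel]; ring
  have hl : M.logD (X.y t) = 4 * M.freq (X.y t) * M.ampl (X.y t) := by
    rw [Model.ampl]
    have := hM.ne (X.y t)
    field_simp
  have hsc' : C ^ 2 = 1 - S ^ 2 := by linarith
  have e1 : (vel M ε X t - X₀.p t) / ε ^ 2 = (X.p t - X₀.p t) / ε ^ 2
      + 2 * ε⁻¹ * X.θ t * M.freq (X.y t) * M.ampl (X.y t) * S := by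
    rw [hv, hl]; field_simp; ring
  rw [e1]
  have e2 : ∀ x : ℝ, 2 * ε⁻¹ * (M.freq (X.y t) + ε / 2 * M.logD (X.y t) * vel M ε X t * S) * x
      = 2 * ε⁻¹ * M.freq (X.y t) * x + M.logD (X.y t) * vel M ε X t * S * x := by
    intro x; field_simp
  rw [e2]
  linear_combination (-(X.θ t * vel M ε X t * M.logD (X.y t) * M.ampl (X.y t))) * hsc

/-- The force is written through the energy, so its difference quotient involves only `y` and `p`.
The remaining `ε⁻¹` term has coefficient `θ p ((log ω)'² - (log ω)'')/2 = 2 ω θ p amplD`, which the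
added cosine cancels. -/
lemma hasDerivWithinAt_corrP {t : ℝ} (ht : t ∈ Icc 0 T) :
    HasDerivWithinAt (corrP M ε X X₀)
      (-(((M.energy - X.p t ^ 2 / 2) * M.logD (X.y t)
          - (M.energy - X₀.p t ^ 2 / 2) * M.logD (X₀.y t)) / ε ^ 2)
        + X.θ t ^ 2 * (M.logD (X.y t) ^ 3 / 8 - M.logD (X.y t) * M.logDD (X.y t) / 4)
          * Real.sin (2 * ε⁻¹ * X.φ t) ^ 2
        - X.θ t * X.p t * M.amplD (X.y t) * M.logD (X.y t) * vel M ε X t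
        + (X.θ t * (-(X.θ t * M.freq (X.y t) * M.logD (X.y t))
            - ε / 2 * X.θ t * M.logDD (X.y t) * vel M ε X t * Real.sin (2 * ε⁻¹ * X.φ t))
              * M.amplD (X.y t)
          + X.θ t * X.p t * deriv M.amplD (X.y t) * vel M ε X t)
          * Real.cos (2 * ε⁻¹ * X.φ t)) (Icc 0 T) t := by
  have hy := hX.hasDerivWithinAt_y hM ht
  have hp := hX.hasDerivWithinAt_p hM ht
  have hn := (hM.hasDerivAt_amplD (X.y t)).comp_hasDerivWithinAt t hy
  have hc := hasDerivWithinAt_cos_phase (2 * ε⁻¹) (hX.hasDerivWithinAt_φ hM ht)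
  have h := ((hp.sub (hX₀.eq_p t ht)).div_const (ε ^ 2)).add
    ((((hX.hasDerivWithinAt_θ hM ht).mul hp).mul hn).mul hc)
  refine h.congr_deriv ?_
  simp only [Function.comp_apply, Pi.mul_apply]
  have hE := hX.energy_eq hM hε ht
  have hE₀ := hX₀.energy_eq hM ht
  have hsc := Real.sin_sq_add_cos_sq (2 * ε⁻¹ * X.φ t)
  set C := Real.cos (2 * ε⁻¹ * X.φ t)
  set S := Real.sin (2 * ε⁻¹ * X.φ t) with hS
  have hv : vel M ε X t = X.p t + ε / 2 * X.θ t * M.logD (X.y t) * S := by rw [vel]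
  have hl : M.logD (X.y t) ^ 2 - M.logDD (X.y t) = 4 * M.freq (X.y t) * M.amplD (X.y t) := by
    rw [Model.amplD]
    have := hM.ne (X.y t)
    field_simp
  -- Expanding `vel² / 2` about `p² / 2` splits the force into the difference quotient, a bounded `S
  -- ^ 2` term and the singular `ε⁻¹ S` term.
  have e1 : (-(X.θ t * M.freq (X.y t) * M.logD (X.y t)) -
      ε / 2 * X.θ t * M.logDD (X.y t) * vel M ε X t * S
        - -(M.θStar * deriv M.freq (X₀.y t))) / ε ^ 2
      = -(((M.energy - X.p t ^ 2 / 2) * M.logD (X.y t)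
          - (M.energy - X₀.p t ^ 2 / 2) * M.logD (X₀.y t)) / ε ^ 2)
        + X.θ t ^ 2 * (M.logD (X.y t) ^ 3 / 8 - M.logD (X.y t) * M.logDD (X.y t) / 4) * S ^ 2
        + 2 * ε⁻¹ * M.freq (X.y t) * (X.θ t * X.p t * M.amplD (X.y t)) * S := by
    have h1 : X.θ t * M.freq (X.y t) = M.energy - vel M ε X t ^ 2 / 2 := by linarith
    have h2 : M.θStar * M.freq (X₀.y t) = M.energy - X₀.p t ^ 2 / 2 := by linarith
    have h3 : 2 * ε⁻¹ * M.freq (X.y t) * (X.θ t * X.p t * M.amplD (X.y t)) * S =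
      ε⁻¹ / 2 * (4 * M.freq (X.y t) * M.amplD (X.y t)) * X.θ t * X.p t * S := by ring
    rw [hM.deriv_freq, ← mul_assoc, h1, h2, h3, ← hl, hv]
    field_simp
    ring
  have e2 : ∀ x : ℝ, 2 * ε⁻¹ * (M.freq (X.y t) + ε / 2 * M.logD (X.y t) * vel M ε X t * S) * x
      = 2 * ε⁻¹ * M.freq (X.y t) * x + M.logD (X.y t) * vel M ε X t * S * x := by
    intro x; field_simp
  rw [e1, e2]
  linear_combination
    (-(X.θ t * X.p t * M.amplD (X.y t) * M.logD (X.y t) * vel M ε X t)) * hsc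

/-- The singular term of the phase residual is `ε⁻¹ (log ω)' vel sin / 2`. Using `vel` rather than
`p` in the correction makes the cancellation exact. -/
lemma hasDerivWithinAt_corrΦ {t : ℝ} (ht : t ∈ Icc 0 T) :
    HasDerivWithinAt (corrΦ M ε X X₀) ((M.freq (X.y t) - M.freq (X₀.y t)) / ε ^ 2
      + (-(X.θ t * M.freq (X.y t) * M.logD (X.y t) * (1 - Real.cos (2 * ε⁻¹ * X.φ t)))
          * M.ampl (X.y t) - vel M ε X t ^ 2 * M.amplD (X.y t)) * Real.cos (2 * ε⁻¹ * X.φ t)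
      - vel M ε X t ^ 2 * M.ampl (X.y t) * M.logD (X.y t) * Real.sin (2 * ε⁻¹ * X.φ t) ^ 2)
      (Icc 0 T) t := by
  have hy := hX.hasDerivWithinAt_y hM ht
  have hφ := hX.hasDerivWithinAt_φ hM ht
  have hn := (hM.hasDerivAt_ampl (X.y t)).comp_hasDerivWithinAt t hy
  have hc := hasDerivWithinAt_cos_phase (2 * ε⁻¹) hφ
  have h := ((hφ.sub (hX₀.eq_φ t ht)).div_const (ε ^ 2)).add
    (((hX.hasDerivWithinAt_vel hM hε ht).mul hn).mul hc)
  refine h.congr_deriv ?_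
  simp only [Function.comp_apply, Pi.mul_apply]
  have hl : M.logD (X.y t) = 4 * M.freq (X.y t) * M.ampl (X.y t) := by
    rw [Model.ampl]
    have := hM.ne (X.y t)
    field_simp
  set C := Real.cos (2 * ε⁻¹ * X.φ t)
  set S := Real.sin (2 * ε⁻¹ * X.φ t) with hS
  have e1 : (M.freq (X.y t) + ε / 2 * M.logD (X.y t) * vel M ε X t * S - M.freq (X₀.y t)) / ε ^ 2
      = (M.freq (X.y t) - M.freq (X₀.y t)) / ε ^ 2
        + 2 * ε⁻¹ * M.freq (X.y t) * M.ampl (X.y t) * vel M ε X t * S := by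
    rw [hl]; field_simp; ring
  have e2 : ∀ x : ℝ, 2 * ε⁻¹ * (M.freq (X.y t) + ε / 2 * M.logD (X.y t) * vel M ε X t * S) * x
      = 2 * ε⁻¹ * M.freq (X.y t) * x + M.logD (X.y t) * vel M ε X t * S * x := by
    intro x; field_simp
  rw [e1, e2]
  ring

end corrected

end FastSlow

namespace FastSlow

/-! ### A priori bounds for the corrected residuals -/

attribute [fun_prop] Model.IsRegular.continuous_deriv_amplD

section continuity
variable {M : Model} (hM : M.IsRegular)
include hM

@[fun_prop]
lemma Model.IsRegular.continuous_freq : Continuous M.freq := hM.smooth.continuous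

@[fun_prop]
lemma Model.IsRegular.continuous_logD : Continuous M.logD := hM.contDiff_logD.continuous

@[fun_prop]
lemma Model.IsRegular.continuous_logDD : Continuous M.logDD := hM.contDiff_logDD.continuous

@[fun_prop]
lemma Model.IsRegular.continuous_ampl : Continuous M.ampl := hM.contDiff_ampl.continuous

@[fun_prop]
lemma Model.IsRegular.continuous_amplD : Continuous M.amplD := hM.contDiff_amplD.continuous

end continuity

/-- Turns a nonlinear difference into a bounded coefficient times the residual, as Grönwall needs
before any convergence is known. -/
lemma exists_slope_unifBdd {T : ℝ} {g g' : ℝ → ℝ} (hg : ∀ z, HasDerivAt g (g' z) z)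
    (hg' : Continuous g') {x y : ℝ × ℝ → ℝ} (hx : UnifBdd T x) (hy : UnifBdd T y) :
    ∃ s, UnifBdd T s ∧ ∀ q, g (x q) - g (y q) = s q * (x q - y q) := by
  obtain ⟨K, hK, hxK⟩ := unifBdd_iff.1 hx
  obtain ⟨K', hK', hyK⟩ := unifBdd_iff.1 hy
  obtain ⟨L, hL⟩ := (isCompact_Icc (a := -(K + K')) (b := K + K')).exists_bound_of_continuousOn
    hg'.continuousOn
  -- Where `x q = y q` the quotient is `0` by convention, and the identity reads `0 = 0`.
  refine ⟨fun q => (g (x q) - g (y q)) / (x q - y q), unifBdd_iff.2 ⟨max L 1, by positivity, ?_⟩,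
    fun q => ?_⟩
  · filter_upwards [hxK, hyK] with ε h1 h2 t ht
    have m1 : x (ε, t) ∈ Icc (-(K + K')) (K + K') := by
      have := abs_le.1 (h1 t ht)
      constructor <;> linarith
    have m2 : y (ε, t) ∈ Icc (-(K + K')) (K + K') := by
      have := abs_le.1 (h2 t ht)
      constructor <;> linarith
    have h := (convex_Icc (-(K + K')) (K + K')).norm_image_sub_le_of_norm_hasDerivWithin_le
      (fun z _ => (hg z).hasDerivWithinAt) hL m2 m1
    rw [abs_div]
    refine div_le_of_le_mul₀ (abs_nonneg _) (by positivity) (h.trans ?_)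
    gcongr
    · exact le_max_left _ _
    · rfl
  · by_cases h : x q - y q = 0
    · rw [h, mul_zero, sub_eq_zero.1 h, sub_self]
    · rw [div_mul_cancel₀ _ h]

/-- Grönwall with coefficients that may depend on `ε` and are only bounded. Taking `e₂ = 0` covers a
single equation. -/
theorem unifBdd_of_linear {T : ℝ} {e₁ e₂ f₁ f₂ d a b : ℝ × ℝ → ℝ}
    (hd : UnifBdd T d) (ha : UnifBdd T a) (hb : UnifBdd T b)
    (hf₁ : UnifBdd T f₁) (hf₂ : UnifBdd T f₂) {c₁ c₂ : ℝ}
    (h0 : ∀ᶠ ε in 𝓝[>] (0 : ℝ), e₁ (ε, 0) = c₁ ∧ e₂ (ε, 0) = c₂)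
    (h : ∀ᶠ ε in 𝓝[>] (0 : ℝ), ∀ t ∈ Icc 0 T,
      HasDerivWithinAt (fun τ => e₁ (ε, τ)) (d (ε, t) * e₂ (ε, t) + f₁ (ε, t)) (Icc 0 T) t ∧
      HasDerivWithinAt (fun τ => e₂ (ε, τ))
        (a (ε, t) * e₁ (ε, t) + b (ε, t) * e₂ (ε, t) + f₂ (ε, t)) (Icc 0 T) t) :
    UnifBdd T e₁ ∧ UnifBdd T e₂ := by
  obtain ⟨D, hD0, hD⟩ := unifBdd_iff.1 hd
  obtain ⟨A, hA0, hA⟩ := unifBdd_iff.1 ha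
  obtain ⟨B, hB0, hB⟩ := unifBdd_iff.1 hb
  obtain ⟨F₁, hF₁0, hF₁⟩ := unifBdd_iff.1 hf₁
  obtain ⟨F₂, hF₂0, hF₂⟩ := unifBdd_iff.1 hf₂
  set K := D + A + B with hK
  set δ := F₁ + F₂ + |c₁| + |c₂| with hδ
  have hc₁ := abs_nonneg c₁
  have hc₂ := abs_nonneg c₂
  have hδ0 : 0 < δ := by positivity
  have key : ∀ᶠ ε in 𝓝[>] (0 : ℝ), ∀ t ∈ Icc 0 T,
      ‖(e₁ (ε, t), e₂ (ε, t))‖ ≤ 2 * Real.exp ((K + 1) * T) * δ := by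
    filter_upwards [h0, h, hD, hA, hB, hF₁, hF₂] with ε hi hder hD hA hB hF₁ hF₂
    refine norm_le_of_norm_deriv_le (T := T) (f := fun t => (e₁ (ε, t), e₂ (ε, t)))
      (f' := fun t => (d (ε, t) * e₂ (ε, t) + f₁ (ε, t),
        a (ε, t) * e₁ (ε, t) + b (ε, t) * e₂ (ε, t) + f₂ (ε, t))) (by positivity) hδ0.le
      (fun t ht => (hder t ht).1.prodMk (hder t ht).2) ?_ ?_
    · rw [hi.1, hi.2, Prod.norm_def]
      refine max_le ?_ ?_ <;> simp only [Real.norm_eq_abs] <;> linarith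
    · intro t ht
      set N := ‖(e₁ (ε, t), e₂ (ε, t))‖ with hN
      have hN0 : 0 ≤ N := norm_nonneg _
      have n1 : |e₁ (ε, t)| ≤ N := norm_fst_le (e₁ (ε, t), e₂ (ε, t))
      have n2 : |e₂ (ε, t)| ≤ N := norm_snd_le (e₁ (ε, t), e₂ (ε, t))
      have p1 : |d (ε, t) * e₂ (ε, t)| ≤ D * N := by
        rw [abs_mul]; gcongr; exact hD t ht
      have p2 : |a (ε, t) * e₁ (ε, t)| ≤ A * N := by
        rw [abs_mul]; gcongr; exact hA t ht
      have p3 : |b (ε, t) * e₂ (ε, t)| ≤ B * N := by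
        rw [abs_mul]; gcongr; exact hB t ht
      have q1 := hF₁ t ht
      have q2 := hF₂ t ht
      have z1 : 0 ≤ D * N := by positivity
      have z2 : 0 ≤ A * N := by positivity
      have z3 : 0 ≤ B * N := by positivity
      rw [Prod.norm_def]
      refine max_le ?_ ?_ <;> simp only [Real.norm_eq_abs] <;> refine (abs_add_le _ _).trans ?_
      · rw [hK]; linarith
      · have := abs_add_le (a (ε, t) * e₁ (ε, t)) (b (ε, t) * e₂ (ε, t))
        rw [hK]; linarith
  constructor <;> rw [unifBdd_iff] <;>
    refine ⟨2 * Real.exp ((K + 1) * T) * δ, by positivity, ?_⟩ <;>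
    filter_upwards [key] with ε hε t ht
  · exact (norm_fst_le (e₁ (ε, t), e₂ (ε, t))).trans (hε t ht)
  · exact (norm_snd_le (e₁ (ε, t), e₂ (ε, t))).trans (hε t ht)

/-- The hypotheses on the model, the exact solutions and the leading-order solution. -/
structure Setting (M : Model) (T : ℝ) (X : ℝ → Path) (X₀ : Path) : Prop where
  reg : M.IsRegular
  T_pos : 0 < T
  bound_below : ∃ ωLow > 0, ∀ η, ωLow ≤ M.freq η
  sol : ∀ᶠ ε in 𝓝[>] (0 : ℝ), IsSolution M T ε (X ε)
  lead : IsLeadingOrder M T X₀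

/-- The slow variables `(y, ẏ, θ, p)` of the exact solutions. -/
noncomputable def slow (M : Model) (X : ℝ → Path) (q : ℝ × ℝ) : ℝ × ℝ × ℝ × ℝ :=
  ((X q.1).y q.2, vel M q.1 (X q.1) q.2, (X q.1).θ q.2, (X q.1).p q.2)

/-- The leading-order slow variables. -/
noncomputable def slow₀ (M : Model) (X₀ : Path) (t : ℝ) : ℝ × ℝ × ℝ × ℝ :=
  (X₀.y t, X₀.p t, M.θStar, X₀.p t)

/-- The phase `2 φ_ε / ε`. -/
noncomputable def ph (X : ℝ → Path) (q : ℝ × ℝ) : ℝ := 2 * q.1⁻¹ * (X q.1).φ q.2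

/-- The leading-order phase `2 φ₀ / ε`. -/
noncomputable def ph₀ (X₀ : Path) (q : ℝ × ℝ) : ℝ := 2 * q.1⁻¹ * X₀.φ q.2

/-- `y₂^ε` as a function of `(ε,t)`. -/
noncomputable def resY (X : ℝ → Path) (X₀ : Path) (q : ℝ × ℝ) : ℝ :=
  ((X q.1).y q.2 - X₀.y q.2) / q.1 ^ 2

/-- `p₂^ε` as a function of `(ε,t)`. -/
noncomputable def resP (X : ℝ → Path) (X₀ : Path) (q : ℝ × ℝ) : ℝ :=
  ((X q.1).p q.2 - X₀.p q.2) / q.1 ^ 2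

/-- `φ₂^ε` as a function of `(ε,t)`. -/
noncomputable def resΦ (X : ℝ → Path) (X₀ : Path) (q : ℝ × ℝ) : ℝ :=
  ((X q.1).φ q.2 - X₀.φ q.2) / q.1 ^ 2

section setting
variable {M : Model} {T : ℝ} {X : ℝ → Path} {X₀ : Path} (S : Setting M T X X₀)
include S

lemma Setting.continuousOn_y : ContinuousOn X₀.y (Icc 0 T) :=
  fun t ht => (S.lead.eq_y t ht).continuousWithinAt

lemma Setting.continuousOn_p : ContinuousOn X₀.p (Icc 0 T) :=
  fun t ht => (S.lead.eq_p t ht).continuousWithinAt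

lemma Setting.continuousOn_φ : ContinuousOn X₀.φ (Icc 0 T) :=
  fun t ht => (S.lead.eq_φ t ht).continuousWithinAt

lemma Setting.continuousOn_slow₀ : ContinuousOn (slow₀ M X₀) (Icc 0 T) :=
  S.continuousOn_y.prodMk (S.continuousOn_p.prodMk (continuousOn_const.prodMk S.continuousOn_p))

/-- For small `ε` the slow variables lie in a fixed compact cube, on which any continuous `g` is
bounded. -/
lemma Setting.unifBdd_slow {g : ℝ × ℝ × ℝ × ℝ → ℝ} (hg : Continuous g) :
    UnifBdd T (fun q => g (slow M X q)) := by
  obtain ⟨ωLow, hωLow, hωge⟩ := S.bound_below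
  obtain ⟨K, hK⟩ := exists_bound_solution S.reg hωLow hωge S.T_pos.le
  obtain ⟨L, hL⟩ := ((isCompact_Icc (a := -K) (b := K)).prod ((isCompact_Icc (a := -K) (b := K)).prod
    ((isCompact_Icc (a := -K) (b := K)).prod (isCompact_Icc (a := -K) (b := K))))
    ).exists_bound_of_continuousOn hg.continuousOn
  refine unifBdd_iff.2 ⟨max L 1, by positivity, ?_⟩
  filter_upwards [S.sol, Ioc_mem_nhdsGT one_pos] with ε h1 h2 t ht
  obtain ⟨b1, b2, b3, b4⟩ := hK ε h2 _ h1 t ht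
  exact (hL _ ⟨abs_le.1 b1, abs_le.1 b2, abs_le.1 b3, abs_le.1 b4⟩).trans (le_max_left _ _)

lemma Setting.unifBdd_y : UnifBdd T (fun q => (X q.1).y q.2) := S.unifBdd_slow continuous_fst

lemma Setting.unifBdd_p : UnifBdd T (fun q => (X q.1).p q.2) :=
  S.unifBdd_slow (g := fun z => z.2.2.2) (by fun_prop)

/-- The residuals vanish at `t = 0`, where the cosine is `1` for every `ε`. These values are the
initial values of the averaged system, so the differences start at zero. -/
lemma Setting.corr_init : ∀ᶠ ε in 𝓝[>] (0 : ℝ),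
    corrY M ε (X ε) X₀ 0 = M.θStar * M.ampl M.yStar ∧
    corrP M ε (X ε) X₀ 0 = M.θStar * M.pStar * M.amplD M.yStar ∧
    corrΦ M ε (X ε) X₀ 0 = M.pStar * M.ampl M.yStar := by
  filter_upwards [S.sol] with ε h
  obtain ⟨i1, i2, i3, i4⟩ := h.init
  obtain ⟨j1, j2, j3, j4⟩ := S.lead.init
  simp [corrY, corrP, corrΦ, vel, i1, i2, i3, i4, j1, j3, j4]

lemma Setting.unifBdd_corrY_corrP :
    UnifBdd T (fun q => corrY M q.1 (X q.1) X₀ q.2) ∧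
    UnifBdd T (fun q => corrP M q.1 (X q.1) X₀ q.2) := by
  have hM := S.reg
  obtain ⟨s, hs, hse⟩ := exists_slope_unifBdd hM.hasDerivAt_logD hM.continuous_logDD
    S.unifBdd_y (unifBdd_of_continuousOn S.continuousOn_y)
  have hsin : UnifBdd T fun q => Real.sin (ph X q) := unifBdd_sin
  have hcos : UnifBdd T fun q => Real.cos (ph X q) := unifBdd_cos
  have hp₀ : UnifBdd T fun q => X₀.p q.2 := unifBdd_of_continuousOn S.continuousOn_p
  have hl₀ : UnifBdd T fun q => M.logD (X₀.y q.2) := unifBdd_of_continuousOn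
    (hM.continuous_logD.comp_continuousOn S.continuousOn_y)
  -- Coefficients of the residuals of `y` and `p` in the force: its difference is `(E - p²/2)((log
  -- ω)'(y) - (log ω)'(y₀)) - (p - p₀)(p + p₀)/2 · (log ω)'(y₀)`. Residuals are then replaced by
  -- corrected residuals minus bounded oscillating terms.
  set a : ℝ × ℝ → ℝ := fun q => -((M.energy - (X q.1).p q.2 ^ 2 / 2) * s q) with ha
  set b : ℝ × ℝ → ℝ := fun q => ((X q.1).p q.2 + X₀.p q.2) * (M.logD (X₀.y q.2) * (1 / 2)) with hb
  have hab : UnifBdd T a := by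
    refine ((unifBdd_const (-1)).mul
      ((S.unifBdd_slow (g := fun z => M.energy - z.2.2.2 ^ 2 / 2) (by fun_prop)).mul hs)).congr ?_
    filter_upwards with ε t _
    simp only [ha, slow]; ring
  have hbb : UnifBdd T b := (S.unifBdd_p.add hp₀).mul (hl₀.mul (unifBdd_const _))
  have hh : UnifBdd T fun q => (X q.1).θ q.2 * M.ampl ((X q.1).y q.2) * Real.cos (ph X q) :=
    (S.unifBdd_slow (g := fun z => z.2.2.1 * M.ampl z.1) (by fun_prop)).mul hcos
  have hq : UnifBdd T fun q =>
      (X q.1).θ q.2 * (X q.1).p q.2 * M.amplD ((X q.1).y q.2) * Real.cos (ph X q) :=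
    (S.unifBdd_slow (g := fun z => z.2.2.1 * z.2.2.2 * M.amplD z.1) (by fun_prop)).mul hcos
  have hf₁ := (S.unifBdd_slow (g := fun z => -(z.2.2.1 * M.ampl z.1 * M.logD z.1 * z.2.1))
    (by fun_prop)).sub ((S.unifBdd_slow
      (g := fun z => z.2.2.1 * M.amplD z.1 * (z.2.1 + z.2.2.2)) (by fun_prop)).mul hcos)
  have hr := (((S.unifBdd_slow (g := fun z => z.2.2.1 ^ 2 * (M.logD z.1 ^ 3 / 8 -
      M.logD z.1 * M.logDD z.1 / 4)) (by fun_prop)).mul (hsin.mul hsin)).sub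
    (S.unifBdd_slow (g := fun z => z.2.2.1 * z.2.2.2 * M.amplD z.1 * M.logD z.1 * z.2.1)
      (by fun_prop))).add
    (((S.unifBdd_slow (g := fun z => z.2.2.1 * (-(z.2.2.1 * M.freq z.1 * M.logD z.1)) * M.amplD z.1
      + z.2.2.1 * z.2.2.2 * deriv M.amplD z.1 * z.2.1) (by fun_prop)).sub
      (unifZero_fst.bdd.mul ((S.unifBdd_slow (g := fun z => z.2.2.1 * (1 / 2 * z.2.2.1 *
        M.logDD z.1 * z.2.1) * M.amplD z.1) (by fun_prop)).mul hsin))).mul hcos)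
  refine unifBdd_of_linear (unifBdd_const 1) hab hbb hf₁
    ((hr.sub (hab.mul hh)).sub (hbb.mul hq))
    (S.corr_init.mono fun ε h => ⟨h.1, h.2.1⟩) ?_
  filter_upwards [S.sol, self_mem_nhdsWithin] with ε hX hε t ht
  have hε : 0 < ε := hε
  refine ⟨(hasDerivWithinAt_corrY hM hε hX S.lead ht).congr_deriv ?_,
    (hasDerivWithinAt_corrP hM hε hX S.lead ht).congr_deriv ?_⟩
  · simp only [slow, ph]; ring
  · have e := hse (ε, t)
    simp only [slow, ph, ha, hb, corrY, corrP] at e ⊢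
    rw [show (M.energy - (X ε).p t ^ 2 / 2) * M.logD ((X ε).y t)
          - (M.energy - X₀.p t ^ 2 / 2) * M.logD (X₀.y t)
        = (M.energy - (X ε).p t ^ 2 / 2) * (M.logD ((X ε).y t) - M.logD (X₀.y t))
          - ((X ε).p t - X₀.p t) * ((X ε).p t + X₀.p t) / 2 * M.logD (X₀.y t) by ring, e]
    ring

lemma Setting.unifBdd_resY : UnifBdd T (resY X X₀) := by
  have hM := S.reg
  refine (S.unifBdd_corrY_corrP.1.sub ((S.unifBdd_slow (g := fun z => z.2.2.1 * M.ampl z.1)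
    (by fun_prop)).mul (unifBdd_cos (F := ph X)))).congr ?_
  filter_upwards with ε t _
  simp only [corrY, slow, ph, resY]; ring

lemma Setting.unifBdd_resP : UnifBdd T (resP X X₀) := by
  have hM := S.reg
  refine (S.unifBdd_corrY_corrP.2.sub ((S.unifBdd_slow
    (g := fun z => z.2.2.1 * z.2.2.2 * M.amplD z.1) (by fun_prop)).mul
      (unifBdd_cos (F := ph X)))).congr ?_
  filter_upwards with ε t _
  simp only [corrP, slow, ph, resP]; ring

lemma Setting.unifBdd_corrΦ : UnifBdd T (fun q => corrΦ M q.1 (X q.1) X₀ q.2) := by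
  have hM := S.reg
  obtain ⟨s, hs, hse⟩ := exists_slope_unifBdd hM.hasDerivAt_freq
    (hM.continuous_freq.mul hM.continuous_logD)
    S.unifBdd_y (unifBdd_of_continuousOn S.continuousOn_y)
  have hsin : UnifBdd T fun q => Real.sin (ph X q) := unifBdd_sin
  have hcos : UnifBdd T fun q => Real.cos (ph X q) := unifBdd_cos
  have hf := ((hs.mul S.unifBdd_resY).add
    (((S.unifBdd_slow (g := fun z => -(z.2.2.1 * M.freq z.1 * M.logD z.1) * M.ampl z.1
      - z.2.1 ^ 2 * M.amplD z.1) (by fun_prop)).add ((S.unifBdd_slow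
        (g := fun z => z.2.2.1 * M.freq z.1 * M.logD z.1 * M.ampl z.1)
        (by fun_prop)).mul hcos)).mul hcos)).sub
    ((S.unifBdd_slow (g := fun z => z.2.1 ^ 2 * M.ampl z.1 * M.logD z.1) (by fun_prop)).mul
      (hsin.mul hsin))
  -- The residual of `y` is already bounded, so the phase equation is a pure quadrature.
  refine (unifBdd_of_linear (e₂ := fun _ => 0) (c₁ := M.pStar * M.ampl M.yStar) (c₂ := 0)
    (unifBdd_const 0) (unifBdd_const 0)
    (unifBdd_const 0) hf (unifBdd_const 0) (S.corr_init.mono fun ε h => ⟨h.2.2, rfl⟩) ?_).1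
  filter_upwards [S.sol, self_mem_nhdsWithin] with ε hX hε t ht
  have hε : 0 < ε := hε
  refine ⟨(hasDerivWithinAt_corrΦ hM hε hX S.lead ht).congr_deriv ?_, ?_⟩
  · have e := hse (ε, t)
    simp only [slow, ph, resY] at e ⊢
    rw [e]
    ring
  · simpa using hasDerivWithinAt_const t (Icc 0 T) (0 : ℝ)

lemma Setting.unifBdd_resΦ : UnifBdd T (resΦ X X₀) := by
  have hM := S.reg
  refine (S.unifBdd_corrΦ.sub ((S.unifBdd_slow
    (g := fun z => z.2.1 * M.ampl z.1) (by fun_prop)).mul (unifBdd_cos (F := ph X)))).congr ?_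
  filter_upwards with ε t _
  simp only [corrΦ, slow, ph, resΦ]; ring

/-! ### Convergence of the slow variables and of the phase -/

omit S in
lemma unifZero_of_scaled {F : ℝ × ℝ → ℝ} (hF : UnifBdd T fun q => F q / q.1 ^ 2) :
    UnifZero T F := by
  refine (((unifZero_fst.mul_bdd unifZero_fst.bdd).mul_bdd hF)).congr ?_
  filter_upwards [self_mem_nhdsWithin] with ε hε t _
  have hε : (0 : ℝ) < ε := hε
  field_simp

lemma Setting.tendsto_slow :
    Tendsto (fun q => slow M X q - slow₀ M X₀ q.2) (unifFilter T) (𝓝 0) := by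
  have hM := S.reg
  have hy : UnifZero T fun q => (X q.1).y q.2 - X₀.y q.2 := unifZero_of_scaled S.unifBdd_resY
  have hp : UnifZero T fun q => (X q.1).p q.2 - X₀.p q.2 := unifZero_of_scaled S.unifBdd_resP
  have hv : UnifZero T fun q => vel M q.1 (X q.1) q.2 - X₀.p q.2 := by
    refine (hp.add (unifZero_fst.mul_bdd ((S.unifBdd_slow (g := fun z => 1 / 2 * z.2.2.1 *
      M.logD z.1) (by fun_prop)).mul (unifBdd_sin (F := ph X))))).congr ?_
    filter_upwards with ε t _
    simp only [vel, slow, ph]; ring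
  -- The equation for `θ` has an oscillating right-hand side of order one; the energy instead gives
  -- `θ = (E - v²/2)/ω(y)` as a continuous function of convergent quantities.
  have hθ : UnifZero T fun q => (X q.1).θ q.2 - M.θStar := by
    have hvy : Tendsto (fun q => ((X q.1).y q.2, vel M q.1 (X q.1) q.2) - (X₀.y q.2, X₀.p q.2))
        (unifFilter T) (𝓝 0) := Tendsto.prodMk_nhds hy hv
    have := unifZero_comp_sub (g := fun z : ℝ × ℝ => (M.energy - z.2 ^ 2 / 2) / M.freq z.1)
      (Continuous.div (by fun_prop) (by fun_prop) fun z => hM.ne z.1)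
      (x₀ := fun t => (X₀.y t, X₀.p t)) (S.continuousOn_y.prodMk S.continuousOn_p) hvy
    refine this.congr ?_
    filter_upwards [S.sol, self_mem_nhdsWithin] with ε hX hε t ht
    have e1 := hX.energy_eq hM hε ht
    have e2 := S.lead.energy_eq hM ht
    have n1 := hM.ne ((X ε).y t)
    have n2 := hM.ne (X₀.y t)
    congr 1
    · rw [div_eq_iff n1]; linarith
    · rw [div_eq_iff n2]; linarith
  exact hy.prodMk_nhds (hv.prodMk_nhds (hθ.prodMk_nhds hp))

lemma Setting.unifZero_slow {g : ℝ × ℝ × ℝ × ℝ → ℝ} (hg : Continuous g) :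
    UnifZero T (fun q => g (slow M X q) - g (slow₀ M X₀ q.2)) :=
  unifZero_comp_sub hg S.continuousOn_slow₀ S.tendsto_slow

/-- The difference of the phases is `2 ε φ₂`: the `ε²` accuracy of `φ_ε` survives division by `ε`.
-/
lemma Setting.unifZero_ph : UnifZero T (fun q => ph X q - ph₀ X₀ q) := by
  refine (unifZero_fst.mul_bdd ((unifBdd_const 2).mul S.unifBdd_resΦ)).congr ?_
  filter_upwards [self_mem_nhdsWithin] with ε hε t _
  have hε : (0 : ℝ) < ε := hε
  simp only [ph, ph₀, resΦ]
  field_simp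

lemma Setting.unifZero_cos (c : ℝ) :
    UnifZero T (fun q => Real.cos (c * ph X q) - Real.cos (c * ph₀ X₀ q)) := by
  have h : UnifZero T fun q => c * (ph X q - ph₀ X₀ q) := (unifBdd_const c).mul_zero S.unifZero_ph
  rw [UnifZero] at *
  refine squeeze_zero_norm (fun q => ?_) (tendsto_norm_zero.comp h)
  simp only [Function.comp_apply, Real.norm_eq_abs]
  rw [mul_sub]
  exact Real.abs_cos_sub_cos_le _ _

/-- Replacing `G` by `G₀` and `ph` by `ph₀` costs uniformly small errors; what is left is the
Riemann–Lebesgue lemma for the phase `φ₀`, whose velocity `ω(y₀)` is positive. -/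
lemma Setting.weakZero_mul_cos_ph {c : ℝ} (hc : 0 < c) {G : ℝ × ℝ → ℝ} {G₀ : ℝ → ℝ}
    (hG₀ : ContinuousOn G₀ (Icc 0 T)) (hG : UnifZero T fun q => G q - G₀ q.2) :
    WeakZero T (fun q => G q * Real.cos (c * ph X q)) := by
  have hM := S.reg
  have h1 : WeakZero T (fun q => G₀ q.2 * Real.cos (c * 2 * q.1⁻¹ * X₀.φ q.2)) := by
    refine weakZero_mul_cos (by positivity) S.lead.eq_φ ?_ (fun t _ => hM.pos _) hG₀
    have := S.continuousOn_y
    fun_prop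
  have h2 := (hG.mul_bdd (unifBdd_cos (F := fun q => c * ph X q))).weakZero
  have h3 := ((unifBdd_of_continuousOn hG₀).mul_zero (S.unifZero_cos c)).weakZero
  refine ((h1.add h2).add h3).congr ?_
  filter_upwards with ε t _
  simp only [ph₀]
  ring_nf

lemma Setting.weakZero_slow_mul_cos {c : ℝ} (hc : 0 < c) {g : ℝ × ℝ × ℝ × ℝ → ℝ}
    (hg : Continuous g) : WeakZero T (fun q => g (slow M X q) * Real.cos (c * ph X q)) :=
  S.weakZero_mul_cos_ph hc (G₀ := fun t => g (slow₀ M X₀ t))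
    (hg.comp_continuousOn S.continuousOn_slow₀) (S.unifZero_slow hg)

end setting

end FastSlow

namespace FastSlow

/-! ### The averaged second-order system in explicit form -/

section explicit
variable {M : Model} {T : ℝ} {X : ℝ → Path} {X₀ : Path}

lemma Model.IsRegular.hasDerivAt_log_freq (hM : M.IsRegular) (η : ℝ) :
    HasDerivAt (fun η => Real.log (M.freq η)) (M.logD η) η := by
  refine ((hM.hasDerivAt_freq η).log (hM.ne η)).congr_deriv ?_
  rw [mul_div_cancel_left₀ _ (hM.ne η)]

lemma Model.IsRegular.deriv_log_freq (hM : M.IsRegular) :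
    deriv (fun η => Real.log (M.freq η)) = M.logD :=
  funext fun η => (hM.hasDerivAt_log_freq η).deriv

lemma Model.IsRegular.iteratedDeriv_two_log_freq (hM : M.IsRegular) :
    iteratedDeriv 2 (fun η => Real.log (M.freq η)) = M.logDD := by
  rw [iteratedDeriv_succ, iteratedDeriv_one, hM.deriv_log_freq]
  exact funext fun η => (hM.hasDerivAt_logD η).deriv

variable (S : Setting M T X X₀)
include S

lemma Setting.uniqueDiffOn : UniqueDiffOn ℝ (Icc 0 T) := uniqueDiffOn_Icc S.T_pos

lemma Setting.zero_mem : (0 : ℝ) ∈ Icc 0 T := ⟨le_rfl, S.T_pos.le⟩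

lemma Setting.hasDerivWithinAt_comp_y {g : ℝ → ℝ} {g' t : ℝ} (hg : HasDerivAt g g' (X₀.y t))
    (ht : t ∈ Icc 0 T) : HasDerivWithinAt (fun τ => g (X₀.y τ)) (g' * X₀.p t) (Icc 0 T) t :=
  hg.comp_hasDerivWithinAt t (S.lead.eq_y t ht)

lemma Setting.hasDerivWithinAt_p {t : ℝ} (ht : t ∈ Icc 0 T) :
    HasDerivWithinAt X₀.p (-(M.θStar * M.freq (X₀.y t) * M.logD (X₀.y t))) (Icc 0 T) t := by
  refine (S.lead.eq_p t ht).congr_deriv ?_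
  rw [S.reg.deriv_freq, mul_assoc]

lemma Setting.DL_zero_one (t : ℝ) : DL M T X₀ 0 1 t = M.logD (X₀.y t) := by
  simp [DL, iteratedDeriv_one, S.reg.deriv_log_freq]

lemma Setting.DL_zero_two (t : ℝ) : DL M T X₀ 0 2 t = M.logDD (X₀.y t) := by
  simp [DL, S.reg.iteratedDeriv_two_log_freq]

lemma Setting.DL_one_zero {t : ℝ} (ht : t ∈ Icc 0 T) :
    DL M T X₀ 1 0 t = M.logD (X₀.y t) * X₀.p t := by
  simp only [DL, iteratedDerivWithin_one, iteratedDeriv_zero]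
  exact (S.hasDerivWithinAt_comp_y (S.reg.hasDerivAt_log_freq _) ht).derivWithin
    (S.uniqueDiffOn t ht)

lemma Setting.DL_one_one {t : ℝ} (ht : t ∈ Icc 0 T) :
    DL M T X₀ 1 1 t = M.logDD (X₀.y t) * X₀.p t := by
  simp only [DL, iteratedDerivWithin_one, iteratedDeriv_one, S.reg.deriv_log_freq]
  exact (S.hasDerivWithinAt_comp_y (S.reg.hasDerivAt_logD _) ht).derivWithin
    (S.uniqueDiffOn t ht)

lemma Setting.derivWithin_ampl {t : ℝ} (ht : t ∈ Icc 0 T) :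
    derivWithin (fun τ => M.θStar * DL M T X₀ 0 1 τ / (4 * M.freq (X₀.y τ))) (Icc 0 T) t
      = -(M.θStar * X₀.p t * M.amplD (X₀.y t)) := by
  have h := (S.hasDerivWithinAt_comp_y (S.reg.hasDerivAt_ampl _) ht).const_mul M.θStar
  have e : (fun τ => M.θStar * DL M T X₀ 0 1 τ / (4 * M.freq (X₀.y τ)))
      = fun τ => M.θStar * M.ampl (X₀.y τ) := by
    funext τ
    rw [S.DL_zero_one, Model.ampl, mul_div_assoc]
  rw [e, h.derivWithin (S.uniqueDiffOn t ht)]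
  ring

/-- The function is `θ_* (D_t L₀)² / (8 ω²)` in explicit form, which is `θ̄₂` up to a constant. -/
lemma Setting.hasDerivWithinAt_sq_ampl {t : ℝ} (ht : t ∈ Icc 0 T) :
    HasDerivWithinAt (fun τ => 2 * M.θStar * (X₀.p τ * M.ampl (X₀.y τ)) ^ 2)
      (4 * M.θStar * (X₀.p t * M.ampl (X₀.y t)) *
        (-(M.θStar * M.freq (X₀.y t) * M.logD (X₀.y t)) * M.ampl (X₀.y t)
          - X₀.p t ^ 2 * M.amplD (X₀.y t))) (Icc 0 T) t := by
  have h := (((S.hasDerivWithinAt_p ht).fun_mul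
    (S.hasDerivWithinAt_comp_y (S.reg.hasDerivAt_ampl _) ht)).fun_pow 2).const_mul (2 * M.θStar)
  refine h.congr_deriv ?_
  ring

lemma Setting.derivWithin_sq_ampl {t : ℝ} (ht : t ∈ Icc 0 T) :
    derivWithin (fun τ => M.θStar * DL M T X₀ 1 0 τ ^ 2 / (8 * M.freq (X₀.y τ) ^ 2)) (Icc 0 T) t
      = 4 * M.θStar * (X₀.p t * M.ampl (X₀.y t)) *
        (-(M.θStar * M.freq (X₀.y t) * M.logD (X₀.y t)) * M.ampl (X₀.y t)
          - X₀.p t ^ 2 * M.amplD (X₀.y t)) := by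
  have e : ∀ τ ∈ Icc 0 T, M.θStar * DL M T X₀ 1 0 τ ^ 2 / (8 * M.freq (X₀.y τ) ^ 2)
      = 2 * M.θStar * (X₀.p τ * M.ampl (X₀.y τ)) ^ 2 := by
    intro τ hτ
    rw [S.DL_one_zero hτ, Model.ampl]
    have := S.reg.ne (X₀.y τ)
    field_simp
    ring
  rw [derivWithin_congr e (e t ht)]
  exact (S.hasDerivWithinAt_sq_ampl ht).derivWithin (S.uniqueDiffOn t ht)

/-! The oscillating functions in explicit form. -/

lemma Setting.oscθ₁_eq (q : ℝ × ℝ) (ht : q.2 ∈ Icc 0 T) : oscθ₁ M T X₀ q.1 q.2 =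
    -(2 * M.θStar * X₀.p q.2 * M.ampl (X₀.y q.2)) * Real.sin (ph₀ X₀ q) := by
  rw [oscθ₁, S.DL_one_zero ht, Model.ampl, ph₀]
  have := S.reg.ne (X₀.y q.2)
  field_simp
  ring

lemma Setting.oscφ₂_eq (q : ℝ × ℝ) (ht : q.2 ∈ Icc 0 T) : oscφ₂ M T X₀ q.1 q.2 =
    -(X₀.p q.2 * M.ampl (X₀.y q.2)) * Real.cos (ph₀ X₀ q) := by
  rw [oscφ₂, S.DL_one_zero ht, Model.ampl, ph₀]
  ring

lemma Setting.oscy₂_eq (q : ℝ × ℝ) : oscy₂ M T X₀ q.1 q.2 =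
    -(M.θStar * M.ampl (X₀.y q.2)) * Real.cos (ph₀ X₀ q) := by
  rw [oscy₂, S.DL_zero_one, Model.ampl, ph₀]
  ring

lemma Setting.oscp₂_eq (q : ℝ × ℝ) (ht : q.2 ∈ Icc 0 T) : oscp₂ M T X₀ q.1 q.2 =
    -(M.θStar * X₀.p q.2 * M.amplD (X₀.y q.2)) * Real.cos (ph₀ X₀ q) := by
  rw [oscp₂, S.derivWithin_ampl ht, ph₀]

/-- The factor `ω` removes the denominators, and `cos 2x = 1 - 2 sin² x` brings the fourth term to
the form in which the energy expansion produces it. -/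
lemma Setting.freq_mul_oscθ₂ (b : ℝ → ℝ) (q : ℝ × ℝ) (ht : q.2 ∈ Icc 0 T) :
    M.freq (X₀.y q.2) * oscθ₂ M T X₀ b q.1 q.2 =
      M.θStar * M.freq (X₀.y q.2) * M.logD (X₀.y q.2) *
        (M.θStar * M.ampl (X₀.y q.2) * Real.cos (ph₀ X₀ q))
      + X₀.p q.2 * (M.θStar * X₀.p q.2 * M.amplD (X₀.y q.2) * Real.cos (ph₀ X₀ q))
      + M.θStar ^ 2 * M.logD (X₀.y q.2) ^ 2 / 16 * (1 - 2 * Real.sin (ph₀ X₀ q) ^ 2)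
      - M.θStar * X₀.p q.2 * M.logD (X₀.y q.2) * b q.2 * Real.cos (ph₀ X₀ q) := by
  have e : Real.cos (4 * q.1⁻¹ * X₀.φ q.2) = 1 - 2 * Real.sin (ph₀ X₀ q) ^ 2 := by
    rw [show 4 * q.1⁻¹ * X₀.φ q.2 = 2 * ph₀ X₀ q by rw [ph₀]; ring, Real.cos_two_mul,
      Real.cos_sq']
    ring
  rw [oscθ₂, e, S.oscp₂_eq q ht, S.oscy₂_eq, S.DL_zero_one, S.DL_one_zero ht,
    show Real.cos (2 * q.1⁻¹ * X₀.φ q.2) = Real.cos (ph₀ X₀ q) by rw [ph₀]]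
  have := S.reg.ne (X₀.y q.2)
  field_simp
  ring

/-- The averaged second-order system with all `D`-terms evaluated. -/
lemma Setting.isSecondOrder_iff {B : Path} : IsSecondOrder M T X₀ B ↔
    (B.φ 0 = M.pStar * M.ampl M.yStar ∧
      M.freq M.yStar * B.θ 0 = -(M.θStar * M.freq M.yStar * M.logD M.yStar * B.y 0)
        - M.pStar * B.p 0 - M.θStar ^ 2 * M.logD M.yStar ^ 2 / 16
        + M.θStar * M.pStar * M.logD M.yStar * B.φ 0 ∧
      B.y 0 = M.θStar * M.ampl M.yStar ∧ B.p 0 = M.θStar * M.pStar * M.amplD M.yStar) ∧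
    ∀ t ∈ Icc 0 T,
      HasDerivWithinAt B.φ (M.freq (X₀.y t) * M.logD (X₀.y t) * B.y t
        + M.θStar * M.logD (X₀.y t) ^ 2 / 8
        - X₀.p t ^ 2 * M.logD (X₀.y t) * M.ampl (X₀.y t) / 2) (Icc 0 T) t ∧
      HasDerivWithinAt B.θ (4 * M.θStar * (X₀.p t * M.ampl (X₀.y t)) *
        (-(M.θStar * M.freq (X₀.y t) * M.logD (X₀.y t)) * M.ampl (X₀.y t)
          - X₀.p t ^ 2 * M.amplD (X₀.y t))) (Icc 0 T) t ∧
      HasDerivWithinAt B.y (B.p t - M.θStar * M.ampl (X₀.y t) * M.logD (X₀.y t) * X₀.p t)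
        (Icc 0 T) t ∧
      HasDerivWithinAt B.p (-(M.freq (X₀.y t) * M.logD (X₀.y t) * B.θ t)
        - M.θStar * M.freq (X₀.y t) * (M.logDD (X₀.y t) + M.logD (X₀.y t) ^ 2) * B.y t
        - M.θStar ^ 2 * M.logD (X₀.y t) * M.logDD (X₀.y t) / 8
        + M.θStar * X₀.p t ^ 2 * M.ampl (X₀.y t) * M.logDD (X₀.y t)) (Icc 0 T) t := by
  have h0 := S.zero_mem
  obtain ⟨j1, j2, j3, j4⟩ := S.lead.init
  have hinit : (∀ ε > 0, B.φ 0 = -oscφ₂ M T X₀ ε 0 ∧ B.θ 0 = -oscθ₂ M T X₀ B.φ ε 0 ∧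
      B.y 0 = -oscy₂ M T X₀ ε 0 ∧ B.p 0 = -oscp₂ M T X₀ ε 0) ↔
    (B.φ 0 = M.pStar * M.ampl M.yStar ∧
      M.freq M.yStar * B.θ 0 = -(M.θStar * M.freq M.yStar * M.logD M.yStar * B.y 0)
        - M.pStar * B.p 0 - M.θStar ^ 2 * M.logD M.yStar ^ 2 / 16
        + M.θStar * M.pStar * M.logD M.yStar * B.φ 0 ∧
      B.y 0 = M.θStar * M.ampl M.yStar ∧ B.p 0 = M.θStar * M.pStar * M.amplD M.yStar) := by
    -- At `t = 0` the leading phase is zero for every `ε`, so all oscillating terms take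
    -- `ε`-independent values and one `ε` suffices.
    have hε : ∀ ε : ℝ, (B.φ 0 = -oscφ₂ M T X₀ ε 0 ∧ B.θ 0 = -oscθ₂ M T X₀ B.φ ε 0 ∧
      B.y 0 = -oscy₂ M T X₀ ε 0 ∧ B.p 0 = -oscp₂ M T X₀ ε 0) ↔
    (B.φ 0 = M.pStar * M.ampl M.yStar ∧
      M.freq M.yStar * B.θ 0 = -(M.θStar * M.freq M.yStar * M.logD M.yStar * B.y 0)
        - M.pStar * B.p 0 - M.θStar ^ 2 * M.logD M.yStar ^ 2 / 16
        + M.θStar * M.pStar * M.logD M.yStar * B.φ 0 ∧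
      B.y 0 = M.θStar * M.ampl M.yStar ∧ B.p 0 = M.θStar * M.pStar * M.amplD M.yStar) := by
      intro ε
      have n := S.reg.ne M.yStar
      have p0 : ph₀ X₀ (ε, 0) = 0 := by simp [ph₀, j1]
      have e1 := S.oscφ₂_eq (ε, 0) h0
      have e2 := S.freq_mul_oscθ₂ B.φ (ε, 0) h0
      have e3 := S.oscy₂_eq (ε, 0)
      have e4 := S.oscp₂_eq (ε, 0) h0
      simp only [p0, Real.cos_zero, Real.sin_zero, j3, j4] at e1 e2 e3 e4
      rw [e1, e3, e4]
      have e5 : B.θ 0 = -oscθ₂ M T X₀ B.φ ε 0 ↔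
          M.freq M.yStar * B.θ 0 = -(M.freq M.yStar * oscθ₂ M T X₀ B.φ ε 0) := by
        rw [← mul_neg, mul_right_inj' n]
      rw [e5, e2]
      constructor
      · rintro ⟨a1, a2, a3, a4⟩
        refine ⟨by linarith, ?_, by linarith, by linarith⟩
        rw [a2, a3, a4]; ring
      · rintro ⟨a1, a2, a3, a4⟩
        refine ⟨by linarith, ?_, by linarith, by linarith⟩
        rw [a2, a3, a4]; ring
    exact ⟨fun h => (hε 1).1 (h 1 one_pos), fun h ε _ => (hε ε).2 h⟩
  have e1 : ∀ t ∈ Icc 0 T, deriv M.freq (X₀.y t) * B.y t + M.θStar * DL M T X₀ 0 1 t ^ 2 / 8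
      - DL M T X₀ 1 0 t ^ 2 / (8 * M.freq (X₀.y t)) =
      M.freq (X₀.y t) * M.logD (X₀.y t) * B.y t + M.θStar * M.logD (X₀.y t) ^ 2 / 8
        - X₀.p t ^ 2 * M.logD (X₀.y t) * M.ampl (X₀.y t) / 2 := by
    intro t ht
    rw [S.reg.deriv_freq, S.DL_zero_one, S.DL_one_zero ht, Model.ampl]
    have := S.reg.ne (X₀.y t)
    field_simp
    ring
  have e3 : ∀ t ∈ Icc 0 T,
      B.p t - M.θStar * DL M T X₀ 0 1 t * DL M T X₀ 1 0 t / (4 * M.freq (X₀.y t)) =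
      B.p t - M.θStar * M.ampl (X₀.y t) * M.logD (X₀.y t) * X₀.p t := by
    intro t ht
    rw [S.DL_zero_one, S.DL_one_zero ht, Model.ampl]
    have := S.reg.ne (X₀.y t)
    field_simp
  have e4 : ∀ t ∈ Icc 0 T, -(deriv M.freq (X₀.y t) * B.θ t)
      - M.θStar * iteratedDeriv 2 M.freq (X₀.y t) * B.y t
      - M.θStar ^ 2 * DL M T X₀ 0 1 t * DL M T X₀ 0 2 t / 8
      + M.θStar * DL M T X₀ 1 0 t * DL M T X₀ 1 1 t / (4 * M.freq (X₀.y t)) =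
      -(M.freq (X₀.y t) * M.logD (X₀.y t) * B.θ t)
        - M.θStar * M.freq (X₀.y t) * (M.logDD (X₀.y t) + M.logD (X₀.y t) ^ 2) * B.y t
        - M.θStar ^ 2 * M.logD (X₀.y t) * M.logDD (X₀.y t) / 8
        + M.θStar * X₀.p t ^ 2 * M.ampl (X₀.y t) * M.logDD (X₀.y t) := by
    intro t ht
    rw [S.DL_zero_one, S.DL_zero_two, S.DL_one_zero ht, S.DL_one_one ht, S.reg.deriv_freq,
      S.reg.iteratedDeriv_two_freq, Model.ampl]
    have := S.reg.ne (X₀.y t)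
    field_simp
  constructor
  · intro h
    refine ⟨hinit.1 h.init, fun t ht => ⟨?_, ?_, ?_, ?_⟩⟩
    · rw [← e1 t ht]; exact h.eq_φ t ht
    · rw [← S.derivWithin_sq_ampl ht]; exact h.eq_θ t ht
    · rw [← e3 t ht]; exact h.eq_y t ht
    · rw [← e4 t ht]; exact h.eq_p t ht
  · rintro ⟨hi, h⟩
    refine ⟨hinit.2 hi, fun t ht => ?_, fun t ht => ?_, fun t ht => ?_, fun t ht => ?_⟩
    · rw [e1 t ht]; exact (h t ht).1
    · rw [S.derivWithin_sq_ampl ht]; exact (h t ht).2.1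
    · rw [e3 t ht]; exact (h t ht).2.2.1
    · rw [e4 t ht]; exact (h t ht).2.2.2

/-- The system is triangular: `θ̄₂` is explicit, `(ȳ₂, p̄₂)` solves a planar linear system forced by
it, and `φ̄₂` is a quadrature. -/
theorem Setting.exists_isSecondOrder : ∃ B : Path, IsSecondOrder M T X₀ B := by
  have hM := S.reg
  have hy := S.continuousOn_y
  have hp := S.continuousOn_p
  have hfr : ContinuousOn (fun t => M.freq (X₀.y t)) (Icc 0 T) :=
    hM.continuous_freq.comp_continuousOn hy
  have hl : ContinuousOn (fun t => M.logD (X₀.y t)) (Icc 0 T) :=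
    hM.continuous_logD.comp_continuousOn hy
  have hll : ContinuousOn (fun t => M.logDD (X₀.y t)) (Icc 0 T) :=
    hM.continuous_logDD.comp_continuousOn hy
  have ham : ContinuousOn (fun t => M.ampl (X₀.y t)) (Icc 0 T) :=
    hM.continuous_ampl.comp_continuousOn hy
  -- Initial value of `θ̄₂`; the initial values of the other unknowns, on which it depends, are
  -- inserted explicitly, so there is no circularity.
  set c := (-(M.θStar * M.freq M.yStar * M.logD M.yStar * (M.θStar * M.ampl M.yStar))
        - M.pStar * (M.θStar * M.pStar * M.amplD M.yStar) - M.θStar ^ 2 * M.logD M.yStar ^ 2 / 16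
        + M.θStar * M.pStar * M.logD M.yStar * (M.pStar * M.ampl M.yStar)) / M.freq M.yStar with hc
  set Θ : ℝ → ℝ := fun t => 2 * M.θStar * (X₀.p t * M.ampl (X₀.y t)) ^ 2
    + (c - 2 * M.θStar * (X₀.p 0 * M.ampl (X₀.y 0)) ^ 2) with hΘ
  have hΘd : ∀ t ∈ Icc 0 T, HasDerivWithinAt Θ _ (Icc 0 T) t := fun t ht =>
    (S.hasDerivWithinAt_sq_ampl ht).add_const _
  have hΘc : ContinuousOn Θ (Icc 0 T) := fun t ht => (hΘd t ht).continuousWithinAt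
  obtain ⟨y, p, y0, p0, hyp⟩ := exists_solution_linear S.T_pos.le
    (a := fun t => -(M.θStar * M.freq (X₀.y t) * (M.logDD (X₀.y t) + M.logD (X₀.y t) ^ 2)))
    (b := fun _ => 0)
    (b₁ := fun t => -(M.θStar * M.ampl (X₀.y t) * M.logD (X₀.y t) * X₀.p t))
    (b₂ := fun t => -(M.freq (X₀.y t) * M.logD (X₀.y t) * Θ t)
        - M.θStar ^ 2 * M.logD (X₀.y t) * M.logDD (X₀.y t) / 8
        + M.θStar * X₀.p t ^ 2 * M.ampl (X₀.y t) * M.logDD (X₀.y t))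
    (by fun_prop) (by fun_prop) (by fun_prop) (by fun_prop)
    (M.θStar * M.ampl M.yStar) (M.θStar * M.pStar * M.amplD M.yStar)
  have hyc : ContinuousOn y (Icc 0 T) := fun t ht => (hyp t ht).1.continuousWithinAt
  -- A quadrature as a planar system whose second component has zero derivative and zero initial
  -- value.
  obtain ⟨φ, z, φ0, z0, hφ⟩ := exists_solution_linear S.T_pos.le (a := fun _ => 0)
    (b := fun _ => 0) (b₂ := fun _ => 0)
    (b₁ := fun t => M.freq (X₀.y t) * M.logD (X₀.y t) * y t + M.θStar * M.logD (X₀.y t) ^ 2 / 8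
        - X₀.p t ^ 2 * M.logD (X₀.y t) * M.ampl (X₀.y t) / 2)
    (by fun_prop) (by fun_prop) (by fun_prop) (by fun_prop) (M.pStar * M.ampl M.yStar) 0
  have hz : ∀ t ∈ Icc 0 T, z t = 0 := by
    intro t ht
    rw [← z0]
    exact eq_of_hasDerivWithinAt_zero (fun t ht => (hφ t ht).2.congr_deriv (by simp)) t ht
  refine ⟨⟨φ, Θ, y, p⟩, S.isSecondOrder_iff.2 ⟨⟨φ0, ?_, y0, p0⟩, fun t ht => ⟨?_, hΘd t ht, ?_, ?_⟩⟩⟩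
  · simp only [hΘ, y0, p0, φ0, add_sub_cancel]
    rw [hc, mul_div_cancel₀ _ (hM.ne _)]
  · refine (hφ t ht).1.congr_deriv ?_
    rw [hz t ht, zero_add]
  · exact (hyp t ht).1.congr_deriv (by ring)
  · exact (hyp t ht).2.congr_deriv (by ring)

/-- The second-order term of the conserved energy vanishes. -/
lemma Setting.energy_second_order {B : Path} (hB : IsSecondOrder M T X₀ B) {t : ℝ}
    (ht : t ∈ Icc 0 T) :
    M.freq (X₀.y t) * B.θ t + M.θStar * M.freq (X₀.y t) * M.logD (X₀.y t) * B.y t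
      + X₀.p t * B.p t + M.θStar ^ 2 * M.logD (X₀.y t) ^ 2 / 16
      - 4 * M.θStar * M.freq (X₀.y t) * (X₀.p t * M.ampl (X₀.y t)) ^ 2 = 0 := by
  obtain ⟨⟨i1, i2, i3, i4⟩, h⟩ := S.isSecondOrder_iff.1 hB
  have hl : ∀ η, M.logD η = 4 * M.freq η * M.ampl η := by
    intro η
    rw [Model.ampl]
    have := S.reg.ne η
    field_simp
  have hll : ∀ η, M.logDD η = M.logD η ^ 2 - 4 * M.freq η * M.amplD η := by
    intro η
    rw [Model.amplD]
    have := S.reg.ne η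
    field_simp
    ring
  have hconst := eq_of_hasDerivWithinAt_zero (T := T) (f := fun t =>
      M.freq (X₀.y t) * B.θ t + M.θStar * (M.freq (X₀.y t) * M.logD (X₀.y t)) * B.y t
      + X₀.p t * B.p t + M.θStar ^ 2 / 16 * M.logD (X₀.y t) ^ 2
      - 4 * M.θStar * (M.freq (X₀.y t) * (X₀.p t * M.ampl (X₀.y t)) ^ 2)) (by
    intro t ht
    obtain ⟨-, dθ, dy, dp⟩ := h t ht
    have dw := S.hasDerivWithinAt_comp_y (S.reg.hasDerivAt_freq _) ht
    have dl := S.hasDerivWithinAt_comp_y (S.reg.hasDerivAt_logD _) ht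
    have dn := S.hasDerivWithinAt_comp_y (S.reg.hasDerivAt_ampl _) ht
    have dp₀ := S.hasDerivWithinAt_p ht
    refine (((((dw.fun_mul dθ).fun_add (((dw.fun_mul dl).const_mul M.θStar).fun_mul dy)).fun_add
      (dp₀.fun_mul dp)).fun_add ((dl.fun_pow 2).const_mul (M.θStar ^ 2 / 16))).fun_sub
      ((dw.fun_mul ((dp₀.fun_mul dn).fun_pow 2)).const_mul (4 * M.θStar))).congr_deriv ?_
    rw [hll, hl]
    push_cast
    ring) t ht
  -- The initial values of `θ̄₂` and `φ̄₂` are inserted; the `φ̄₂(0)` term cancels the square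
  -- because `(log ω)' = 4 ω ampl`.
  have h00 : M.freq (X₀.y 0) * B.θ 0 + M.θStar * (M.freq (X₀.y 0) * M.logD (X₀.y 0)) * B.y 0
      + X₀.p 0 * B.p 0 + M.θStar ^ 2 / 16 * M.logD (X₀.y 0) ^ 2
      - 4 * M.θStar * (M.freq (X₀.y 0) * (X₀.p 0 * M.ampl (X₀.y 0)) ^ 2) = 0 := by
    rw [S.lead.init.2.2.1, S.lead.init.2.2.2, i2, i1, hl]
    ring
  simp only [h00] at hconst
  linarith

end explicit

end FastSlow

namespace FastSlow

/-! ### Convergence of the corrected residuals -/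

section convergence
variable {M : Model} {T : ℝ} {X : ℝ → Path} {X₀ B : Path}

lemma IsSecondOrder.continuousOn (hB : IsSecondOrder M T X₀ B) :
    ContinuousOn B.φ (Icc 0 T) ∧ ContinuousOn B.θ (Icc 0 T) ∧ ContinuousOn B.y (Icc 0 T) ∧
      ContinuousOn B.p (Icc 0 T) :=
  ⟨fun t ht => (hB.eq_φ t ht).continuousWithinAt, fun t ht => (hB.eq_θ t ht).continuousWithinAt,
    fun t ht => (hB.eq_y t ht).continuousWithinAt, fun t ht => (hB.eq_p t ht).continuousWithinAt⟩

lemma unifZero_mul_sub {F F₀ G G₀ : ℝ × ℝ → ℝ} (hF : UnifZero T fun q => F q - F₀ q)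
    (hG : UnifZero T fun q => G q - G₀ q) (hF₀ : UnifBdd T F₀) (hG₀ : UnifBdd T G₀) :
    UnifZero T fun q => F q * G q - F₀ q * G₀ q := by
  refine (((hF.mul_bdd hG.bdd).add (hF.mul_bdd hG₀)).add (hF₀.mul_zero hG)).congr ?_
  filter_upwards with ε t _
  ring

variable (S : Setting M T X X₀)
include S

lemma Setting.unifBdd_slow₀ {g : ℝ × ℝ × ℝ × ℝ → ℝ} (hg : Continuous g) :
    UnifBdd T (fun q => g (slow₀ M X₀ q.2)) :=
  unifBdd_of_continuousOn (g := fun t => g (slow₀ M X₀ t))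
    (hg.comp_continuousOn S.continuousOn_slow₀)

lemma Setting.continuousOn_comp_slow₀ {g : ℝ × ℝ × ℝ × ℝ → ℝ} (hg : Continuous g) :
    ContinuousOn (fun t => g (slow₀ M X₀ t)) (Icc 0 T) :=
  hg.comp_continuousOn S.continuousOn_slow₀

/-- Expansion of the force term. -/
lemma Setting.unifZero_force : UnifZero T fun q =>
    -(((M.energy - (X q.1).p q.2 ^ 2 / 2) * M.logD ((X q.1).y q.2)
          - (M.energy - X₀.p q.2 ^ 2 / 2) * M.logD (X₀.y q.2)) / q.1 ^ 2)
      + M.θStar * M.freq (X₀.y q.2) * M.logDD (X₀.y q.2) * resY X X₀ q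
      - X₀.p q.2 * M.logD (X₀.y q.2) * resP X X₀ q := by
  have hM := S.reg
  have h1 := (S.unifBdd_slow (g := fun z => -(M.energy - z.2.2.2 ^ 2 / 2))
    (by fun_prop)).mul_zero (unifZero_linear_remainder hM.hasDerivAt_logD hM.continuous_logDD
      S.continuousOn_y S.unifBdd_resY)
  have h2 := ((S.unifZero_slow (g := fun z => (M.energy - z.2.2.2 ^ 2 / 2))
    (by fun_prop)).mul_bdd (S.unifBdd_slow₀ (g := fun z => M.logDD z.1) (by fun_prop))).mul_bdd
      S.unifBdd_resY
  have h3 := ((S.unifZero_slow (g := fun z => z.2.2.2 / 2)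
    (by fun_prop)).mul_bdd (S.unifBdd_slow₀ (g := fun z => M.logD z.1) (by fun_prop))).mul_bdd
      S.unifBdd_resP
  refine ((h1.sub h2).add h3).congr ?_
  filter_upwards with ε t ht
  -- The leading-order energy identifies `E - p₀²/2` with `θ_* ω(y₀)`.
  have e := S.lead.energy_eq hM ht
  simp only [slow, slow₀, resY, resP]
  linear_combination (-M.logDD (X₀.y t) * (((X ε).y t - X₀.y t) / ε ^ 2)) * e

/-- The differences to `ȳ₂`, `p̄₂` solve a linear system with zero initial values. Its forcing
consists of uniformly small terms and of slow functions times `cos(2φ_ε/ε)` or `cos(4φ_ε/ε)`. -/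
theorem Setting.unifZero_corrY_corrP (hB : IsSecondOrder M T X₀ B) :
    UnifZero T (fun q => corrY M q.1 (X q.1) X₀ q.2 - B.y q.2) ∧
    UnifZero T (fun q => corrP M q.1 (X q.1) X₀ q.2 - B.p q.2) := by
  have hM := S.reg
  obtain ⟨⟨i1, i2, i3, i4⟩, hd⟩ := S.isSecondOrder_iff.1 hB
  have hsin : UnifBdd T fun q => Real.sin (ph X q) := unifBdd_sin
  have hcos : UnifBdd T fun q => Real.cos (ph X q) := unifBdd_cos
  -- Coefficients after `θ̄₂` is eliminated from the equation for `p̄₂` by the second-order energy: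
  -- the `(log ω)'²` part of the coefficient of `ȳ₂` cancels, and a term in `p̄₂` appears.
  set a : ℝ → ℝ := fun t => -(M.θStar * M.freq (X₀.y t) * M.logDD (X₀.y t)) with ha
  set b : ℝ → ℝ := fun t => X₀.p t * M.logD (X₀.y t) with hb
  have hac : ContinuousOn a (Icc 0 T) := S.continuousOn_comp_slow₀
    (g := fun z => -(M.θStar * M.freq z.1 * M.logDD z.1)) (by fun_prop)
  have hbc : ContinuousOn b (Icc 0 T) := S.continuousOn_comp_slow₀
    (g := fun z => z.2.1 * M.logD z.1) (by fun_prop)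
  have hf₁ := (S.unifZero_slow (g := fun z => -(z.2.2.1 * M.ampl z.1 * M.logD z.1 * z.2.1))
    (by fun_prop)).weakZero.add (S.weakZero_slow_mul_cos one_pos
      (g := fun z => -(z.2.2.1 * M.amplD z.1 * (z.2.1 + z.2.2.2))) (by fun_prop))
  -- `hB₁` and `hB₂` account for the cosine terms by which residuals and corrected residuals differ.
  have hB₁ : WeakZero T fun q => a q.2 * -((X q.1).θ q.2 * M.ampl ((X q.1).y q.2)) *
      Real.cos (1 * ph X q) := by
    refine S.weakZero_mul_cos_ph one_pos
      (G₀ := fun t => a t * -(M.θStar * M.ampl (X₀.y t)))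
      (hac.mul (S.continuousOn_comp_slow₀ (g := fun z => -(z.2.2.1 * M.ampl z.1))
        (by fun_prop))) ?_
    refine ((unifBdd_of_continuousOn hac).mul_zero
      (S.unifZero_slow (g := fun z => -(z.2.2.1 * M.ampl z.1)) (by fun_prop))).congr ?_
    filter_upwards with ε t _
    simp only [slow, slow₀]; ring
  have hB₂ : WeakZero T fun q => b q.2 *
      -((X q.1).θ q.2 * (X q.1).p q.2 * M.amplD ((X q.1).y q.2)) * Real.cos (1 * ph X q) := by
    refine S.weakZero_mul_cos_ph one_pos
      (G₀ := fun t => b t * -(M.θStar * X₀.p t * M.amplD (X₀.y t)))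
      (hbc.mul (S.continuousOn_comp_slow₀ (g := fun z => -(z.2.2.1 * z.2.2.2 * M.amplD z.1))
        (by fun_prop))) ?_
    refine ((unifBdd_of_continuousOn hbc).mul_zero
      (S.unifZero_slow (g := fun z => -(z.2.2.1 * z.2.2.2 * M.amplD z.1)) (by fun_prop))).congr ?_
    filter_upwards with ε t _
    simp only [slow, slow₀]; ring
  -- `sin²` is split as `1/2 - cos(2·)/2`: the mean enters the averaged equation, the rest is weakly
  -- zero.
  have hC := (S.unifZero_slow (g := fun z => z.2.2.1 ^ 2 * (M.logD z.1 ^ 3 / 8 -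
      M.logD z.1 * M.logDD z.1 / 4) / 2) (by fun_prop)).weakZero.add
    (S.weakZero_slow_mul_cos two_pos (g := fun z => -(z.2.2.1 ^ 2 * (M.logD z.1 ^ 3 / 8 -
      M.logD z.1 * M.logDD z.1 / 4) / 2)) (by fun_prop))
  have hD := (S.unifZero_slow (g := fun z => -(z.2.2.1 * z.2.2.2 * M.amplD z.1 * M.logD z.1
    * z.2.1)) (by fun_prop)).weakZero
  have hE := S.weakZero_slow_mul_cos one_pos (g := fun z =>
    z.2.2.1 * (-(z.2.2.1 * M.freq z.1 * M.logD z.1)) * M.amplD z.1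
      + z.2.2.1 * z.2.2.2 * deriv M.amplD z.1 * z.2.1) (by fun_prop)
  have hF := (unifZero_fst.mul_bdd (((S.unifBdd_slow (g := fun z => -(z.2.2.1 * (1 / 2 * z.2.2.1 *
        M.logDD z.1 * z.2.1) * M.amplD z.1)) (by fun_prop)).mul hsin).mul hcos)).weakZero
  have hf₂ := (((((S.unifZero_force.weakZero.add hB₁).add hB₂).add hC).add hD).add hE).add hF
  refine unifZero_of_weakZero_forcing S.T_pos.le (continuousOn_const (c := 1)) hac hbc ?_ ?_ hf₁ hf₂
  · filter_upwards [S.corr_init] with ε h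
    exact ⟨by simp only [h.1, i3, sub_self], by simp only [h.2.1, i4, sub_self]⟩
  · filter_upwards [S.sol, self_mem_nhdsWithin] with ε hX hε t ht
    have hε : 0 < ε := hε
    refine ⟨((hasDerivWithinAt_corrY hM hε hX S.lead ht).fun_sub (hd t ht).2.2.1).congr_deriv ?_,
      ((hasDerivWithinAt_corrP hM hε hX S.lead ht).fun_sub (hd t ht).2.2.2).congr_deriv ?_⟩
    · simp only [slow, slow₀, ph, one_mul]; ring
    · have hI := S.energy_second_order hB ht
      have hn : 4 * M.freq (X₀.y t) * M.ampl (X₀.y t) = M.logD (X₀.y t) := by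
        rw [Model.ampl]
        have := hM.ne (X₀.y t)
        field_simp
      have hm : M.logD (X₀.y t) ^ 2 - M.logDD (X₀.y t) = 4 * M.freq (X₀.y t) * M.amplD (X₀.y t) := by
        rw [Model.amplD]
        have := hM.ne (X₀.y t)
        field_simp
      have hc2 : Real.sin (2 * ε⁻¹ * (X ε).φ t) ^ 2 =
          1 / 2 - Real.cos (2 * (2 * ε⁻¹ * (X ε).φ t)) / 2 := by
        rw [Real.cos_two_mul, Real.sin_sq]; ring
      simp only [slow, slow₀, ph, ha, hb, resY, resP, corrY, corrP, one_mul] at hI ⊢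
      rw [hc2]
      linear_combination M.logD (X₀.y t) * hI
        + (M.θStar * X₀.p t ^ 2 * M.ampl (X₀.y t)) * hm
        + (M.θStar * X₀.p t ^ 2 * (M.logD (X₀.y t) * M.ampl (X₀.y t) + M.amplD (X₀.y t))) * hn

theorem Setting.unifZero_corrΦ (hB : IsSecondOrder M T X₀ B) :
    UnifZero T (fun q => corrΦ M q.1 (X q.1) X₀ q.2 - B.φ q.2) := by
  have hM := S.reg
  obtain ⟨⟨i1, i2, i3, i4⟩, hd⟩ := S.isSecondOrder_iff.1 hB
  set a : ℝ → ℝ := fun t => M.freq (X₀.y t) * M.logD (X₀.y t) with ha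
  have hac : ContinuousOn a (Icc 0 T) := S.continuousOn_comp_slow₀
    (g := fun z => M.freq z.1 * M.logD z.1) (by fun_prop)
  have hA := (unifZero_linear_remainder hM.hasDerivAt_freq
    (hM.continuous_freq.mul hM.continuous_logD) S.continuousOn_y S.unifBdd_resY).weakZero
  have hA' := ((unifBdd_of_continuousOn hac).mul_zero (S.unifZero_corrY_corrP hB).1).weakZero
  have hB₁ : WeakZero T fun q => a q.2 * -((X q.1).θ q.2 * M.ampl ((X q.1).y q.2)) *
      Real.cos (1 * ph X q) := by
    refine S.weakZero_mul_cos_ph one_pos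
      (G₀ := fun t => a t * -(M.θStar * M.ampl (X₀.y t)))
      (hac.mul (S.continuousOn_comp_slow₀ (g := fun z => -(z.2.2.1 * M.ampl z.1))
        (by fun_prop))) ?_
    refine ((unifBdd_of_continuousOn hac).mul_zero
      (S.unifZero_slow (g := fun z => -(z.2.2.1 * M.ampl z.1)) (by fun_prop))).congr ?_
    filter_upwards with ε t _
    simp only [slow, slow₀]; ring
  have hC := S.weakZero_slow_mul_cos one_pos (g := fun z =>
    -(z.2.2.1 * M.freq z.1 * M.logD z.1) * M.ampl z.1 - z.2.1 ^ 2 * M.amplD z.1) (by fun_prop)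
  -- Means of the `cos²` and `sin²` terms; the double-frequency parts are in `hE`.
  have hD := (S.unifZero_slow (g := fun z => (z.2.2.1 * M.freq z.1 * M.logD z.1 * M.ampl z.1
    - z.2.1 ^ 2 * M.ampl z.1 * M.logD z.1) / 2) (by fun_prop)).weakZero
  have hE := S.weakZero_slow_mul_cos two_pos (g := fun z =>
    (z.2.2.1 * M.freq z.1 * M.logD z.1 * M.ampl z.1
    + z.2.1 ^ 2 * M.ampl z.1 * M.logD z.1) / 2) (by fun_prop)
  refine (unifZero_of_weakZero_forcing (e₂ := fun _ => 0) (f₂ := fun _ => 0) (d := fun _ => 0)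
    (a := fun _ => 0) (b := fun _ => 0) S.T_pos.le continuousOn_const continuousOn_const
    continuousOn_const ?_ ?_ (((((hA.add hA').add hB₁).add hC).add hD).add hE)
    (UnifZero.weakZero tendsto_const_nhds)).1
  · filter_upwards [S.corr_init] with ε h
    exact ⟨by simp only [h.2.2, i1, sub_self], rfl⟩
  · filter_upwards [S.sol, self_mem_nhdsWithin] with ε hX hε t ht
    have hε : 0 < ε := hε
    refine ⟨((hasDerivWithinAt_corrΦ hM hε hX S.lead ht).fun_sub (hd t ht).1).congr_deriv ?_,
      by simpa using hasDerivWithinAt_const t (Icc 0 T) (0 : ℝ)⟩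
    have hn : 4 * M.freq (X₀.y t) * M.ampl (X₀.y t) = M.logD (X₀.y t) := by
      rw [Model.ampl]
      have := hM.ne (X₀.y t)
      field_simp
    simp only [slow, slow₀, ph, ha, corrY, one_mul]
    rw [Real.cos_two_mul, Real.sin_sq]
    linear_combination (M.θStar * M.logD (X₀.y t) / 8) * hn

lemma Setting.unifZero_cos_ph : UnifZero T (fun q => Real.cos (ph X q) - Real.cos (ph₀ X₀ q)) := by
  simpa only [one_mul] using S.unifZero_cos 1

lemma Setting.unifZero_resY (hB : IsSecondOrder M T X₀ B) :
    UnifZero T fun q => resY X X₀ q -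
      (B.y q.2 - M.θStar * M.ampl (X₀.y q.2) * Real.cos (ph₀ X₀ q)) := by
  have hM := S.reg
  refine ((S.unifZero_corrY_corrP hB).1.sub (unifZero_mul_sub
    (S.unifZero_slow (g := fun z => z.2.2.1 * M.ampl z.1) (by fun_prop)) S.unifZero_cos_ph
    (S.unifBdd_slow₀ (g := fun z => z.2.2.1 * M.ampl z.1) (by fun_prop)) unifBdd_cos)).congr ?_
  filter_upwards with ε t _
  simp only [corrY, resY, slow, slow₀, ph]; ring

lemma Setting.unifZero_resP (hB : IsSecondOrder M T X₀ B) :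
    UnifZero T fun q => resP X X₀ q -
      (B.p q.2 - M.θStar * X₀.p q.2 * M.amplD (X₀.y q.2) * Real.cos (ph₀ X₀ q)) := by
  have hM := S.reg
  refine ((S.unifZero_corrY_corrP hB).2.sub (unifZero_mul_sub
    (S.unifZero_slow (g := fun z => z.2.2.1 * z.2.2.2 * M.amplD z.1) (by fun_prop))
    S.unifZero_cos_ph
    (S.unifBdd_slow₀ (g := fun z => z.2.2.1 * z.2.2.2 * M.amplD z.1) (by fun_prop))
    unifBdd_cos)).congr ?_
  filter_upwards with ε t _
  simp only [corrP, resP, slow, slow₀, ph]; ring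

lemma Setting.unifZero_resΦ (hB : IsSecondOrder M T X₀ B) :
    UnifZero T fun q => resΦ X X₀ q -
      (B.φ q.2 - X₀.p q.2 * M.ampl (X₀.y q.2) * Real.cos (ph₀ X₀ q)) := by
  have hM := S.reg
  refine ((S.unifZero_corrΦ hB).sub (unifZero_mul_sub
    (S.unifZero_slow (g := fun z => z.2.1 * M.ampl z.1) (by fun_prop)) S.unifZero_cos_ph
    (S.unifBdd_slow₀ (g := fun z => z.2.1 * M.ampl z.1) (by fun_prop)) unifBdd_cos)).congr ?_
  filter_upwards with ε t _
  simp only [corrΦ, resΦ, slow, slow₀, ph]; ring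

end convergence

end FastSlow

namespace FastSlow

/-! ### Expansion of `θ` from the energy -/

section theta
variable {M : Model} {T : ℝ} {X : ℝ → Path} {X₀ B : Path} (S : Setting M T X X₀)
include S

lemma Setting.unifZero_sin_ph : UnifZero T (fun q => Real.sin (ph X q) - Real.sin (ph₀ X₀ q)) :=
  squeeze_zero_norm (fun q => by
    simpa only [Function.comp_apply, Real.norm_eq_abs] using Real.abs_sin_sub_sin_le _ _)
    (tendsto_norm_zero.comp S.unifZero_ph)

/-- The phases differ by `2 ε φ₂`, so the Taylor remainder of the sine is at most `(2 ε φ₂)²`, and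
division by `2ε` leaves `2 ε φ₂²`. -/
lemma Setting.unifZero_sin_expansion : UnifZero T fun q =>
    (Real.sin (ph X q) - Real.sin (ph₀ X₀ q)) / (2 * q.1) - resΦ X X₀ q * Real.cos (ph₀ X₀ q) := by
  have h : UnifZero T fun q => q.1 * (2 * (resΦ X X₀ q * resΦ X X₀ q)) :=
    unifZero_fst.mul_bdd ((unifBdd_const 2).mul (S.unifBdd_resΦ.mul S.unifBdd_resΦ))
  refine squeeze_zero_norm' ?_ h
  filter_upwards [eventually_mem_unifFilter T] with q hq
  have hε := hq.1
  have hd : ph X q - ph₀ X₀ q = 2 * q.1 * resΦ X X₀ q := by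
    simp only [ph, ph₀, resΦ]
    field_simp
  have hlin := abs_sub_linear_le Real.hasDerivAt_sin (a := ph₀ X₀ q) (b := ph X q)
    (δ := |ph X q - ph₀ X₀ q|) fun z hz =>
      (Real.abs_cos_sub_cos_le _ _).trans (abs_sub_left_of_mem_uIcc hz)
  rw [← sq, sq_abs, hd] at hlin
  have e : (Real.sin (ph X q) - Real.sin (ph₀ X₀ q)) / (2 * q.1)
      - resΦ X X₀ q * Real.cos (ph₀ X₀ q) = (Real.sin (ph X q) - Real.sin (ph₀ X₀ q)
        - Real.cos (ph₀ X₀ q) * (2 * q.1 * resΦ X X₀ q)) / (2 * q.1) := by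
    field_simp
  rw [e, Real.norm_eq_abs, abs_div, abs_of_pos (show 0 < 2 * q.1 by positivity),
    div_le_iff₀ (by positivity)]
  refine hlin.trans (le_of_eq ?_)
  ring

/-- The scaled increment `(ω(y_ε) - ω(y₀))/ε²`. -/
noncomputable def resFreq (M : Model) (X : ℝ → Path) (X₀ : Path) (q : ℝ × ℝ) : ℝ :=
  (M.freq ((X q.1).y q.2) - M.freq (X₀.y q.2)) / q.1 ^ 2

lemma Setting.unifZero_resFreq_sub : UnifZero T fun q => resFreq M X X₀ q -
    M.freq (X₀.y q.2) * M.logD (X₀.y q.2) * resY X X₀ q :=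
  unifZero_linear_remainder S.reg.hasDerivAt_freq
    (S.reg.continuous_freq.mul S.reg.continuous_logD) S.continuousOn_y S.unifBdd_resY

lemma Setting.unifBdd_resFreq : UnifBdd T (resFreq M X X₀) := by
  have hM := S.reg
  refine (S.unifZero_resFreq_sub.bdd.add ((S.unifBdd_slow₀
    (g := fun z => M.freq z.1 * M.logD z.1) (by fun_prop)).mul S.unifBdd_resY)).congr ?_
  filter_upwards with ε t _
  simp only [slow₀]; ring

lemma Setting.unifBdd_logD_increment : UnifBdd T fun q =>
    (M.logD ((X q.1).y q.2) - M.logD (X₀.y q.2)) / q.1 ^ 2 := by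
  have hM := S.reg
  refine ((unifZero_linear_remainder hM.hasDerivAt_logD hM.continuous_logDD
      S.continuousOn_y S.unifBdd_resY).bdd.add ((S.unifBdd_slow₀
    (g := fun z => M.logDD z.1) (by fun_prop)).mul S.unifBdd_resY)).congr ?_
  filter_upwards with ε t _
  simp only [slow₀, resY]; ring

omit S in
lemma Model.IsRegular.continuous_inv_freq (hM : M.IsRegular) :
    Continuous fun z : ℝ × ℝ × ℝ × ℝ => (M.freq z.1)⁻¹ :=
  Continuous.inv₀ (by fun_prop) fun z => hM.ne z.1

/-- An exact identity: the two conserved energies are subtracted and divided by `ε`. Only the cross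
term of `vel²` is of order one. -/
lemma Setting.freq_mul_θ₁ : ∀ᶠ ε in 𝓝[>] (0 : ℝ), ∀ t ∈ Icc 0 T,
    M.freq ((X ε).y t) * θ₁ M X ε t = ε * (-(M.θStar * resFreq M X X₀ (ε, t))
      - resP X X₀ (ε, t) * ((X ε).p t + X₀.p t) / 2
      - (X ε).θ t ^ 2 * M.logD ((X ε).y t) ^ 2 / 8 *
        (Real.sin (ph X (ε, t)) * Real.sin (ph X (ε, t))))
      - (X ε).θ t * (X ε).p t * M.logD ((X ε).y t) / 2 * Real.sin (ph X (ε, t)) := by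
  filter_upwards [S.sol, self_mem_nhdsWithin] with ε hX hε t ht
  have hε : 0 < ε := hε
  have e1 := hX.energy_eq S.reg hε ht
  have e2 := S.lead.energy_eq S.reg ht
  have e3 : M.freq ((X ε).y t) * ((X ε).θ t - M.θStar) =
      -(M.θStar * (M.freq ((X ε).y t) - M.freq (X₀.y t)))
      - (vel M ε (X ε) t ^ 2 - X₀.p t ^ 2) / 2 := by linarith
  rw [θ₁, mul_div_assoc', e3]
  simp only [vel, resFreq, resP, ph]
  field_simp
  ring

lemma Setting.unifZero_θ₁ : UnifZero T fun q => θ₁ M X q.1 q.2 -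
    -(2 * M.θStar * X₀.p q.2 * M.ampl (X₀.y q.2) * Real.sin (ph₀ X₀ q)) := by
  have hM := S.reg
  have hsin : UnifBdd T fun q => Real.sin (ph X q) := unifBdd_sin
  have h1 := unifZero_fst.mul_bdd ((S.unifBdd_slow hM.continuous_inv_freq).mul
    ((((unifBdd_const (-M.θStar)).mul S.unifBdd_resFreq).sub (S.unifBdd_resP.mul
      ((S.unifBdd_slow (g := fun z => z.2.2.2 / 2) (by fun_prop)).add
        (S.unifBdd_slow₀ (g := fun z => z.2.2.2 / 2) (by fun_prop))))).sub
      ((S.unifBdd_slow (g := fun z => z.2.2.1 ^ 2 * M.logD z.1 ^ 2 / 8) (by fun_prop)).mul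
        (hsin.mul hsin))))
  have h2 := unifZero_mul_sub
    (S.unifZero_slow (g := fun z => -(2 * z.2.2.1 * z.2.2.2 * M.ampl z.1)) (by fun_prop))
    S.unifZero_sin_ph
    (S.unifBdd_slow₀ (g := fun z => -(2 * z.2.2.1 * z.2.2.2 * M.ampl z.1)) (by fun_prop))
    unifBdd_sin
  refine (h1.add h2).congr ?_
  filter_upwards [S.freq_mul_θ₁] with ε h t ht
  have e := h t ht
  have hn := hM.ne ((X ε).y t)
  have e' : θ₁ M X ε t = (M.freq ((X ε).y t))⁻¹ * (M.freq ((X ε).y t) * θ₁ M X ε t) := by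
    rw [inv_mul_cancel_left₀ hn]
  have ha : M.ampl ((X ε).y t) = (M.freq ((X ε).y t))⁻¹ * M.logD ((X ε).y t) / 4 := by
    rw [Model.ampl]; field_simp
  rw [e', e]
  simp only [slow, slow₀, ha]
  ring

/-- The `O(ε)` terms of `freq_mul_θ₁` are collected. Replacing `sin(2φ_ε/ε)` by `sin(2φ₀/ε)` in the
leading term contributes `φ₂ cos` at this order, the source of `φ̄₂` in `[θ₂]`. -/
theorem Setting.unifZero_θ₂ (hB : IsSecondOrder M T X₀ B) : UnifZero T fun q =>
    θ₂ M T X₀ X q.1 q.2 - (oscθ₂ M T X₀ B.φ q.1 q.2 + B.θ q.2) := by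
  have hM := S.reg
  obtain ⟨cφ, cθ, cy, cp⟩ := hB.continuousOn
  have hsin : UnifBdd T fun q => Real.sin (ph X q) := unifBdd_sin
  have hsin₀ : UnifBdd T fun q => Real.sin (ph₀ X₀ q) := unifBdd_sin
  have hcos₀ : UnifBdd T fun q => Real.cos (ph₀ X₀ q) := unifBdd_cos
  have bP := (unifBdd_of_continuousOn cp).sub
    ((S.unifBdd_slow₀ (g := fun z => M.θStar * z.2.1 * M.amplD z.1) (by fun_prop)).mul hcos₀)
  have bFl := S.unifBdd_slow₀ (g := fun z => M.θStar * (M.freq z.1 * M.logD z.1)) (by fun_prop)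
  have bpl := S.unifBdd_slow₀ (g := fun z => M.θStar * (z.2.2.2 * M.logD z.1)) (by fun_prop)
  have z₁ := (S.unifZero_resFreq_sub).mul_bdd (unifBdd_const (-M.θStar))
  have z₂ := bFl.mul_zero (S.unifZero_resY hB)
  have z₃ := unifZero_mul_sub (S.unifZero_resP hB)
    (S.unifZero_slow (g := fun z => z.2.2.2) (by fun_prop)) bP
    (S.unifBdd_slow₀ (g := fun z => z.2.2.2) (by fun_prop))
  have z₃' := (S.unifZero_resP hB).mul_bdd (S.unifBdd_slow₀ (g := fun z => z.2.2.2) (by fun_prop))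
  have z₄ := unifZero_mul_sub
    (S.unifZero_slow (g := fun z => z.2.2.1 ^ 2 * M.logD z.1 ^ 2 / 8) (by fun_prop))
    (unifZero_mul_sub S.unifZero_sin_ph S.unifZero_sin_ph hsin₀ hsin₀)
    (S.unifBdd_slow₀ (g := fun z => z.2.2.1 ^ 2 * M.logD z.1 ^ 2 / 8) (by fun_prop))
    (hsin₀.mul hsin₀)
  have bθ₁ : UnifBdd T fun q =>
      -(2 * M.θStar * X₀.p q.2 * M.ampl (X₀.y q.2) * Real.sin (ph₀ X₀ q)) := by
    refine ((S.unifBdd_slow₀ (g := fun z => -(2 * M.θStar * z.2.2.2 * M.ampl z.1))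
      (by fun_prop)).mul hsin₀).congr ?_
    filter_upwards with ε t _
    simp only [slow₀]; ring
  have bpl' := S.unifBdd_slow₀ (g := fun z => z.2.2.2 * M.logD z.1 / 2) (by fun_prop)
  have z₅ := unifZero_mul_sub S.unifZero_θ₁ (unifZero_mul_sub
    (S.unifZero_slow (g := fun z => z.2.2.2 * M.logD z.1 / 2) (by fun_prop))
    S.unifZero_sin_ph bpl' hsin₀) bθ₁ (bpl'.mul hsin₀)
  have z₆ := unifZero_fst.mul_bdd ((((S.unifBdd_resP.mul
    (S.unifBdd_slow (g := fun z => M.θStar / 2 * M.logD z.1) (by fun_prop))).add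
    ((S.unifBdd_slow₀ (g := fun z => M.θStar / 2 * z.2.2.2) (by fun_prop)).mul
      S.unifBdd_logD_increment)).mul hsin))
  have z₇ := bpl.mul_zero S.unifZero_sin_expansion
  have z₇' := (bpl.mul hcos₀).mul_zero (S.unifZero_resΦ hB)
  have z₈ := unifZero_fst.mul_bdd ((S.unifBdd_resFreq.mul (S.unifBdd_slow₀
    (g := fun z => 2 * M.θStar * z.2.2.2 * M.ampl z.1) (by fun_prop))).mul hsin₀)
  have bN : UnifBdd T fun q => M.freq (X₀.y q.2) * (oscθ₂ M T X₀ B.φ q.1 q.2 + B.θ q.2) := by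
    have b₁ := S.unifBdd_slow₀ (g := fun z => M.θStar * M.freq z.1 * M.logD z.1 *
        (M.θStar * M.ampl z.1) + z.2.1 * (M.θStar * z.2.1 * M.amplD z.1)) (by fun_prop)
    have b₂ := S.unifBdd_slow₀ (g := fun z => M.θStar ^ 2 * M.logD z.1 ^ 2 / 16) (by fun_prop)
    have b₃ := S.unifBdd_slow₀ (g := fun z => M.θStar * z.2.1 * M.logD z.1) (by fun_prop)
    have b₄ := S.unifBdd_slow₀ (g := fun z => M.freq z.1) (by fun_prop)
    refine ((((b₁.mul hcos₀).add (b₂.mul ((unifBdd_const 1).sub ((unifBdd_const 2).mul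
      (hsin₀.mul hsin₀))))).sub ((b₃.mul (unifBdd_of_continuousOn cφ)).mul hcos₀)).add
      (b₄.mul (unifBdd_of_continuousOn cθ))).congr ?_
    filter_upwards with ε t ht
    rw [mul_add, S.freq_mul_oscθ₂ B.φ (ε, t) ht]
    simp only [slow₀]
    ring
  have key : UnifZero T fun q => M.freq ((X q.1).y q.2) * θ₂ M T X₀ X q.1 q.2 -
      M.freq (X₀.y q.2) * (oscθ₂ M T X₀ B.φ q.1 q.2 + B.θ q.2) := by
    have hhalf : UnifBdd T fun _ => (-(1 / 2) : ℝ) := unifBdd_const _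
    refine (((((((z₁.sub z₂).add ((z₃.add z₃').mul_bdd hhalf)).sub z₄).sub z₅).sub z₆).sub
      (z₇.add z₇')).add z₈).congr ?_
    filter_upwards [S.freq_mul_θ₁, self_mem_nhdsWithin] with ε h hε t ht
    have hε : 0 < ε := hε
    have e := h t ht
    have hI := S.energy_second_order hB ht
    have hl : M.logD (X₀.y t) = 4 * M.freq (X₀.y t) * M.ampl (X₀.y t) := by
      rw [Model.ampl]
      have := hM.ne (X₀.y t)
      field_simp
    have hsc := Real.sin_sq_add_cos_sq (ph₀ X₀ (ε, t))
    have hN := S.freq_mul_oscθ₂ B.φ (ε, t) ht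
    have hO := S.oscθ₁_eq (ε, t) ht
    simp only at hN hO
    have hθ : (X ε).θ t = M.θStar + ε * θ₁ M X ε t := by
      rw [θ₁]; field_simp; ring
    have hp : (X ε).p t = X₀.p t + ε ^ 2 * resP X X₀ (ε, t) := by
      simp only [resP]; field_simp; ring
    have hlD : M.logD ((X ε).y t) = M.logD (X₀.y t) + ε ^ 2 *
        ((M.logD ((X ε).y t) - M.logD (X₀.y t)) / ε ^ 2) := by
      field_simp; ring
    have hF : M.freq ((X ε).y t) = M.freq (X₀.y t) + ε ^ 2 * resFreq M X X₀ (ε, t) := by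
      simp only [resFreq]; field_simp; ring
    -- Exact expansion: the `1/ε` terms combine into the scaled difference of sines, and every other
    -- factor is bounded or carries `ε`.
    have e2 : M.freq ((X ε).y t) * θ₂ M T X₀ X ε t =
        -(M.θStar * resFreq M X X₀ (ε, t))
        - resP X X₀ (ε, t) * ((X ε).p t + X₀.p t) / 2
        - (X ε).θ t ^ 2 * M.logD ((X ε).y t) ^ 2 / 8 *
          (Real.sin (ph X (ε, t)) * Real.sin (ph X (ε, t)))
        - θ₁ M X ε t * ((X ε).p t * M.logD ((X ε).y t) / 2 * Real.sin (ph X (ε, t)))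
        - ε * ((resP X X₀ (ε, t) * (M.θStar / 2 * M.logD ((X ε).y t))
          + M.θStar / 2 * X₀.p t * ((M.logD ((X ε).y t) - M.logD (X₀.y t)) / ε ^ 2))
            * Real.sin (ph X (ε, t)))
        - M.θStar * (X₀.p t * M.logD (X₀.y t)) *
          ((Real.sin (ph X (ε, t)) - Real.sin (ph₀ X₀ (ε, t))) / (2 * ε))
        + ε * (resFreq M X X₀ (ε, t) * (2 * M.θStar * X₀.p t * M.ampl (X₀.y t))
          * Real.sin (ph₀ X₀ (ε, t))) := by
      have e3 : (X ε).θ t * (X ε).p t * M.logD ((X ε).y t) =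
          ε * θ₁ M X ε t * ((X ε).p t * M.logD ((X ε).y t))
          + M.θStar * (ε ^ 2 * resP X X₀ (ε, t) * M.logD ((X ε).y t) + X₀.p t *
            (M.logD (X₀.y t) + ε ^ 2 *
              ((M.logD ((X ε).y t) - M.logD (X₀.y t)) / ε ^ 2))) := by
        rw [← hlD]
        linear_combination (X ε).p t * M.logD ((X ε).y t) * hθ
          + M.θStar * M.logD ((X ε).y t) * hp
      have e4 : M.freq ((X ε).y t) * θ₂ M T X₀ X ε t = (M.freq ((X ε).y t) * θ₁ M X ε t
          + (M.freq (X₀.y t) + ε ^ 2 * resFreq M X X₀ (ε, t)) *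
            (2 * M.θStar * X₀.p t * M.ampl (X₀.y t) * Real.sin (ph₀ X₀ (ε, t)))) / ε := by
        rw [← hF, θ₂, hO]; ring
      rw [e4, e, e3]
      set D := (M.logD ((X ε).y t) - M.logD (X₀.y t)) / ε ^ 2
      set s₀ := Real.sin (ph₀ X₀ (ε, t))
      have h4 : M.freq (X₀.y t) * (2 * M.θStar * X₀.p t * M.ampl (X₀.y t) * s₀) =
          M.θStar * (X₀.p t * M.logD (X₀.y t)) * s₀ / 2 := by rw [hl]; ring
      rw [add_mul, h4]
      field_simp
      ring
    rw [e2, mul_add (M.freq (X₀.y t)), hN]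
    simp only [slow, slow₀]
    rw [hl] at hI ⊢
    -- One square term comes from `θ₁` times the sine, one from the oscillating part of `φ₂` times
    -- the cosine. They add up to the last term of the second-order energy.
    linear_combination hI - (4 * M.θStar * M.freq (X₀.y t) *
      (X₀.p t * M.ampl (X₀.y t)) ^ 2) * hsc
  -- Removes the factors `ω(y_ε)` and `ω(y₀)`, which differ and must be inverted separately.
  have hinv := unifZero_mul_sub (S.unifZero_slow hM.continuous_inv_freq) key
    (S.unifBdd_slow₀ hM.continuous_inv_freq) bN
  refine hinv.congr ?_
  filter_upwards with ε t _
  simp only [slow, slow₀]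
  rw [inv_mul_cancel_left₀ (hM.ne _), inv_mul_cancel_left₀ (hM.ne _)]

end theta

end FastSlow

namespace FastSlow

/-! ### Profiles and oscillating functions -/

lemma IsContTorus.add {T : ℝ} {U V : ℝ → ℝ → ℝ} (hU : IsContTorus T U) (hV : IsContTorus T V) :
    IsContTorus T fun t s => U t s + V t s :=
  ⟨hU.1.add hV.1, fun t ht => (hU.2 t ht).add (hV.2 t ht)⟩

lemma IsContTorus.mul {T : ℝ} {c : ℝ → ℝ} {U : ℝ → ℝ → ℝ} (hc : ContinuousOn c (Icc 0 T))
    (hU : IsContTorus T U) : IsContTorus T fun t s => c t * U t s :=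
  ⟨(hc.comp continuousOn_fst fun _ hx => hx.1).mul hU.1,
    fun t ht s => by simp only [hU.2 t ht s]⟩

lemma IsContTorus.congr {T : ℝ} {U V : ℝ → ℝ → ℝ} (hU : IsContTorus T U)
    (h : ∀ t ∈ Icc 0 T, ∀ s, V t s = U t s) : IsContTorus T V :=
  ⟨hU.1.congr fun x hx => h x.1 hx.1 x.2,
    fun t ht s => by rw [h t ht, h t ht, hU.2 t ht]⟩

lemma isContTorus_cos {T : ℝ} : IsContTorus T fun _ s => Real.cos (2 * Real.pi * s) :=
  ⟨by fun_prop, fun _ _ s => by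
    simp only
    rw [show 2 * Real.pi * (s + 1) = 2 * Real.pi * s + 2 * Real.pi by ring, Real.cos_add_two_pi]⟩

lemma isContTorus_sin {T : ℝ} : IsContTorus T fun _ s => Real.sin (2 * Real.pi * s) :=
  ⟨by fun_prop, fun _ _ s => by
    simp only
    rw [show 2 * Real.pi * (s + 1) = 2 * Real.pi * s + 2 * Real.pi by ring, Real.sin_add_two_pi]⟩

lemma isContTorus_cos_four {T : ℝ} : IsContTorus T fun _ s => Real.cos (4 * Real.pi * s) :=
  ⟨by fun_prop, fun _ _ s => by
    simp only
    rw [show 4 * Real.pi * (s + 1) = 4 * Real.pi * s + 2 * Real.pi + 2 * Real.pi by ring,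
      Real.cos_add_two_pi, Real.cos_add_two_pi]⟩

/-- Identifies the fast variable `s = φ₀/(πε)`; at `ε = 0` both sides vanish by the convention for
division. -/
lemma two_pi_mul_phase (ε x : ℝ) : 2 * Real.pi * (x / (Real.pi * ε)) = 2 * ε⁻¹ * x := by
  have := Real.pi_ne_zero
  rw [div_mul_eq_div_div]
  field_simp

lemma four_pi_mul_phase (ε x : ℝ) : 4 * Real.pi * (x / (Real.pi * ε)) = 4 * ε⁻¹ * x := by
  have := two_pi_mul_phase ε x
  linear_combination 2 * this

lemma UnifConv.eqOn {T : ℝ} {u : ℝ → ℝ → ℝ} {a b : ℝ → ℝ} (ha : UnifConv T u a)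
    (hb : UnifConv T u b) : EqOn a b (Icc 0 T) := fun _ ht =>
  tendsto_nhds_unique (ha.tendsto_at ht) (hb.tendsto_at ht)

section profiles
variable {M : Model} {T : ℝ} {X : ℝ → Path} {X₀ B : Path} (S : Setting M T X X₀)
include S

lemma Setting.isContTorus_profθ₁ : IsContTorus T (profθ₁ M T X₀) := by
  have hM := S.reg
  refine ((isContTorus_sin).mul (S.continuousOn_comp_slow₀
    (g := fun z => -(2 * M.θStar * z.2.1 * M.ampl z.1)) (by fun_prop))).congr fun t ht s => ?_
  rw [profθ₁, S.DL_one_zero ht]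
  simp only [slow₀, Model.ampl]
  have := hM.ne (X₀.y t)
  field_simp
  ring

lemma Setting.isContTorus_profφ₂ : IsContTorus T (profφ₂ M T X₀) := by
  have hM := S.reg
  refine ((isContTorus_cos).mul (S.continuousOn_comp_slow₀
    (g := fun z => -(z.2.1 * M.ampl z.1)) (by fun_prop))).congr fun t ht s => ?_
  rw [profφ₂, S.DL_one_zero ht]
  simp only [slow₀, Model.ampl]
  ring

lemma Setting.isContTorus_profy₂ : IsContTorus T (profy₂ M T X₀) := by
  have hM := S.reg
  refine ((isContTorus_cos).mul (S.continuousOn_comp_slow₀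
    (g := fun z => -(M.θStar * M.ampl z.1)) (by fun_prop))).congr fun t ht s => ?_
  rw [profy₂, S.DL_zero_one]
  simp only [slow₀, Model.ampl]
  ring

lemma Setting.isContTorus_profp₂ : IsContTorus T (profp₂ M T X₀) := by
  have hM := S.reg
  refine ((isContTorus_cos).mul (S.continuousOn_comp_slow₀
    (g := fun z => -(M.θStar * z.2.1 * M.amplD z.1)) (by fun_prop))).congr fun t ht s => ?_
  rw [profp₂, S.derivWithin_ampl ht]
  simp only [slow₀]

lemma Setting.isContTorus_profθ₂ {b : ℝ → ℝ} (hb : ContinuousOn b (Icc 0 T)) :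
    IsContTorus T (profθ₂ M T X₀ b) := by
  have hM := S.reg
  have h1 := S.isContTorus_profy₂.mul (S.continuousOn_comp_slow₀
    (g := fun z => -(M.θStar * M.logD z.1)) (by fun_prop))
  have h2 := S.isContTorus_profp₂.mul (S.continuousOn_comp_slow₀
    (g := fun z => -(z.2.1 * (M.freq z.1)⁻¹)) ((Continuous.mul (by fun_prop)
      hM.continuous_inv_freq).neg))
  have h3 := (isContTorus_cos_four).mul (S.continuousOn_comp_slow₀
    (g := fun z => M.θStar ^ 2 * M.logD z.1 * M.ampl z.1 / 4) (by fun_prop))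
  have h4 := (isContTorus_cos).mul ((S.continuousOn_comp_slow₀
    (g := fun z => -(4 * M.θStar * z.2.1 * M.ampl z.1)) (by fun_prop)).mul hb)
  refine (((h1.add h2).add h3).add h4).congr fun t ht s => ?_
  rw [profθ₂, S.DL_zero_one, S.DL_one_zero ht]
  simp only [slow₀, Model.ampl, Pi.mul_apply]
  have := hM.ne (X₀.y t)
  field_simp
  ring

lemma Setting.continuousOn_oscθ₁ (ε : ℝ) : ContinuousOn (oscθ₁ M T X₀ ε) (Icc 0 T) := by
  have hM := S.reg
  have hφ := S.continuousOn_φ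
  refine ((S.continuousOn_comp_slow₀ (g := fun z => -(2 * M.θStar * z.2.2.2 * M.ampl z.1))
    (by fun_prop)).mul (Real.continuous_sin.comp_continuousOn
      (continuousOn_const (c := 2 * ε⁻¹) |>.mul hφ))).congr fun t ht => S.oscθ₁_eq (ε, t) ht

lemma Setting.strictMonoOn_φ : StrictMonoOn X₀.φ (Icc 0 T) := by
  refine strictMonoOn_of_hasDerivWithinAt_pos (convex_Icc 0 T) S.continuousOn_φ
    (f' := fun t => M.freq (X₀.y t)) (fun t ht => ?_) fun t _ => S.reg.pos _
  exact (S.lead.eq_φ t (interior_subset ht)).mono interior_subset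

/-! ### Equivalences, limits and uniqueness. -/

lemma Setting.unifConv_iff_twoScale {u osc prof : ℝ → ℝ → ℝ} {a : ℝ → ℝ}
    (ha : ContinuousOn a (Icc 0 T))
    (hu : ∀ᶠ ε in 𝓝[>] (0 : ℝ), ContinuousOn (u ε) (Icc 0 T)) (hprof : IsContTorus T prof)
    (hosc : ∀ ε t, osc ε t = prof t (X₀.φ t / (Real.pi * ε))) :
    UnifConv T (fun ε t => u ε t - osc ε t) a ↔
      TwoScaleWrt T X₀.φ u (fun t s => a t + prof t s) :=
  unifConv_iff_twoScaleWrt S.T_pos.le S.continuousOn_φ S.strictMonoOn_φ S.lead.init.1 ha hu hprof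
    fun ε _ t _ => hosc ε t

theorem Setting.equivalences {b : ℝ → ℝ} (hb : ContinuousOn b (Icc 0 T)) {a : ℝ → ℝ}
    (ha : ContinuousOn a (Icc 0 T)) :
    (UnifConv T (fun ε t => θ₁ M X ε t - oscθ₁ M T X₀ ε t) a ↔
      TwoScaleWrt T X₀.φ (θ₁ M X) (fun t s => a t + profθ₁ M T X₀ t s)) ∧
    (UnifConv T (fun ε t => φ₂ X₀ X ε t - oscφ₂ M T X₀ ε t) a ↔
      TwoScaleWrt T X₀.φ (φ₂ X₀ X) (fun t s => a t + profφ₂ M T X₀ t s)) ∧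
    (UnifConv T (fun ε t => y₂ X₀ X ε t - oscy₂ M T X₀ ε t) a ↔
      TwoScaleWrt T X₀.φ (y₂ X₀ X) (fun t s => a t + profy₂ M T X₀ t s)) ∧
    (UnifConv T (fun ε t => p₂ X₀ X ε t - oscp₂ M T X₀ ε t) a ↔
      TwoScaleWrt T X₀.φ (p₂ X₀ X) (fun t s => a t + profp₂ M T X₀ t s)) ∧
    (UnifConv T (fun ε t => θ₂ M T X₀ X ε t - oscθ₂ M T X₀ b ε t) a ↔
      TwoScaleWrt T X₀.φ (θ₂ M T X₀ X) (fun t s => a t + profθ₂ M T X₀ b t s)) := by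
  have hθ₁ : ∀ᶠ ε in 𝓝[>] (0 : ℝ), ContinuousOn (θ₁ M X ε) (Icc 0 T) :=
    S.sol.mono fun ε h => (ContinuousOn.sub (fun t ht => (h.eq_θ t ht).continuousWithinAt)
      continuousOn_const).div_const ε
  refine ⟨S.unifConv_iff_twoScale ha hθ₁ S.isContTorus_profθ₁ fun ε t => ?_,
    S.unifConv_iff_twoScale ha ?_ S.isContTorus_profφ₂ fun ε t => ?_,
    S.unifConv_iff_twoScale ha ?_ S.isContTorus_profy₂ fun ε t => ?_,
    S.unifConv_iff_twoScale ha ?_ S.isContTorus_profp₂ fun ε t => ?_,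
    S.unifConv_iff_twoScale ha ?_ (S.isContTorus_profθ₂ hb) fun ε t => ?_⟩
  · rw [oscθ₁, profθ₁, two_pi_mul_phase]
  · exact S.sol.mono fun ε h => (ContinuousOn.sub (fun t ht => (h.eq_φ t ht).continuousWithinAt)
      S.continuousOn_φ).div_const _
  · rw [oscφ₂, profφ₂, two_pi_mul_phase]
  · exact S.sol.mono fun ε h => (ContinuousOn.sub (fun t ht => (h.eq_y t ht).continuousWithinAt)
      S.continuousOn_y).div_const _
  · rw [oscy₂, profy₂, two_pi_mul_phase]
  · exact S.sol.mono fun ε h => (ContinuousOn.sub (fun t ht => (h.eq_p t ht).continuousWithinAt)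
      S.continuousOn_p).div_const _
  · rw [oscp₂, profp₂, two_pi_mul_phase]
  · exact hθ₁.mono fun ε h => (h.sub (S.continuousOn_oscθ₁ ε)).div_const _
  · rw [oscθ₂, profθ₂, oscy₂, profy₂, oscp₂, profp₂, two_pi_mul_phase, four_pi_mul_phase]

theorem Setting.uniform_convergences (hB : IsSecondOrder M T X₀ B) :
    UnifConv T (fun ε t => θ₁ M X ε t - oscθ₁ M T X₀ ε t) (fun _ => 0) ∧
    UnifConv T (fun ε t => φ₂ X₀ X ε t - oscφ₂ M T X₀ ε t) B.φ ∧
    UnifConv T (fun ε t => y₂ X₀ X ε t - oscy₂ M T X₀ ε t) B.y ∧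
    UnifConv T (fun ε t => p₂ X₀ X ε t - oscp₂ M T X₀ ε t) B.p ∧
    UnifConv T (fun ε t => θ₂ M T X₀ X ε t - oscθ₂ M T X₀ B.φ ε t) B.θ := by
  simp only [unifConv_iff]
  refine ⟨S.unifZero_θ₁.congr ?_, (S.unifZero_resΦ hB).congr ?_, (S.unifZero_resY hB).congr ?_,
    (S.unifZero_resP hB).congr ?_, (S.unifZero_θ₂ hB).congr ?_⟩ <;>
    refine Eventually.of_forall fun ε t ht => ?_ <;> dsimp only
  · rw [S.oscθ₁_eq (ε, t) ht]; ring
  · rw [S.oscφ₂_eq (ε, t) ht]; simp only [resΦ, φ₂]; ring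
  · rw [S.oscy₂_eq (ε, t)]; simp only [resY, y₂]; ring
  · rw [S.oscp₂_eq (ε, t) ht]; simp only [resP, p₂]; ring
  · ring

/-- Both solutions are limits of the same residuals, so they agree in `φ`, `y`, `p`. The term
subtracted from `θ₂` depends on `φ̄₂`, so `θ̄₂` is recovered from the second-order energy instead.
-/
theorem Setting.unique_isSecondOrder (hB : IsSecondOrder M T X₀ B) {B' : Path}
    (hB' : IsSecondOrder M T X₀ B') :
    EqOn B'.φ B.φ (Icc 0 T) ∧ EqOn B'.θ B.θ (Icc 0 T) ∧
      EqOn B'.y B.y (Icc 0 T) ∧ EqOn B'.p B.p (Icc 0 T) := by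
  obtain ⟨-, aφ, ay, ap, -⟩ := S.uniform_convergences hB
  obtain ⟨-, bφ, by', bp, -⟩ := S.uniform_convergences hB'
  have ey := by'.eqOn ay
  have ep := bp.eqOn ap
  refine ⟨bφ.eqOn aφ, fun t ht => ?_, ey, ep⟩
  have h1 := S.energy_second_order hB ht
  have h2 := S.energy_second_order hB' ht
  rw [ey ht, ep ht] at h2
  exact mul_left_cancel₀ (S.reg.ne (X₀.y t)) (by linarith)

end profiles

end FastSlow

/-! ### Assembly of the theorem. -/

open FastSlow in
theorem corollary1 (M : Model) (hω : ContDiff ℝ ∞ M.freq)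
    (ωLow : ℝ) (hωLow : 0 < ωLow) (hωge : ∀ η, ωLow ≤ M.freq η)
    (T : ℝ) (hT : 0 < T) (ε₀ : ℝ) (hε₀ : 0 < ε₀)
    (X : ℝ → Path) (hX : ∀ ε ∈ Ioo 0 ε₀, IsSolution M T ε (X ε))
    (X₀ : Path) (hX₀ : IsLeadingOrder M T X₀) :
    ∃ B : Path,
      -- `B = (φ̄₂, θ̄₂, ȳ₂, p̄₂)` is the unique solution of the averaged second-order system
      IsSecondOrder M T X₀ B ∧
      (∀ B' : Path, IsSecondOrder M T X₀ B' →
        EqOn B'.φ B.φ (Icc 0 T) ∧ EqOn B'.θ B.θ (Icc 0 T) ∧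
        EqOn B'.y B.y (Icc 0 T) ∧ EqOn B'.p B.p (Icc 0 T)) ∧
      -- equivalence of uniform and two-scale convergence, for every candidate limit `a`
      (∀ a : ℝ → ℝ, ContinuousOn a (Icc 0 T) →
        (UnifConv T (fun ε t => θ₁ M X ε t - oscθ₁ M T X₀ ε t) a ↔
          TwoScaleWrt T X₀.φ (θ₁ M X) (fun t s => a t + profθ₁ M T X₀ t s)) ∧
        (UnifConv T (fun ε t => φ₂ X₀ X ε t - oscφ₂ M T X₀ ε t) a ↔
          TwoScaleWrt T X₀.φ (φ₂ X₀ X) (fun t s => a t + profφ₂ M T X₀ t s)) ∧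
        (UnifConv T (fun ε t => y₂ X₀ X ε t - oscy₂ M T X₀ ε t) a ↔
          TwoScaleWrt T X₀.φ (y₂ X₀ X) (fun t s => a t + profy₂ M T X₀ t s)) ∧
        (UnifConv T (fun ε t => p₂ X₀ X ε t - oscp₂ M T X₀ ε t) a ↔
          TwoScaleWrt T X₀.φ (p₂ X₀ X) (fun t s => a t + profp₂ M T X₀ t s)) ∧
        (UnifConv T (fun ε t => θ₂ M T X₀ X ε t - oscθ₂ M T X₀ B.φ ε t) a ↔
          TwoScaleWrt T X₀.φ (θ₂ M T X₀ X) (fun t s => a t + profθ₂ M T X₀ B.φ t s))) ∧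
      -- the uniform convergences
      UnifConv T (fun ε t => θ₁ M X ε t - oscθ₁ M T X₀ ε t) (fun _ => 0) ∧
      UnifConv T (fun ε t => φ₂ X₀ X ε t - oscφ₂ M T X₀ ε t) B.φ ∧
      UnifConv T (fun ε t => y₂ X₀ X ε t - oscy₂ M T X₀ ε t) B.y ∧
      UnifConv T (fun ε t => p₂ X₀ X ε t - oscp₂ M T X₀ ε t) B.p ∧
      UnifConv T (fun ε t => θ₂ M T X₀ X ε t - oscθ₂ M T X₀ B.φ ε t) B.θ ∧
      -- the strong two-scale convergences with respect to `φ₀⁻¹ ∘ π`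
      TwoScaleWrt T X₀.φ (θ₁ M X) (profθ₁ M T X₀) ∧
      TwoScaleWrt T X₀.φ (φ₂ X₀ X) (fun t s => B.φ t + profφ₂ M T X₀ t s) ∧
      TwoScaleWrt T X₀.φ (y₂ X₀ X) (fun t s => B.y t + profy₂ M T X₀ t s) ∧
      TwoScaleWrt T X₀.φ (p₂ X₀ X) (fun t s => B.p t + profp₂ M T X₀ t s) ∧
      TwoScaleWrt T X₀.φ (θ₂ M T X₀ X) (fun t s => B.θ t + profθ₂ M T X₀ B.φ t s) := by
  have S : Setting M T X X₀ :=
    ⟨⟨hω, fun η => hωLow.trans_le (hωge η)⟩, hT, ⟨ωLow, hωLow, hωge⟩,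
      Filter.mem_of_superset (Ioo_mem_nhdsGT hε₀) hX, hX₀⟩
  obtain ⟨B, hB⟩ := S.exists_isSecondOrder
  obtain ⟨cφ, cθ, cy, cp⟩ := hB.continuousOn
  have hconv := S.uniform_convergences hB
  obtain ⟨u1, u2, u3, u4, u5⟩ := hconv
  -- The limit of `θ₁` has no averaged part, so the candidate is `a = 0`.
  have t1 := (S.equivalences cφ (continuousOn_const (c := 0))).1.1 u1
  simp only [zero_add] at t1
  exact ⟨B, hB, fun B' hB' => S.unique_isSecondOrder hB hB', fun a ha => S.equivalences cφ ha,
    u1, u2, u3, u4, u5, t1, (S.equivalences cφ cφ).2.1.1 u2, (S.equivalences cφ cy).2.2.1.1 u3,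
    (S.equivalences cφ cp).2.2.2.1.1 u4, (S.equivalences cφ cθ).2.2.2.2.1 u5⟩
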